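/- Fix $K\ge 1$ regressors and $T$ periods. Countries are indexed by $i,j=1,2,\dots$, and pairs with $i=j$ are not observed. Let $x_{ijt}\in\mathbb R^K$ be uniformly bounded regressors that are asymptotically non-collinear with the fixed effects: there is $c>0$ such that for all large $N$, all $b\in\mathbb R^K$ and all $p_{it},q_{jt},r_{ij}\in\mathbb R$, $$\sum_{i=1}^N\sum_{j\ne i}\sum_{t=1}^T\bigl(x_{ijt}'b-p_{it}-q_{jt}-r_{ij}\bigr)^2\ \ge\ c\,N^2\|b\|^2 .$$ Let $\Lambda\subseteq(0,\infty)$. Consider all data-generating processes $y_{ijt}=\lambda_{ijt}\omega_{ijt}$ ($i\neq j$), conditional on the regressors and fixed effects, with conditional means $\lambda_{ijt}=\exp(x_{ijt}'\beta+\alpha_{it}+\gamma_{jt}+\eta_{ij})\in\Lambda$, where the true $\beta\in\mathbb R^K$ is arbitrary, $\alpha_{it},\gamma_{jt},\eta_{ij}$ are uniformly bounded, and the disturbances $\omega_{ijt}>0$ are independent across $(i,j,t)$ with $\mathbb E\,\omega_{ijt}=1$ and $\sup_{i,j,t}\mathbb E\,\omega_{ijt}^{8+\nu}<\infty$ for some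 $\nu>0$. Their distributions may vary arbitrarily with $(i,j,t)$; in particular the conditional variance ${\rm Var}(y\mid x,\alpha,\gamma,\eta)$ is otherwise unrestricted. Let $g:(0,\infty)\to(0,\infty)$ be continuous. A three-way FE-PML estimate with weight $g$ from the data of $N$ countries is a parameter $\widehat\theta=(\widehat\beta,\widehat\alpha,\widehat\gamma,\widehat\eta)$, with $\widehat\lambda_{ijt}=\exp(x_{ijt}'\widehat\beta+\widehat\alpha_{it}+\widehat\gamma_{jt}+\widehat\eta_{ij})$, that maximizes the pseudo-likelihood $$\sum_{i}\sum_{j\neq i}\sum_t\Bigl(y_{ijt}\int_1^{\lambda_{ijt}}\tfrac{g(s)}{s}\,ds-\int_1^{\lambda_{ijt}}g(s)\,ds\Bigr)$$ and hence solves the first-order conditions $$\sum_{i}\sum_{j\neq i}\sum_t x_{ijt}(y_{ijt}-\widehat\lambda_{ijt})g(\widehat\lambda_{ijt})=0,\qquad \sum_{j\ne i}(y_{ijt}-\widehat\lambda_{ijt})g(\widehat\lambda_{ijt})=0\ \ \forall i,t,$$ $$\sum_{i\neq j}(y_{ijt}-\widehat\lambda_{ijt})g(\widehat\lambda_{ijt})=0\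 \ \forall j,t,\qquad \sum_t(y_{ijt}-\widehat\lambda_{ijt})g(\widehat\lambda_{ijt})=0\ \ \forall i\ne j .$$ Suppose an estimator (for each $N$, a function of the outcomes of the first $N$ countries) is such that under every one of these data-generating processes, as $N\to\infty$ with $T$ fixed, it is an FE-PML estimate with weight $g$ with probability tending to one, and $\widehat\beta_N$ converges in probability to the true $\beta$. Then $g$ is constant on $\Lambda$. Consequently the estimator is equivalent to FE-PPML there: for every $N$, every data set $y$ and every parameter whose $\lambda_{ijt}$ ($i\ne j$) all lie in $\Lambda$, the first-order conditions with weight $g$ hold if and only if those with weight $1$ (FE-PPML) hold. -/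

import Mathlib

open MeasureTheory ProbabilityTheory Filter Topology

noncomputable section

/-- Parameters of the three-way gravity model with countries indexed by `ι`, `T` periods and `K`
regressors: the slope `β`, the exporter-time effects `α i t`, the importer-time effects `γ j t` and
the pair effects `η i j`. -/
structure GravityParams (K T : ℕ) (ι : Type) where
  β : EuclideanSpace ℝ (Fin K)
  α : ι → Fin T → ℝ
  γ : ι → Fin T → ℝ
  η : ι → ι → ℝ

/-- Regressors `x i j t` (a vector in `ℝ^K`). -/
abbrev Regressors (K T : ℕ) (ι : Type) : Type := ι → ι → Fin T → EuclideanSpace ℝ (Fin K)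

/-- The conditional mean `λ_{ijt} = exp (x_{ijt}' β + α_{it} + γ_{jt} + η_{ij})`. -/
def gravityMean {K T : ℕ} {ι : Type} (x : Regressors K T ι) (θ : GravityParams K T ι)
    (i j : ι) (t : Fin T) : ℝ :=
  Real.exp (inner ℝ (x i j t) θ.β + θ.α i t + θ.γ j t + θ.η i j)

/-- The regressors of the first `N` countries. -/
def sampleRegressors {K T : ℕ} (x : Regressors K T ℕ) (N : ℕ) : Regressors K T (Fin N) :=
  fun i j t => x i j t

/-- The first-order conditions weighted by `g`, for `N` countries (no observation has `i = j`). -/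
structure SolvesFOC (g : ℝ → ℝ) {K T N : ℕ} (x : Regressors K T (Fin N))
    (y : Fin N → Fin N → Fin T → ℝ) (θ : GravityParams K T (Fin N)) : Prop where
  foc_β : ∑ i, ∑ j ∈ Finset.univ.erase i, ∑ t,
    ((y i j t - gravityMean x θ i j t) * g (gravityMean x θ i j t)) • x i j t = 0
  foc_α : ∀ i t, ∑ j ∈ Finset.univ.erase i,
    (y i j t - gravityMean x θ i j t) * g (gravityMean x θ i j t) = 0
  foc_γ : ∀ j t, ∑ i ∈ Finset.univ.erase j,
    (y i j t - gravityMean x θ i j t) * g (gravityMean x θ i j t) = 0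
  foc_η : ∀ i j, i ≠ j → ∑ t,
    (y i j t - gravityMean x θ i j t) * g (gravityMean x θ i j t) = 0

/-- The pseudo-log-likelihood `∑ (y ∫ g(λ)/λ dλ - ∫ g(λ) dλ)` belonging to the weight `g`; the
choice of `1` as the lower end of the integrals only changes it by a term free of `θ`. -/
def pseudoLogLik (g : ℝ → ℝ) {K T N : ℕ} (x : Regressors K T (Fin N))
    (y : Fin N → Fin N → Fin T → ℝ) (θ : GravityParams K T (Fin N)) : ℝ :=
  ∑ i, ∑ j ∈ Finset.univ.erase i, ∑ t,
    (y i j t * (∫ s in (1 : ℝ)..(gravityMean x θ i j t), g s / s)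
      - ∫ s in (1 : ℝ)..(gravityMean x θ i j t), g s)

/-- `θ` is a three-way fixed-effects pseudo-maximum-likelihood (FE-PML) estimate with weight `g`:
it maximizes the pseudo-likelihood and solves its first-order conditions. -/
structure IsFEPML (g : ℝ → ℝ) {K T N : ℕ} (x : Regressors K T (Fin N))
    (y : Fin N → Fin N → Fin T → ℝ) (θ : GravityParams K T (Fin N)) : Prop where
  solvesFOC : SolvesFOC g x y θ
  isMax : ∀ θ' : GravityParams K T (Fin N), pseudoLogLik g x y θ' ≤ pseudoLogLik g x y θ

/-- The regressors are uniformly bounded and asymptotically not collinear with the three sets of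
fixed effects: no nonzero combination of them is, in mean square, absorbed by the fixed effects. -/
structure RegularRegressors {K T : ℕ} (x : Regressors K T ℕ) : Prop where
  bounded : ∃ B : ℝ, ∀ i j t, ‖x i j t‖ ≤ B
  noncollinear : ∃ c : ℝ, 0 < c ∧ ∀ᶠ N : ℕ in atTop,
    ∀ (b : EuclideanSpace ℝ (Fin K)) (p q : Fin N → Fin T → ℝ) (r : Fin N → Fin N → ℝ),
      c * (N : ℝ) ^ 2 * ‖b‖ ^ 2 ≤
        ∑ i, ∑ j ∈ Finset.univ.erase i, ∑ t,
          (inner ℝ (sampleRegressors x N i j t) b - p i t - q j t - r i j) ^ 2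

/-- A data-generating process `y = λ ω` of the three-way model, conditional on the regressors and
the fixed effects, whose conditional means all lie in `Λ`. The true fixed effects are uniformly
bounded; the disturbances are positive, independent, with mean one and uniformly bounded moments of
some order above eight. Their distributions are otherwise arbitrary and may vary with `(i, j, t)`,
so the conditional variance of `y` may depend on the regressors and on all fixed effects. -/
structure GravityDGP {K T : ℕ} (x : Regressors K T ℕ) (Λ : Set ℝ)
    {Ω : Type} [MeasurableSpace Ω] (P : Measure Ω) where
  θ : GravityParams K T ℕ
  ω : ℕ → ℕ → Fin T → Ω → ℝ
  bounded_effects : ∃ B : ℝ, (∀ i t, |θ.α i t| ≤ B) ∧ (∀ j t, |θ.γ j t| ≤ B) ∧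
    ∀ i j, |θ.η i j| ≤ B
  mean_mem : ∀ i j t, i ≠ j → gravityMean x θ i j t ∈ Λ
  measurable : ∀ i j t, i ≠ j → Measurable (ω i j t)
  pos : ∀ i j t, i ≠ j → ∀ᵐ w ∂P, 0 < ω i j t w
  mean_one : ∀ i j t, i ≠ j → ∫ w, ω i j t w ∂P = 1
  moments : ∃ ν M : ℝ, 0 < ν ∧ ∀ i j t, i ≠ j →
    ∫⁻ w, ENNReal.ofReal (ω i j t w ^ (8 + ν)) ∂P ≤ ENNReal.ofReal M
  indep : iIndepFun
    (fun (p : {p : ℕ × ℕ × Fin T // p.1 ≠ p.2.1}) (w : Ω) => ω p.1.1 p.1.2.1 p.1.2.2 w) P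

/-- The observed outcomes of the first `N` countries; the unobserved diagonal is filled with `0`. -/
def GravityDGP.sample {K T : ℕ} {x : Regressors K T ℕ} {Λ : Set ℝ}
    {Ω : Type} [MeasurableSpace Ω] {P : Measure Ω} (D : GravityDGP x Λ P) (N : ℕ) (w : Ω) :
    Fin N → Fin N → Fin T → ℝ :=
  fun i j t => if i = j then 0 else gravityMean x D.θ i j t * D.ω i j t w

/-- An estimator: for each number `N` of countries, a function of the outcomes. -/
abbrev GravityEstimator (K T : ℕ) : Type :=
  (N : ℕ) → (Fin N → Fin N → Fin T → ℝ) → GravityParams K T (Fin N)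

/-- Under the process `D`, the estimator is, with probability approaching one as `N → ∞`, an FE-PML
estimate with weight `g`. -/
def IsFEPMLEstimatorUnder (g : ℝ → ℝ) {K T : ℕ} {x : Regressors K T ℕ} {Λ : Set ℝ}
    {Ω : Type} [MeasurableSpace Ω] {P : Measure Ω} (D : GravityDGP x Λ P)
    (est : GravityEstimator K T) : Prop :=
  Tendsto (fun N : ℕ => P {w | ¬ IsFEPML g (sampleRegressors x N) (D.sample N w)
    (est N (D.sample N w))}) atTop (𝓝 0)

/-- Under the process `D`, the estimator of `β` is consistent as `N → ∞` (with `T` fixed). -/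
def IsConsistentUnder {K T : ℕ} {x : Regressors K T ℕ} {Λ : Set ℝ}
    {Ω : Type} [MeasurableSpace Ω] {P : Measure Ω} (D : GravityDGP x Λ P)
    (est : GravityEstimator K T) : Prop :=
  TendstoInMeasure P (fun (N : ℕ) (w : Ω) => (est N (D.sample N w)).β) atTop (fun _ => D.θ.β)

end

/-! A pair effect is estimated from only `T` observations, so its error does not vanish as `N → ∞`,
and a weight that varies with the fitted mean turns this error into bias. Suppose `g l₂ ≠ g l₁` with
`l₁ ∈ Λ` and `l₁ < l₂`. Take `β = 0`, all conditional means equal to `l₁`, and disturbances equal to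
one except on a fixed set `S` of pairs in one period `t₀`. There they are `u` with a small
probability `p` and slightly below one otherwise, with mean one. The size `u` is such that the
outcomes of a pair hit by the shock average to `l₂` over time. If the slope and the country-time
effects are estimated well, the pair effect lifts all fitted means of such a pair to about `l₂`. Its
score then carries the weight `g l₂`, that of the other pairs about `g l₁`. Let `v` be a regressor
from which the three sets of fixed effects have been partialled out. Up to a positive factor, the
score in the direction `v` is about `p (u - 1) (g l₂ - g l₁)` times the sum of `v` over `S` in
period `t₀`. For suitable `S` this is of order `N ^ 2`, whereas the first-order conditions make it
zero.

Three points need work. Consistency concerns the slope alone, so `exists_effects_bound` derives from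
global maximality that the country-time effects are small up to a common shift: resetting the large
ones would raise the pseudo-likelihood. Next, the remainder of the score must be small relative to
`p`, not merely small. The energy estimate `sum_sq_fittedLog_le` bounds the mean square of the fits
outside the shocks by order `p ^ 2`, and `score_bias_le` then isolates the bias;
`exists_contamination_contradiction` fixes the constants. Finally, `v` depends on `N` but the
process may not, so `S` is built by a gliding hump in `exists_set_frequently_sum_ge` and works for
infinitely many `N`, which is enough.

Hoeffding's inequality makes the random set of shocks sparse in every row and column and almost
uncorrelated with `v` beyond its mean (`eventually_events_regular`). The argument is assembled in
`weight_eq_of_lt`. -/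

/-- The deviance, up to a constant, of a fitted log-mean `δ` from the outcome `ω`. -/
noncomputable def deviance (h : ℝ → ℝ) (ω δ : ℝ) : ℝ := ∫ τ in (0 : ℝ)..δ, (Real.exp τ - ω) * h τ

/-! ### Deviance of a single observation. -/

section Deviance

variable {h : ℝ → ℝ}

theorem hasDerivAt_deviance (hc : Continuous h) (ω δ : ℝ) :
    HasDerivAt (deviance h ω) ((Real.exp δ - ω) * h δ) δ := by
  have hf : Continuous fun τ => (Real.exp τ - ω) * h τ := by fun_prop
  exact intervalIntegral.integral_hasDerivAt_right (hf.intervalIntegrable _ _)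
    hf.aestronglyMeasurable.stronglyMeasurableAtFilter hf.continuousAt

theorem deviance_zero (ω : ℝ) : deviance h ω 0 = 0 := by simp [deviance]

theorem continuous_deviance (hc : Continuous h) (ω : ℝ) : Continuous (deviance h ω) :=
  continuous_iff_continuousAt.2 fun δ => (hasDerivAt_deviance hc ω δ).continuousAt

theorem deviance_eq_add (hc : Continuous h) (ω δ : ℝ) :
    deviance h ω δ = deviance h 1 δ + (1 - ω) * ∫ τ in (0 : ℝ)..δ, h τ := by
  have h1 : Continuous fun τ => (Real.exp τ - 1) * h τ := by fun_prop
  rw [deviance, deviance, ← intervalIntegral.integral_const_mul, ← intervalIntegral.integral_add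
    (h1.intervalIntegrable _ _) ((hc.const_mul _).intervalIntegrable _ _)]
  congr 1
  ext τ
  ring

theorem monotoneOn_deviance (hc : Continuous h) (hpos : ∀ τ, 0 < h τ) {ω : ℝ} (hω : 0 < ω) :
    MonotoneOn (deviance h ω) (Set.Ici (Real.log ω)) := by
  refine monotoneOn_of_deriv_nonneg (convex_Ici _) (continuous_deviance hc ω).continuousOn
    (fun δ _ => (hasDerivAt_deviance hc ω δ).differentiableAt.differentiableWithinAt) ?_
  intro δ hδ
  rw [(hasDerivAt_deviance hc ω δ).deriv]
  rw [interior_Ici] at hδ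
  have : ω ≤ Real.exp δ := by
    rw [← Real.log_le_iff_le_exp hω]
    exact le_of_lt hδ
  exact mul_nonneg (by linarith) (hpos δ).le

theorem antitoneOn_deviance (hc : Continuous h) (hpos : ∀ τ, 0 < h τ) {ω : ℝ} (hω : 0 < ω) :
    AntitoneOn (deviance h ω) (Set.Iic (Real.log ω)) := by
  refine antitoneOn_of_deriv_nonpos (convex_Iic _) (continuous_deviance hc ω).continuousOn
    (fun δ _ => (hasDerivAt_deviance hc ω δ).differentiableAt.differentiableWithinAt) ?_
  intro δ hδ
  rw [(hasDerivAt_deviance hc ω δ).deriv]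
  rw [interior_Iic] at hδ
  have : Real.exp δ ≤ ω := by
    rw [← Real.le_log_iff_exp_le hω]
    exact le_of_lt hδ
  exact mul_nonpos_of_nonpos_of_nonneg (by linarith) (hpos δ).le

theorem deviance_log_le (hc : Continuous h) (hpos : ∀ τ, 0 < h τ) {ω : ℝ} (hω : 0 < ω) (δ : ℝ) :
    deviance h ω (Real.log ω) ≤ deviance h ω δ := by
  rcases le_total (Real.log ω) δ with H | H
  · exact monotoneOn_deviance hc hpos hω (Set.mem_Ici.2 le_rfl) H H
  · exact antitoneOn_deviance hc hpos hω H (Set.mem_Iic.2 le_rfl) H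

theorem deviance_one_pos (hc : Continuous h) (hpos : ∀ τ, 0 < h τ) {δ : ℝ} (hδ : δ ≠ 0) :
    0 < deviance h 1 δ := by
  have hd := hasDerivAt_deviance hc 1
  rcases lt_or_gt_of_ne hδ with H | H
  · have : StrictAntiOn (deviance h 1) (Set.Iic 0) := by
      refine strictAntiOn_of_deriv_neg (convex_Iic _) (continuous_deviance hc 1).continuousOn ?_
      intro τ hτ
      rw [interior_Iic] at hτ
      rw [(hd τ).deriv]
      have : Real.exp τ < 1 := Real.exp_lt_one_iff.2 hτ
      exact mul_neg_of_neg_of_pos (by linarith) (hpos τ)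
    simpa [deviance_zero] using this (Set.mem_Iic.2 H.le) (Set.mem_Iic.2 le_rfl) H
  · have : StrictMonoOn (deviance h 1) (Set.Ici 0) := by
      refine strictMonoOn_of_deriv_pos (convex_Ici _) (continuous_deviance hc 1).continuousOn ?_
      intro τ hτ
      rw [interior_Ici] at hτ
      rw [(hd τ).deriv]
      have : 1 < Real.exp τ := Real.one_lt_exp_iff.2 hτ
      exact mul_pos (by linarith) (hpos τ)
    simpa [deviance_zero] using this (Set.mem_Ici.2 le_rfl) (Set.mem_Ici.2 H.le) H

/-- For `ω` near one the deviance is close, uniformly on bounded sets of fits, to that of `1`. -/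
theorem exists_deviance_near (hc : Continuous h) (r : ℝ) {e : ℝ} (he : 0 < e) :
    ∃ π : ℝ, 0 < π ∧ ∀ ω δ : ℝ, |1 - ω| ≤ π → |δ| ≤ r →
      |deviance h ω δ - deviance h 1 δ| ≤ e := by
  have hI : Continuous fun δ : ℝ => ∫ τ in (0 : ℝ)..δ, h τ :=
    intervalIntegral.continuous_primitive (fun a b => hc.intervalIntegrable a b) 0
  obtain ⟨C, hC⟩ := (isCompact_Icc (a := -r) (b := r)).exists_bound_of_continuousOn hI.continuousOn
  refine ⟨e / (|C| + 1), by positivity, fun ω δ hω hδ => ?_⟩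
  have h1 := hC δ (abs_le.1 hδ)
  rw [deviance_eq_add hc ω δ, add_sub_cancel_left, abs_mul]
  rw [Real.norm_eq_abs] at h1
  calc |1 - ω| * |∫ τ in (0 : ℝ)..δ, h τ| ≤ e / (|C| + 1) * (|C| + 1) := by
        gcongr
        linarith [le_abs_self C]
    _ = e := by field_simp

/-- No growth of `h` at infinity is assumed. The deviance is unimodal around `log ω`, which lies in
`[-κ, 0]`, so it suffices to bound it at `-κ` and `κ`, where it is close to the positive deviance of
the outcome one. -/
theorem exists_deviance_lower (hc : Continuous h) (hpos : ∀ τ, 0 < h τ) {κ : ℝ} (hκ : 0 < κ) :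
    ∃ c π : ℝ, 0 < c ∧ 0 < π ∧ ∀ ω δ : ℝ, 1 - π ≤ ω → ω ≤ 1 → κ ≤ |δ| → c ≤ deviance h ω δ := by
  obtain ⟨c, hc0, hc1⟩ : ∃ c > 0, 2 * c ≤ deviance h 1 κ ∧ 2 * c ≤ deviance h 1 (-κ) := by
    refine ⟨min (deviance h 1 κ) (deviance h 1 (-κ)) / 2, ?_, ?_, ?_⟩
    · exact half_pos (lt_min (deviance_one_pos hc hpos hκ.ne')
        (deviance_one_pos hc hpos (neg_ne_zero.2 hκ.ne')))
    · linarith [min_le_left (deviance h 1 κ) (deviance h 1 (-κ))]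
    · linarith [min_le_right (deviance h 1 κ) (deviance h 1 (-κ))]
  obtain ⟨π, hπ, H⟩ := exists_deviance_near hc κ hc0
  refine ⟨c, min π (1 - Real.exp (-κ)), hc0, lt_min hπ (by simpa using hκ), ?_⟩
  intro ω δ h1 h2 h3
  have h4 := min_le_left π (1 - Real.exp (-κ))
  have h5 := min_le_right π (1 - Real.exp (-κ))
  have hω : 0 < ω := by linarith [Real.exp_pos (-κ)]
  have hωa : |1 - ω| ≤ π := by rw [abs_of_nonneg (by linarith)]; linarith
  have hl0 : Real.log ω ≤ 0 := Real.log_nonpos hω.le h2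
  have hl1 : -κ ≤ Real.log ω := by
    rw [Real.le_log_iff_exp_le hω]; linarith
  rcases le_abs'.1 h3 with h6 | h6
  · have := abs_le.1 (H ω (-κ) hωa (by rw [abs_neg, abs_of_pos hκ]))
    have := antitoneOn_deviance hc hpos hω (Set.mem_Iic.2 (h6.trans hl1)) (Set.mem_Iic.2 hl1) h6
    linarith
  · have := abs_le.1 (H ω κ hωa (by rw [abs_of_pos hκ]))
    have := monotoneOn_deviance hc hpos hω (Set.mem_Ici.2 (hl0.trans hκ.le))
      (Set.mem_Ici.2 (hl0.trans (hκ.le.trans h6))) h6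
    linarith

/-- The minimum is attained at `log ω`, which is near zero, and there the deviance is close to that
of the outcome one, which is nonnegative. -/
theorem exists_deviance_ge_neg (hc : Continuous h) (hpos : ∀ τ, 0 < h τ) {e : ℝ} (he : 0 < e) :
    ∃ π : ℝ, 0 < π ∧ ∀ ω δ : ℝ, 1 - π ≤ ω → ω ≤ 1 → -e ≤ deviance h ω δ := by
  obtain ⟨π, hπ, H⟩ := exists_deviance_near hc 1 he
  refine ⟨min π (1 - Real.exp (-1)), lt_min hπ (by simp), fun ω δ h1 h2 => ?_⟩
  have h4 := min_le_left π (1 - Real.exp (-1))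
  have h5 := min_le_right π (1 - Real.exp (-1))
  have hω : 0 < ω := by linarith [Real.exp_pos (-1)]
  have hωa : |1 - ω| ≤ π := by rw [abs_of_nonneg (by linarith)]; linarith
  have hl0 : Real.log ω ≤ 0 := Real.log_nonpos hω.le h2
  have hl1 : -1 ≤ Real.log ω := by
    rw [Real.le_log_iff_exp_le hω]; linarith
  have h6 := abs_le.1 (H ω (Real.log ω) hωa (abs_le.2 ⟨hl1, hl0.trans zero_le_one⟩))
  have h7 : 0 ≤ deviance h 1 (Real.log ω) := by
    simpa [deviance_zero] using deviance_log_le hc hpos one_pos (Real.log ω)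
  linarith [deviance_log_le hc hpos hω δ]

theorem exists_deviance_upper (hc : Continuous h) {e : ℝ} (he : 0 < e) :
    ∃ κ π : ℝ, 0 < κ ∧ 0 < π ∧ ∀ ω δ : ℝ, 1 - π ≤ ω → ω ≤ 1 → |δ| ≤ κ → deviance h ω δ ≤ e := by
  obtain ⟨π, hπ, H⟩ := exists_deviance_near hc 1 (half_pos he)
  have h1 := Metric.continuousAt_iff.1 ((continuous_deviance hc 1).continuousAt (x := 0)) (e / 2)
    (half_pos he)
  obtain ⟨κ, hκ, h1⟩ := h1
  refine ⟨min (κ / 2) 1, π, by positivity, hπ, fun ω δ h2 h3 h4 => ?_⟩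
  have h5 := abs_le.1 (H ω δ (by rw [abs_of_nonneg (by linarith)]; linarith)
    (h4.trans (min_le_right _ _)))
  have h6 := @h1 δ (by rw [Real.dist_eq, sub_zero]; linarith [min_le_left (κ / 2) 1])
  rw [deviance_zero, Real.dist_eq, sub_zero] at h6
  linarith [le_abs_self (deviance h 1 δ)]

/-- Crude bounds for the few shocked observations: from below for every fit, from above only for
fits of size at most one. -/
theorem exists_deviance_bound (hc : Continuous h) (hpos : ∀ τ, 0 < h τ) {u : ℝ} (hu : 0 < u) :
    ∃ C : ℝ, 0 < C ∧ (∀ δ, -C ≤ deviance h u δ) ∧ ∀ δ, |δ| ≤ 1 → deviance h u δ ≤ C := by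
  obtain ⟨C, hC⟩ := (isCompact_Icc (a := (-1 : ℝ)) (b := 1)).exists_bound_of_continuousOn
    (continuous_deviance hc u).continuousOn
  refine ⟨|C| + |deviance h u (Real.log u)| + 1, by positivity, fun δ => ?_, fun δ hδ => ?_⟩
  · have := deviance_log_le hc hpos hu δ
    linarith [neg_abs_le (deviance h u (Real.log u)), abs_nonneg C]
  · have := hC δ (abs_le.1 hδ)
    linarith [Real.le_norm_self (deviance h u δ), le_abs_self C,
      abs_nonneg (deviance h u (Real.log u))]

end Deviance

/-! ### Sparse sets of pairs and additive arrays that are mostly small. -/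

theorem card_offDiag_le {ι : Type*} [Fintype ι] :
    ((Finset.univ : Finset ι).offDiag.card : ℝ) ≤ (Fintype.card ι : ℝ) ^ 2 := by
  rw [Finset.offDiag_card, Finset.card_univ, ← Nat.cast_pow, sq]
  exact_mod_cast Nat.sub_le _ _

section SparsePairs

variable {ι : Type*} [Fintype ι] [DecidableEq ι]

/-- A set of off-diagonal pairs which contains at most a fraction `π` of each row and column. -/
structure SparsePairs (E : Finset (ι × ι)) (π : ℝ) : Prop where
  offDiag : E ⊆ Finset.univ.offDiag
  row : ∀ i, ((E.filter fun q => q.1 = i).card : ℝ) ≤ π * Fintype.card ι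
  col : ∀ j, ((E.filter fun q => q.2 = j).card : ℝ) ≤ π * Fintype.card ι

variable {E : Finset (ι × ι)} {π : ℝ}

theorem SparsePairs.sum_row_le (hE : SparsePairs E π) {a : ι → ℝ} (ha : ∀ i, 0 ≤ a i) :
    ∑ q ∈ E, a q.1 ≤ π * Fintype.card ι * ∑ i, a i := by
  rw [← Finset.sum_fiberwise E Prod.fst, Finset.mul_sum]
  refine Finset.sum_le_sum fun i _ => ?_
  rw [Finset.sum_congr rfl (g := fun _ => a i)
    (fun q hq => by rw [(Finset.mem_filter.1 hq).2]), Finset.sum_const, nsmul_eq_mul]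
  exact mul_le_mul_of_nonneg_right (hE.row i) (ha i)

theorem SparsePairs.sum_col_le (hE : SparsePairs E π) {a : ι → ℝ} (ha : ∀ i, 0 ≤ a i) :
    ∑ q ∈ E, a q.2 ≤ π * Fintype.card ι * ∑ i, a i := by
  rw [← Finset.sum_fiberwise E Prod.snd, Finset.mul_sum]
  refine Finset.sum_le_sum fun i _ => ?_
  rw [Finset.sum_congr rfl (g := fun _ => a i)
    (fun q hq => by rw [(Finset.mem_filter.1 hq).2]), Finset.sum_const, nsmul_eq_mul]
  exact mul_le_mul_of_nonneg_right (hE.col i) (ha i)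

theorem SparsePairs.card_le (hE : SparsePairs E π) :
    (E.card : ℝ) ≤ π * (Fintype.card ι : ℝ) ^ 2 := by
  have := hE.sum_row_le (a := fun _ => 1) (fun _ => zero_le_one)
  simp only [Finset.sum_const, nsmul_eq_mul, mul_one, Finset.card_univ] at this
  linarith

/-- If all but few pairs have a small sum `P i + Q j`, then up to a common shift all but few `P i`
and all but few `Q j` are small. -/
theorem exists_common_shift {V : Type*} [SeminormedAddCommGroup V] (P Q : ι → V)
    {B : Finset (ι × ι)} {η ρ : ℝ} (hη : 0 < η) (hη8 : η ≤ 1 / 8)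
    (hN : 1 ≤ η * Fintype.card ι) (hB : (B.card : ℝ) ≤ η * (Fintype.card ι : ℝ) ^ 2)
    (hPQ : ∀ i j, i ≠ j → (i, j) ∉ B → ‖P i + Q j‖ ≤ ρ) :
    ∃ i₀, ((Finset.univ.filter fun i => 2 * ρ < ‖P i - P i₀‖).card : ℝ) ≤ 2 * η * Fintype.card ι ∧
      ((Finset.univ.filter fun j => 2 * ρ < ‖Q j + P i₀‖).card : ℝ) ≤ 2 * η * Fintype.card ι := by
  set N : ℝ := (Fintype.card ι : ℝ) with hNdef
  have hNpos : 0 < N := by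
    by_contra hcon
    nlinarith
  have hsum : (B.card : ℝ) = ∑ i, ((B.filter fun q => q.1 = i).card : ℝ) := by
    rw [Finset.card_eq_sum_card_fiberwise (f := Prod.fst) (t := Finset.univ) (by simp)]
    push_cast
    rfl
  -- Pigeonhole: some row contains at most the average number of bad pairs. It serves as the
  -- reference row.
  obtain ⟨i₀, -, hi₀⟩ : ∃ i ∈ (Finset.univ : Finset ι),
      ((B.filter fun q => q.1 = i).card : ℝ) ≤ η * N := by
    apply Finset.exists_le_of_sum_le
    · have : 0 < Fintype.card ι := by
        rw [hNdef] at hNpos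
        exact_mod_cast hNpos
      exact Finset.univ_nonempty_iff.2 (Fintype.card_pos_iff.1 this)
    · rw [← hsum, Finset.sum_const, nsmul_eq_mul, Finset.card_univ, ← hNdef]
      linarith
  have hρ : 0 ≤ ρ := by
    by_contra hcon
    have hall : (Finset.univ : Finset ι).offDiag ⊆ B := by
      intro q hq
      by_contra hqB
      have := hPQ q.1 q.2 (by simpa using hq) hqB
      linarith [norm_nonneg (P q.1 + Q q.2)]
    have h1 := Finset.card_le_card hall
    have h2 : ((Finset.univ : Finset ι).offDiag.card : ℝ) = N ^ 2 - N := by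
      rw [Finset.offDiag_card, Finset.card_univ, Nat.cast_sub (Nat.le_mul_self _)]
      push_cast
      ring
    have h3 : N ^ 2 - N ≤ η * N ^ 2 := by
      rw [← h2]
      exact le_trans (by exact_mod_cast h1) hB
    nlinarith
  have hcols : ((Finset.univ.filter fun j => ρ < ‖Q j + P i₀‖).card : ℝ) ≤ 2 * η * N := by
    have : (Finset.univ.filter fun j => ρ < ‖Q j + P i₀‖) ⊆
        insert i₀ ((B.filter fun q => q.1 = i₀).image Prod.snd) := by
      intro j hj
      rw [Finset.mem_filter] at hj
      rw [Finset.mem_insert, Finset.mem_image]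
      by_cases hij : j = i₀
      · exact Or.inl hij
      · refine Or.inr ⟨(i₀, j), ?_, rfl⟩
        rw [Finset.mem_filter]
        refine ⟨?_, rfl⟩
        by_contra hcon
        have := hPQ i₀ j (Ne.symm hij) hcon
        rw [add_comm] at this
        linarith [hj.2]
    have h1 := (Finset.card_le_card this).trans (Finset.card_insert_le _ _)
    have h2 : ((B.filter fun q => q.1 = i₀).image Prod.snd).card ≤
      (B.filter fun q => q.1 = i₀).card := Finset.card_image_le
    have h3 : ((Finset.univ.filter fun j => ρ < ‖Q j + P i₀‖).card : ℝ) ≤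
        ((B.filter fun q => q.1 = i₀).card : ℝ) + 1 := by exact_mod_cast h1.trans (by omega)
    linarith
  refine ⟨i₀, ?_, ?_⟩
  · set bad := Finset.univ.filter fun i => 2 * ρ < ‖P i - P i₀‖ with hbad
    set good := Finset.univ.filter fun j => ¬ ρ < ‖Q j + P i₀‖ with hgood
    have hgc : N - 2 * η * N ≤ (good.card : ℝ) := by
      have := Finset.card_filter_add_card_filter_not (s := (Finset.univ : Finset ι))
        (fun j => ρ < ‖Q j + P i₀‖)
      rw [Finset.card_univ] at this
      have h4 : ((Finset.univ.filter fun j => ρ < ‖Q j + P i₀‖).card : ℝ) + good.card = N := by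
        rw [hNdef]
        exact_mod_cast this
      linarith
    -- A bad row and a good column meet in a pair of `B`, since `P i - P i₀` is the difference of `P
    -- i + Q j` and `Q j + P i₀`. At least about half of the columns are good, so bad rows are few.
    have hsub : (bad ×ˢ good) \ (bad.image fun i => (i, i)) ⊆ B := by
      intro q hq
      rw [Finset.mem_sdiff, Finset.mem_product] at hq
      obtain ⟨⟨h1, h2⟩, h3⟩ := hq
      have hne : q.1 ≠ q.2 := by
        intro heq
        apply h3
        rw [Finset.mem_image]
        exact ⟨q.1, h1, Prod.ext rfl heq⟩
      by_contra hqB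
      have h4 := hPQ q.1 q.2 hne hqB
      have h5 := (Finset.mem_filter.1 h1).2
      have h6 := not_lt.1 (Finset.mem_filter.1 h2).2
      have h7 : ‖P q.1 - P i₀‖ ≤ ‖P q.1 + Q q.2‖ + ‖Q q.2 + P i₀‖ := by
        have : P q.1 - P i₀ = (P q.1 + Q q.2) - (Q q.2 + P i₀) := by abel
        rw [this]
        exact norm_sub_le _ _
      linarith
    have h1 := (Finset.le_card_sdiff _ _).trans (Finset.card_le_card hsub)
    have h2 : (bad.image fun i => (i, i)).card ≤ bad.card := Finset.card_image_le
    rw [Finset.card_product] at h1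
    have h3 : (bad.card : ℝ) * good.card - bad.card ≤ B.card := by
      have : bad.card * good.card ≤ B.card + bad.card := by omega
      have : (bad.card : ℝ) * good.card ≤ B.card + bad.card := by exact_mod_cast this
      linarith
    have h4 : (bad.card : ℝ) * (N / 2) ≤ η * N ^ 2 := by
      have h5 : N / 2 ≤ (good.card : ℝ) - 1 := by nlinarith
      have h6 : (0 : ℝ) ≤ bad.card := Nat.cast_nonneg _
      nlinarith
    have h7 : (bad.card : ℝ) * (N / 2) ≤ (2 * η * N) * (N / 2) := by linarith
    exact le_of_mul_le_mul_right h7 (by positivity)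
  · refine le_trans ?_ hcols
    have : (Finset.univ.filter fun j => 2 * ρ < ‖Q j + P i₀‖) ⊆
        Finset.univ.filter fun j => ρ < ‖Q j + P i₀‖ := by
      intro j hj
      rw [Finset.mem_filter] at hj ⊢
      exact ⟨hj.1, by linarith [hj.2]⟩
    exact_mod_cast Finset.card_le_card this

end SparsePairs

/-! ### Size of the country-time effects of a minimizer. -/

/-- The fitted log-means `ξ + P + Q + R` with exporter-time, importer-time and pair effects. -/
def fittedLog {ι : Type*} {T : ℕ} (ξ : ι → ι → Fin T → ℝ) (P Q : ι → Fin T → ℝ) (R : ι → ι → ℝ)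
    (i j : ι) (t : Fin T) : ℝ := ξ i j t + P i t + Q j t + R i j

section EffectsBound

variable {ι : Type*} [Fintype ι] [DecidableEq ι] {T : ℕ}

theorem exists_norm_lt_of_lt_norm {v : Fin T → ℝ} {r : ℝ} (hr : 0 ≤ r) (h : r < ‖v‖) :
    ∃ t, r < |v t| := by
  by_contra! hcon
  exact absurd ((pi_norm_le_iff_of_nonneg hr).2 hcon) (not_le.2 h)

/-- A counting argument: with all effects zero the fit is `ξ` and costs at most `e` per pair outside
`E` and `C` per pair in `E`. A minimizer costs no more, so only few pairs can each incur `c₁`. On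
`E` only the bound `-C` is available, so counting `c₁` there as well loses `C + c₁` per pair. -/
theorem card_filter_abs_le {Φ : ι → ι → (Fin T → ℝ) → ℝ} {ξ δ : ι → ι → Fin T → ℝ}
    {E : Finset (ι × ι)} {π κ₁ ξ₀ c₁ e C η : ℝ} (hE : SparsePairs E π)
    (hc₁ : 0 < c₁) (he : 0 ≤ e) (hC : 0 ≤ C)
    (hlow : ∀ i j, i ≠ j → (i, j) ∉ E → ∀ d, -e ≤ Φ i j d)
    (hfar : ∀ i j, i ≠ j → (i, j) ∉ E → ∀ d, (∃ t, κ₁ ≤ |d t|) → c₁ ≤ Φ i j d)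
    (hnear : ∀ i j, i ≠ j → (i, j) ∉ E → ∀ d, (∀ t, |d t| ≤ ξ₀) → Φ i j d ≤ e)
    (hElow : ∀ i j, (i, j) ∈ E → ∀ d, -C ≤ Φ i j d)
    (hEup : ∀ i j, i ≠ j → ∀ d, (∀ t, |d t| ≤ ξ₀) → Φ i j d ≤ C)
    (hξ : ∀ i j t, |ξ i j t| ≤ ξ₀)
    (hmin : ∑ q ∈ Finset.univ.offDiag, Φ q.1 q.2 (δ q.1 q.2) ≤
      ∑ q ∈ Finset.univ.offDiag, Φ q.1 q.2 (ξ q.1 q.2))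
    (hη : 2 * e + (2 * C + c₁) * π ≤ η * c₁) :
    ((Finset.univ.offDiag.filter fun q : ι × ι => q ∈ E ∨ ∃ t, κ₁ ≤ |δ q.1 q.2 t|).card : ℝ) ≤
      η * (Fintype.card ι : ℝ) ^ 2 := by
  classical
  set N : ℝ := (Fintype.card ι : ℝ)
  set O : Finset (ι × ι) := Finset.univ.offDiag with hO
  set B := O.filter fun q : ι × ι => q ∈ E ∨ ∃ t, κ₁ ≤ |δ q.1 q.2 t| with hB
  have hOc : (O.card : ℝ) ≤ N ^ 2 := card_offDiag_le
  have hEc : (E.card : ℝ) ≤ π * N ^ 2 := hE.card_le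
  have hcardE : ∀ a : ℝ, ∑ q ∈ O, (if q ∈ E then a else 0) = a * E.card := by
    intro a
    rw [← Finset.sum_filter, Finset.filter_mem_eq_inter, Finset.inter_eq_right.2 hE.offDiag,
      Finset.sum_const, nsmul_eq_mul, mul_comm]
  have hlower : c₁ * B.card - e * O.card - (C + c₁) * E.card ≤
      ∑ q ∈ O, Φ q.1 q.2 (δ q.1 q.2) := by
    have : c₁ * B.card - e * O.card - (C + c₁) * E.card = ∑ q ∈ O,
        ((if q ∈ E ∨ ∃ t, κ₁ ≤ |δ q.1 q.2 t| then c₁ else 0) - e -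
          if q ∈ E then C + c₁ else 0) := by
      rw [Finset.sum_sub_distrib, Finset.sum_sub_distrib, hcardE, ← Finset.sum_filter,
        Finset.sum_const, Finset.sum_const, nsmul_eq_mul, nsmul_eq_mul]
      ring
    rw [this]
    refine Finset.sum_le_sum fun q hq => ?_
    have hne : q.1 ≠ q.2 := by simpa [hO] using hq
    by_cases hqE : q ∈ E
    · have := hElow q.1 q.2 hqE (δ q.1 q.2)
      simp only [hqE, true_or, if_true]
      linarith
    · simp only [hqE, false_or, if_false]
      split_ifs with hf
      · linarith [hfar q.1 q.2 hne hqE _ hf]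
      · linarith [hlow q.1 q.2 hne hqE (δ q.1 q.2)]
  have hupper : ∑ q ∈ O, Φ q.1 q.2 (ξ q.1 q.2) ≤ e * O.card + C * E.card := by
    have : e * O.card + C * E.card = ∑ q ∈ O, (e + if q ∈ E then C else 0) := by
      rw [Finset.sum_add_distrib, hcardE, Finset.sum_const, nsmul_eq_mul]
      ring
    rw [this]
    refine Finset.sum_le_sum fun q hq => ?_
    have hne : q.1 ≠ q.2 := by simpa [hO] using hq
    by_cases hqE : q ∈ E
    · simp only [hqE, if_true]
      linarith [hEup q.1 q.2 hne _ (hξ q.1 q.2)]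
    · simp only [hqE, if_false]
      linarith [hnear q.1 q.2 hne hqE _ (hξ q.1 q.2)]
  have h1 : c₁ * B.card ≤ 2 * e * N ^ 2 + (2 * C + c₁) * (π * N ^ 2) := by
    have h2 : e * O.card ≤ e * N ^ 2 := by gcongr
    have h3 : (2 * C + c₁) * E.card ≤ (2 * C + c₁) * (π * N ^ 2) := by gcongr
    linarith
  have h4 : c₁ * B.card ≤ c₁ * (η * N ^ 2) := by
    have := mul_le_mul_of_nonneg_right hη (sq_nonneg N)
    linarith
  exact le_of_mul_le_mul_left h4 hc₁

set_option maxHeartbeats 1000000 in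
/-- No exporter-time or importer-time effect of a minimizer is large: otherwise resetting all the
large ones to zero would lower the total cost. -/
theorem effects_bound_of_most_small {Φ : ι → ι → (Fin T → ℝ) → ℝ} {ξ : ι → ι → Fin T → ℝ}
    {P Q : ι → Fin T → ℝ} {R : ι → ι → ℝ}
    {E : Finset (ι × ι)} {t₀ : Fin T} {π κ κ₁ ξ₀ c e C ζ : ℝ} (hE : SparsePairs E π)
    (hκ₁ : 0 < κ₁) (hc : 0 < c) (he : 0 ≤ e) (hC : 0 ≤ C) (hκκ : 16 * κ₁ ≤ κ) (hκ1 : 5 * κ ≤ 1)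
    (hξκ : 2 * ξ₀ ≤ κ₁)
    (hlow : ∀ i j, i ≠ j → (i, j) ∉ E → ∀ d, -e ≤ Φ i j d)
    (hfar : ∀ i j, i ≠ j → (i, j) ∉ E → ∀ d, (∃ t, κ ≤ |d t|) → c ≤ Φ i j d)
    (hnear : ∀ i j, i ≠ j → (i, j) ∉ E → ∀ d, (∀ t, |d t| ≤ 9 * κ₁) → Φ i j d ≤ c / 16)
    (hElow : ∀ i j, (i, j) ∈ E → ∀ d, -C ≤ Φ i j d)
    (hEup : ∀ i j, i ≠ j → ∀ d, (∀ t, |d t| ≤ 1) → Φ i j d ≤ C)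
    (hξ : ∀ i j t, |ξ i j t| ≤ ξ₀)
    (hP : ∀ i, P i t₀ = 0) (hQ : ∀ j, Q j t₀ = 0)
    (hmin : ∀ P' Q' : ι → Fin T → ℝ, ∀ R' : ι → ι → ℝ,
      ∑ q ∈ Finset.univ.offDiag, Φ q.1 q.2 (fittedLog ξ P Q R q.1 q.2) ≤
        ∑ q ∈ Finset.univ.offDiag, Φ q.1 q.2 (fittedLog ξ P' Q' R' q.1 q.2))
    (hPc : ((Finset.univ.filter fun i => 6 * κ₁ < ‖P i‖).card : ℝ) ≤ ζ * Fintype.card ι)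
    (hQc : ((Finset.univ.filter fun i => 6 * κ₁ < ‖Q i‖).card : ℝ) ≤ ζ * Fintype.card ι)
    (hζ : ζ ≤ 1 / 4) (hN : 8 ≤ (Fintype.card ι : ℝ)) (hec : e ≤ c / 16)
    (hπc : (2 * C + c) * π ≤ c / 16) (hζc : C * ζ ≤ c / 16) :
    (∀ i, ‖P i‖ ≤ 4 * κ) ∧ ∀ j, ‖Q j‖ ≤ 4 * κ := by
  classical
  set N : ℝ := (Fintype.card ι : ℝ) with hNdef
  set O : Finset (ι × ι) := Finset.univ.offDiag with hO
  -- Two thresholds: `NR` and `NC` hold the effects that are not small, which are few by assumption,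
  -- `BR` and `BC` the large ones, to be reset. Where a large effect meets a small one, the two
  -- cannot cancel.
  set NR := Finset.univ.filter fun i => 6 * κ₁ < ‖P i‖ with hNR
  set NC := Finset.univ.filter fun i => 6 * κ₁ < ‖Q i‖ with hNC
  set BR := Finset.univ.filter fun i => 4 * κ < ‖P i‖ with hBR
  set BC := Finset.univ.filter fun i => 4 * κ < ‖Q i‖ with hBC
  have hBNR : BR ⊆ NR := by
    intro i hi
    rw [hBR, Finset.mem_filter] at hi
    rw [hNR, Finset.mem_filter]
    exact ⟨hi.1, by linarith [hi.2]⟩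
  have hBNC : BC ⊆ NC := by
    intro i hi
    rw [hBC, Finset.mem_filter] at hi
    rw [hNC, Finset.mem_filter]
    exact ⟨hi.1, by linarith [hi.2]⟩
  set δ := fittedLog ξ P Q R with hδ
  set P' : ι → Fin T → ℝ := fun i => if i ∈ BR then 0 else P i with hP'
  set Q' : ι → Fin T → ℝ := fun i => if i ∈ BC then 0 else Q i with hQ'
  set R' : ι → ι → ℝ := fun i j => if i ∈ BR ∨ j ∈ BC then 0 else R i j with hR'
  set δ' := fittedLog ξ P' Q' R' with hδ'
  set S := O.filter fun q : ι × ι => q.1 ∈ BR ∨ q.2 ∈ BC with hS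
  have hcmp : ∑ q ∈ S, Φ q.1 q.2 (δ q.1 q.2) ≤ ∑ q ∈ S, Φ q.1 q.2 (δ' q.1 q.2) := by
    have h1 := hmin P' Q' R'
    rw [← Finset.sum_filter_add_sum_filter_not O (fun q : ι × ι => q.1 ∈ BR ∨ q.2 ∈ BC),
      ← Finset.sum_filter_add_sum_filter_not O (fun q : ι × ι => q.1 ∈ BR ∨ q.2 ∈ BC)] at h1
    have h2 : ∑ q ∈ O.filter (fun q : ι × ι => ¬ (q.1 ∈ BR ∨ q.2 ∈ BC)),
        Φ q.1 q.2 (δ' q.1 q.2) = ∑ q ∈ O.filter (fun q : ι × ι => ¬ (q.1 ∈ BR ∨ q.2 ∈ BC)),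
        Φ q.1 q.2 (δ q.1 q.2) := by
      refine Finset.sum_congr rfl fun q hq => ?_
      have h3 := (Finset.mem_filter.1 hq).2
      have h4 := not_or.1 h3
      congr 1
      ext t
      simp only [hδ', hδ, fittedLog, hP', hQ', hR', if_neg h4.1, if_neg h4.2, if_neg h3]
    rw [h2] at h1
    exact le_of_add_le_add_right h1
  have hP'b : ∀ i t, |P' i t| ≤ 4 * κ := by
    intro i t
    by_cases hi : i ∈ BR
    · simp only [hP', if_pos hi, Pi.zero_apply, abs_zero]
      linarith
    · simp only [hP', if_neg hi]
      rw [hBR, Finset.mem_filter, not_and, not_lt] at hi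
      exact (norm_le_pi_norm (P i) t).trans (hi (Finset.mem_univ _))
  have hQ'b : ∀ i t, |Q' i t| ≤ 4 * κ := by
    intro i t
    by_cases hi : i ∈ BC
    · simp only [hQ', if_pos hi, Pi.zero_apply, abs_zero]
      linarith
    · simp only [hQ', if_neg hi]
      rw [hBC, Finset.mem_filter, not_and, not_lt] at hi
      exact (norm_le_pi_norm (Q i) t).trans (hi (Finset.mem_univ _))
  have hPgood : ∀ i, i ∉ NR → ∀ t, |P i t| ≤ 6 * κ₁ := by
    intro i hi t
    rw [hNR, Finset.mem_filter, not_and, not_lt] at hi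
    exact (norm_le_pi_norm (P i) t).trans (hi (Finset.mem_univ _))
  have hQgood : ∀ i, i ∉ NC → ∀ t, |Q i t| ≤ 6 * κ₁ := by
    intro i hi t
    rw [hNC, Finset.mem_filter, not_and, not_lt] at hi
    exact (norm_le_pi_norm (Q i) t).trans (hi (Finset.mem_univ _))
  have hδ'eq : ∀ q ∈ S, ∀ t, δ' q.1 q.2 t = ξ q.1 q.2 t + P' q.1 t + Q' q.2 t := by
    intro q hq t
    have h3 := (Finset.mem_filter.1 hq).2
    simp only [hδ', fittedLog, hR', if_pos h3, add_zero]
  have hz : ∀ q ∈ S, (∀ t, P' q.1 t = 0) ∨ ∀ t, Q' q.2 t = 0 := by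
    intro q hq
    rcases (Finset.mem_filter.1 hq).2 with h3 | h3
    · left; intro t; simp only [hP', if_pos h3, Pi.zero_apply]
    · right; intro t; simp only [hQ', if_pos h3, Pi.zero_apply]
  -- At every pair of `S` one of the two effects has been reset to zero, so the new fit is at most
  -- `4 * κ + ξ₀`, hence at most one.
  have hnew1 : ∀ q ∈ S, Φ q.1 q.2 (δ' q.1 q.2) ≤ C := by
    intro q hq
    have hne : q.1 ≠ q.2 := by simpa [hO] using (Finset.mem_filter.1 hq).1
    refine hEup _ _ hne _ fun t => ?_
    rw [hδ'eq q hq t]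
    have h1 := abs_le.1 (hξ q.1 q.2 t)
    have h2 := abs_le.1 (hP'b q.1 t)
    have h3 := abs_le.1 (hQ'b q.2 t)
    rcases hz q hq with h4 | h4 <;> rw [h4 t, abs_le] <;> constructor <;> linarith
  have hnew : ∀ q ∈ S, Φ q.1 q.2 (δ' q.1 q.2) ≤ c / 16 + (if q ∈ E then C else 0) +
      (if q.1 ∈ NR ∧ q.2 ∈ BC then C else 0) + (if q.1 ∈ BR ∧ q.2 ∈ NC then C else 0) := by
    intro q hq
    have hne : q.1 ≠ q.2 := by simpa [hO] using (Finset.mem_filter.1 hq).1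
    have hi : ∀ p : Prop, [Decidable p] → 0 ≤ if p then C else 0 := by
      intro p _
      split_ifs <;> linarith
    have ha := hi (q ∈ E)
    have hb := hi (q.1 ∈ NR ∧ q.2 ∈ BC)
    have hd := hi (q.1 ∈ BR ∧ q.2 ∈ NC)
    by_cases h1 : q ∈ E
    · rw [if_pos h1] at ha ⊢
      linarith [hnew1 q hq]
    by_cases h2 : q.1 ∈ NR ∧ q.2 ∈ BC
    · rw [if_pos h2] at hb ⊢
      linarith [hnew1 q hq]
    by_cases h3 : q.1 ∈ BR ∧ q.2 ∈ NC
    · rw [if_pos h3] at hd ⊢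
      linarith [hnew1 q hq]
    have h4 : Φ q.1 q.2 (δ' q.1 q.2) ≤ c / 16 := by
      refine hnear _ _ hne h1 _ fun t => ?_
      rw [hδ'eq q hq t]
      have hx := abs_le.1 (hξ q.1 q.2 t)
      rcases (Finset.mem_filter.1 hq).2 with h5 | h5
      · have h6 : q.2 ∉ NC := fun h6 => h3 ⟨h5, h6⟩
        have h7 : q.2 ∉ BC := fun h7 => h6 (hBNC h7)
        have h8 := abs_le.1 (hQgood _ h6 t)
        simp only [hP', if_pos h5, hQ', if_neg h7, Pi.zero_apply]
        rw [abs_le]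
        constructor <;> linarith
      · have h6 : q.1 ∉ NR := fun h6 => h2 ⟨h6, h5⟩
        have h7 : q.1 ∉ BR := fun h7 => h6 (hBNR h7)
        have h8 := abs_le.1 (hPgood _ h6 t)
        simp only [hQ', if_pos h5, hP', if_neg h7, Pi.zero_apply]
        rw [abs_le]
        constructor <;> linarith
    linarith
  -- On these pairs a large effect meets a small one, so the old fit was costly. The two blocks are
  -- disjoint because `BR ⊆ NR`, and they make up most of `S`.
  set G := (BR ×ˢ NCᶜ) ∪ (NRᶜ ×ˢ BC) with hG
  have hfarG : ∀ q ∈ S, q ∉ E → q ∈ G → c ≤ Φ q.1 q.2 (δ q.1 q.2) := by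
    intro q hq hqE hqG
    have hne : q.1 ≠ q.2 := by simpa [hO] using (Finset.mem_filter.1 hq).1
    refine hfar _ _ hne hqE _ ?_
    have h1 : ∃ t, 2 * κ + 2 * ξ₀ < |P q.1 t + Q q.2 t| := by
      rw [hG, Finset.mem_union, Finset.mem_product, Finset.mem_product, Finset.mem_compl,
        Finset.mem_compl] at hqG
      rcases hqG with ⟨h1, h2⟩ | ⟨h1, h2⟩
      · obtain ⟨t, ht⟩ := exists_norm_lt_of_lt_norm (by linarith) (Finset.mem_filter.1 h1).2
        refine ⟨t, ?_⟩
        have h3 := hQgood _ h2 t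
        have h4 : |P q.1 t| ≤ |P q.1 t + Q q.2 t| + |Q q.2 t| := by
          simpa using abs_sub (P q.1 t + Q q.2 t) (Q q.2 t)
        linarith
      · obtain ⟨t, ht⟩ := exists_norm_lt_of_lt_norm (by linarith) (Finset.mem_filter.1 h2).2
        refine ⟨t, ?_⟩
        have h3 := hPgood _ h1 t
        have h4 : |Q q.2 t| ≤ |P q.1 t + Q q.2 t| + |P q.1 t| := by
          simpa using abs_sub (P q.1 t + Q q.2 t) (P q.1 t)
        linarith
    obtain ⟨t, ht⟩ := h1
    -- Both effects vanish in period `t₀`. Whatever the pair effect is, the fits in the periods `t`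
    -- and `t₀` differ by `P + Q` up to `2 * ξ₀`, so they cannot both be below `κ` in absolute
    -- value.
    by_contra! hcon
    have h2 := abs_lt.1 (hcon t)
    have h3 := abs_lt.1 (hcon t₀)
    have h4 := abs_le.1 (hξ q.1 q.2 t)
    have h5 := abs_le.1 (hξ q.1 q.2 t₀)
    simp only [hδ, fittedLog, hP, hQ, add_zero] at h2 h3
    refine absurd ht (not_lt.2 (abs_le.2 ⟨?_, ?_⟩)) <;> linarith
  have hold : ∀ q ∈ S, (if q ∈ G then c else 0) - e - (if q ∈ E then C + c else 0) ≤
      Φ q.1 q.2 (δ q.1 q.2) := by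
    intro q hq
    have hne : q.1 ≠ q.2 := by simpa [hO] using (Finset.mem_filter.1 hq).1
    by_cases hqE : q ∈ E
    · have h1 := hElow q.1 q.2 hqE (δ q.1 q.2)
      have h2 : (if q ∈ G then c else 0) ≤ c := by split_ifs <;> linarith
      rw [if_pos hqE]
      linarith
    · rw [if_neg hqE]
      split_ifs with h1
      · linarith [hfarG q hq hqE h1]
      · linarith [hlow q.1 q.2 hne hqE (δ q.1 q.2)]
  have hsum := (Finset.sum_le_sum hold).trans (hcmp.trans (Finset.sum_le_sum hnew))
  simp only [Finset.sum_sub_distrib, Finset.sum_add_distrib, ← Finset.sum_filter,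
    Finset.sum_const, nsmul_eq_mul] at hsum
  set br : ℝ := (BR.card : ℝ) with hbr
  set bc : ℝ := (BC.card : ℝ) with hbc
  have hbr0 : 0 ≤ br := Nat.cast_nonneg _
  have hbc0 : 0 ≤ bc := Nat.cast_nonneg _
  have hcardSE : ((S.filter fun q => q ∈ E).card : ℝ) ≤ π * N * (br + bc) := by
    have h1 := hE.sum_row_le (a := fun i => if i ∈ BR then (1 : ℝ) else 0)
      (fun i => by split_ifs <;> norm_num)
    have h2 := hE.sum_col_le (a := fun i => if i ∈ BC then (1 : ℝ) else 0)
      (fun i => by split_ifs <;> norm_num)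
    rw [← hNdef] at h1 h2
    simp only [← Finset.sum_filter, Finset.sum_const, nsmul_eq_mul, mul_one,
      Finset.filter_mem_eq_inter, Finset.univ_inter] at h1 h2
    have h3 : S.filter (fun q => q ∈ E) ⊆
        (E.filter fun q => q.1 ∈ BR) ∪ (E.filter fun q => q.2 ∈ BC) := by
      intro q hq
      rw [Finset.mem_filter] at hq
      rw [Finset.mem_union]
      rcases (Finset.mem_filter.1 hq.1).2 with h3 | h3
      · exact Or.inl (Finset.mem_filter.2 ⟨hq.2, h3⟩)
      · exact Or.inr (Finset.mem_filter.2 ⟨hq.2, h3⟩)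
    have h4 := (Finset.card_le_card h3).trans (Finset.card_union_le _ _)
    have h5 : ((S.filter fun q => q ∈ E).card : ℝ) ≤
      (E.filter fun q => q.1 ∈ BR).card + (E.filter fun q => q.2 ∈ BC).card := by
      exact_mod_cast h4
    linarith
  have hcardRC : ((S.filter fun q : ι × ι => q.1 ∈ NR ∧ q.2 ∈ BC).card : ℝ) ≤ ζ * N * bc := by
    have h1 : (S.filter fun q : ι × ι => q.1 ∈ NR ∧ q.2 ∈ BC) ⊆ NR ×ˢ BC := by
      intro q hq
      exact Finset.mem_product.2 (Finset.mem_filter.1 hq).2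
    have h2 := Finset.card_le_card h1
    rw [Finset.card_product] at h2
    calc ((S.filter fun q : ι × ι => q.1 ∈ NR ∧ q.2 ∈ BC).card : ℝ) ≤ NR.card * bc := by
          rw [hbc]
          exact_mod_cast h2
      _ ≤ ζ * N * bc := by gcongr
  have hcardCR : ((S.filter fun q : ι × ι => q.1 ∈ BR ∧ q.2 ∈ NC).card : ℝ) ≤ ζ * N * br := by
    have h1 : (S.filter fun q : ι × ι => q.1 ∈ BR ∧ q.2 ∈ NC) ⊆ BR ×ˢ NC := by
      intro q hq
      exact Finset.mem_product.2 (Finset.mem_filter.1 hq).2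
    have h2 := Finset.card_le_card h1
    rw [Finset.card_product] at h2
    calc ((S.filter fun q : ι × ι => q.1 ∈ BR ∧ q.2 ∈ NC).card : ℝ) ≤ br * NC.card := by
          rw [hbr]
          exact_mod_cast h2
      _ ≤ br * (ζ * N) := by gcongr
      _ = ζ * N * br := by ring
  have hcardS : (S.card : ℝ) ≤ N * (br + bc) := by
    have h1 : S ⊆ (BR ×ˢ Finset.univ) ∪ (Finset.univ ×ˢ BC) := by
      intro q hq
      rw [Finset.mem_union, Finset.mem_product, Finset.mem_product]
      rcases (Finset.mem_filter.1 hq).2 with h3 | h3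
      · exact Or.inl ⟨h3, Finset.mem_univ _⟩
      · exact Or.inr ⟨Finset.mem_univ _, h3⟩
    have h2 := (Finset.card_le_card h1).trans (Finset.card_union_le _ _)
    rw [Finset.card_product, Finset.card_product, Finset.card_univ] at h2
    calc (S.card : ℝ) ≤ br * N + N * bc := by
          rw [hbr, hbc, hNdef]
          exact_mod_cast h2
      _ = N * (br + bc) := by ring
  have hcardG : (br + bc) * (N - ζ * N - 1) ≤ ((S.filter fun q => q ∈ G).card : ℝ) := by
    have h1 : G \ ((BR ∪ BC).image fun i => (i, i)) ⊆ S.filter fun q => q ∈ G := by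
      intro q hq
      rw [Finset.mem_sdiff] at hq
      rw [Finset.mem_filter, hS, Finset.mem_filter]
      have h2 : q.1 ∈ BR ∨ q.2 ∈ BC := by
        have h3 := hq.1
        rw [hG, Finset.mem_union, Finset.mem_product, Finset.mem_product] at h3
        rcases h3 with h3 | h3
        · exact Or.inl h3.1
        · exact Or.inr h3.2
      refine ⟨⟨?_, h2⟩, hq.1⟩
      rw [hO, Finset.mem_offDiag]
      refine ⟨Finset.mem_univ _, Finset.mem_univ _, fun heq => hq.2 ?_⟩
      rw [Finset.mem_image]
      refine ⟨q.1, ?_, Prod.ext rfl heq⟩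
      rw [Finset.mem_union]
      rcases h2 with h2 | h2
      · exact Or.inl h2
      · exact Or.inr (heq ▸ h2)
    have h2 := (Finset.le_card_sdiff _ _).trans (Finset.card_le_card h1)
    have h3 : ((BR ∪ BC).image fun i => (i, i)).card ≤ BR.card + BC.card :=
      Finset.card_image_le.trans (Finset.card_union_le _ _)
    have h4 : G.card = BR.card * NCᶜ.card + NRᶜ.card * BC.card := by
      rw [hG, Finset.card_union_of_disjoint, Finset.card_product, Finset.card_product]
      rw [Finset.disjoint_left]
      intro q h5 h6
      rw [Finset.mem_product] at h5 h6
      exact Finset.mem_compl.1 h6.1 (hBNR h5.1)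
    have h5 : (NCᶜ.card : ℝ) = N - NC.card := by
      rw [Finset.card_compl, Nat.cast_sub (Finset.card_le_univ _)]
    have h6 : (NRᶜ.card : ℝ) = N - NR.card := by
      rw [Finset.card_compl, Nat.cast_sub (Finset.card_le_univ _)]
    have h7 : (G.card : ℝ) ≤ (S.filter fun q => q ∈ G).card + (br + bc) := by
      have : G.card ≤ (S.filter fun q => q ∈ G).card + (BR.card + BC.card) := by omega
      rw [hbr, hbc]
      exact_mod_cast this
    have h8 : (G.card : ℝ) = br * (N - NC.card) + (N - NR.card) * bc := by
      rw [h4]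
      push_cast
      rw [h5, h6]
    nlinarith [mul_le_mul_of_nonneg_left hQc hbr0, mul_le_mul_of_nonneg_left hPc hbc0]
  -- The old fit costs at least `5 / 8 * c` times `N * (br + bc)` before errors. The four error
  -- terms amount to at most `c / 16` times the same quantity each, so nothing can have been reset.
  have hfinal : br + bc ≤ 0 := by
    by_contra! hb
    have hN0 : 0 < N := by linarith
    have h1 : c * ((br + bc) * (N - ζ * N - 1)) ≤ ((S.filter fun q => q ∈ G).card : ℝ) * c := by
      rw [mul_comm]
      exact mul_le_mul_of_nonneg_right hcardG hc.le
    have h2 : (S.card : ℝ) * (c / 16) ≤ N * (br + bc) * (c / 16) := by gcongr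
    have h3 : (S.card : ℝ) * e ≤ N * (br + bc) * (c / 16) := by gcongr
    have h4 : ((S.filter fun q => q ∈ E).card : ℝ) * (2 * C + c) ≤
        N * (br + bc) * (c / 16) := by
      calc ((S.filter fun q => q ∈ E).card : ℝ) * (2 * C + c) ≤
          π * N * (br + bc) * (2 * C + c) := by gcongr
        _ = N * (br + bc) * ((2 * C + c) * π) := by ring
        _ ≤ _ := by gcongr
    have h5 : ((S.filter fun q : ι × ι => q.1 ∈ NR ∧ q.2 ∈ BC).card : ℝ) * C +
        ((S.filter fun q : ι × ι => q.1 ∈ BR ∧ q.2 ∈ NC).card : ℝ) * C ≤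
        N * (br + bc) * (c / 16) := by
      calc _ ≤ ζ * N * bc * C + ζ * N * br * C := by gcongr
        _ = N * (br + bc) * (C * ζ) := by ring
        _ ≤ _ := by gcongr
    have h6 : N * (5 / 8) ≤ N - ζ * N - 1 := by nlinarith
    have h7 : c * ((br + bc) * (N * (5 / 8))) ≤ c * ((br + bc) * (N - ζ * N - 1)) := by gcongr
    have h8 : 0 < N * (br + bc) * c := by positivity
    nlinarith
  have hBR0 : BR = ∅ := by
    rw [← Finset.card_eq_zero, ← Nat.cast_eq_zero (R := ℝ)]
    linarith
  have hBC0 : BC = ∅ := by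
    rw [← Finset.card_eq_zero, ← Nat.cast_eq_zero (R := ℝ)]
    linarith
  constructor
  · intro i
    by_contra! hcon
    have : i ∈ BR := Finset.mem_filter.2 ⟨Finset.mem_univ _, hcon⟩
    rw [hBR0] at this
    exact Finset.notMem_empty _ this
  · intro i
    by_contra! hcon
    have : i ∈ BC := Finset.mem_filter.2 ⟨Finset.mem_univ _, hcon⟩
    rw [hBC0] at this
    exact Finset.notMem_empty _ this

end EffectsBound

/-- Disturbances that are within `π` below one, except that at the pairs of `E` those of period `t₀`
are `u` and those of all other periods are one. -/
structure ContaminatedOutcome {ι : Type*} {T : ℕ} (E : Finset (ι × ι)) (t₀ : Fin T) (u π : ℝ)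
    (ω : ι → ι → Fin T → ℝ) : Prop where
  base : ∀ i j, i ≠ j → (i, j) ∉ E → ∀ t, 1 - π ≤ ω i j t ∧ ω i j t ≤ 1
  event : ∀ i j, (i, j) ∈ E → ∀ t, ω i j t = if t = t₀ then u else 1

/-- The fit with effects `P`, `Q`, `R` minimizes the total deviance among all fits with the same
regression part `ξ`. -/
def MinimizesDeviance {ι : Type*} [Fintype ι] {T : ℕ} (h : ℝ → ℝ)
    (ω ξ : ι → ι → Fin T → ℝ) (P Q : ι → Fin T → ℝ) (R : ι → ι → ℝ) : Prop :=
  ∀ P' Q' : ι → Fin T → ℝ, ∀ R' : ι → ι → ℝ,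
    ∑ q ∈ (Finset.univ : Finset ι).offDiag,
        ∑ t, deviance h (ω q.1 q.2 t) (fittedLog ξ P Q R q.1 q.2 t) ≤
      ∑ q ∈ (Finset.univ : Finset ι).offDiag,
        ∑ t, deviance h (ω q.1 q.2 t) (fittedLog ξ P' Q' R' q.1 q.2 t)

theorem le_sum_of_exists_le {T : ℕ} {f : Fin T → ℝ} {c e : ℝ} (he : 0 ≤ e) (hf : ∀ t, -e ≤ f t)
    (hc : ∃ t, c ≤ f t) : c - T * e ≤ ∑ t, f t := by
  obtain ⟨t, ht⟩ := hc
  rw [← Finset.add_sum_erase _ _ (Finset.mem_univ t)]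
  have h1 : ∑ s ∈ Finset.univ.erase t, (-e) ≤ ∑ s ∈ Finset.univ.erase t, f s :=
    Finset.sum_le_sum fun s _ => hf s
  rw [Finset.sum_const, nsmul_eq_mul] at h1
  have h2 : ((Finset.univ.erase t).card : ℝ) ≤ T := by
    exact_mod_cast (Finset.card_le_univ _).trans (by simp)
  nlinarith

theorem sum_le_mul_of_le {T : ℕ} {f : Fin T → ℝ} {C : ℝ} (hf : ∀ t, f t ≤ C) :
    ∑ t, f t ≤ T * C := by
  simpa using Finset.sum_le_sum fun t (_ : t ∈ Finset.univ) => hf t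

-- The thresholds depend on `h`, `T`, `u` and `κ` only, never on the number of countries. Comparison
-- with the zero effects shows that most pairs have a small fit, hence most effects are small up to
-- a common shift `a`, which leaves the fit unchanged. The resetting argument then extends this from
-- most effects to all.
set_option maxHeartbeats 1000000 in
theorem exists_effects_bound {h : ℝ → ℝ} (hc : Continuous h) (hpos : ∀ τ, 0 < h τ) (T : ℕ)
    {u κ : ℝ} (hu : 0 < u) (hκ : 0 < κ) (hκ1 : 5 * κ ≤ 1) :
    ∃ π₀ ξ₀ N₀ : ℝ, 0 < π₀ ∧ 0 < ξ₀ ∧ ∀ {ι : Type} [Fintype ι] [DecidableEq ι]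
      {E : Finset (ι × ι)} {t₀ : Fin T} {π : ℝ} {ω ξ : ι → ι → Fin T → ℝ} {P Q : ι → Fin T → ℝ}
      {R : ι → ι → ℝ}, 0 ≤ π → π ≤ π₀ → N₀ ≤ Fintype.card ι → SparsePairs E π →
      ContaminatedOutcome E t₀ u π ω → (∀ i j t, |ξ i j t| ≤ ξ₀) →
      (∀ i, P i t₀ = 0) → (∀ j, Q j t₀ = 0) → MinimizesDeviance h ω ξ P Q R →
      ∃ a : Fin T → ℝ, a t₀ = 0 ∧ (∀ i, ‖P i - a‖ ≤ 4 * κ) ∧ ∀ j, ‖Q j + a‖ ≤ 4 * κ := by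
  have hT : (0 : ℝ) < T + 1 := by positivity
  have hT0 : (0 : ℝ) ≤ T := by positivity
  obtain ⟨d, πd, hd, hπd, Hd⟩ := exists_deviance_lower hc hpos hκ
  -- Half of the gain is kept in reserve for the other periods, whose deviances may be slightly
  -- negative.
  set c := d / 2 with hcdef
  have hc0 : 0 < c := by positivity
  obtain ⟨κu, πu, hκu, hπu, Hu⟩ := exists_deviance_upper hc
    (show 0 < c / (16 * (T + 1)) by positivity)
  -- The finer scale `κ₁` is chosen so that a pair whose fits are within `9 * κ₁` costs at most `c /
  -- 16`.
  set κ₁ := min (κu / 9) (κ / 16) with hκ₁def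
  have hκ₁ : 0 < κ₁ := by positivity
  have hκ₁u : 9 * κ₁ ≤ κu := by linarith [min_le_left (κu / 9) (κ / 16)]
  have hκ₁κ : 16 * κ₁ ≤ κ := by linarith [min_le_right (κu / 9) (κ / 16)]
  obtain ⟨d₁, πd₁, hd₁, hπd₁, Hd₁⟩ := exists_deviance_lower hc hpos hκ₁
  set c₁ := d₁ / 2 with hc₁def
  have hc₁0 : 0 < c₁ := by positivity
  obtain ⟨Cu, hCu, HCu, HCu'⟩ := exists_deviance_bound hc hpos hu
  obtain ⟨C1, hC1, HC1, HC1'⟩ := exists_deviance_bound hc hpos one_pos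
  obtain ⟨πn, hπn, Hn⟩ := exists_deviance_near hc 1 one_pos
  set D := Cu + C1 + 1 with hD
  set C := (T + 1) * D with hCdef
  have hD0 : 0 < D := by positivity
  have hC0 : 0 < C := by positivity
  have hTD : T * D ≤ C := by rw [hCdef]; nlinarith
  set η := min (1 / 8) (c / (32 * (C + 1))) with hηdef
  have hη : 0 < η := by positivity
  have hη8 : η ≤ 1 / 8 := min_le_left _ _
  have hηC : C * (2 * η) ≤ c / 16 := by
    have h1 : η ≤ c / (32 * (C + 1)) := min_le_right _ _
    rw [le_div_iff₀ (by positivity)] at h1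
    nlinarith
  set e := min (c / 16) (η * c₁ / 4) with hedef
  have he : 0 < e := by positivity
  have hec : e ≤ c / 16 := min_le_left _ _
  have heη : e ≤ η * c₁ / 4 := min_le_right _ _
  have hηc₁ : η * c₁ ≤ c₁ := by nlinarith
  set e' := e / (T + 1) with he'def
  have he' : 0 < e' := by positivity
  have hTe : T * e' ≤ e := by
    rw [he'def, mul_div_assoc', div_le_iff₀ hT]
    nlinarith
  obtain ⟨πl, hπl, Hl⟩ := exists_deviance_ge_neg hc hpos he'
  obtain ⟨κe, πe, hκe, hπe, He⟩ := exists_deviance_upper hc he'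
  set π₀ := min (min (min πd πu) (min πd₁ πn)) (min (min πl πe)
    (min (c / (16 * (2 * C + c))) (η * c₁ / (2 * (2 * C + c₁))))) with hπ₀
  refine ⟨π₀, min (min κe (κ₁ / 2)) 1, max 8 (1 / η), by positivity, by positivity, ?_⟩
  intro ι _ _ E t₀ π ω ξ P Q R hπ0 hππ hN hE hω hξ hP hQ hmin
  have b1 : π ≤ πd :=
    hππ.trans ((min_le_left _ _).trans ((min_le_left _ _).trans (min_le_left _ _)))
  have b2 : π ≤ πu :=
    hππ.trans ((min_le_left _ _).trans ((min_le_left _ _).trans (min_le_right _ _)))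
  have b3 : π ≤ πd₁ :=
    hππ.trans ((min_le_left _ _).trans ((min_le_right _ _).trans (min_le_left _ _)))
  have b4 : π ≤ πn :=
    hππ.trans ((min_le_left _ _).trans ((min_le_right _ _).trans (min_le_right _ _)))
  have b5 : π ≤ πl :=
    hππ.trans ((min_le_right _ _).trans ((min_le_left _ _).trans (min_le_left _ _)))
  have b6 : π ≤ πe :=
    hππ.trans ((min_le_right _ _).trans ((min_le_left _ _).trans (min_le_right _ _)))
  have b7 : π ≤ c / (16 * (2 * C + c)) :=
    hππ.trans ((min_le_right _ _).trans ((min_le_right _ _).trans (min_le_left _ _)))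
  have b8 : π ≤ η * c₁ / (2 * (2 * C + c₁)) :=
    hππ.trans ((min_le_right _ _).trans ((min_le_right _ _).trans (min_le_right _ _)))
  have hN8 : (8 : ℝ) ≤ Fintype.card ι := (le_max_left _ _).trans hN
  have hNη : 1 ≤ η * Fintype.card ι := by
    have := (le_max_right 8 (1 / η)).trans hN
    rwa [div_le_iff₀' hη] at this
  have hπc : (2 * C + c) * π ≤ c / 16 := by
    rw [le_div_iff₀ (by positivity)] at b7
    linarith
  have hπc₁ : (2 * C + c₁) * π ≤ η * c₁ / 2 := by
    rw [le_div_iff₀ (by positivity)] at b8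
    linarith
  set ξ₁ := min (min κe (κ₁ / 2)) 1 with hξ₁
  have x1 : ξ₁ ≤ κe := (min_le_left _ _).trans (min_le_left _ _)
  have x2 : ξ₁ ≤ κ₁ / 2 := (min_le_left _ _).trans (min_le_right _ _)
  have x3 : ξ₁ ≤ 1 := min_le_right _ _
  set Φ : ι → ι → (Fin T → ℝ) → ℝ := fun i j d => ∑ t, deviance h (ω i j t) (d t) with hΦ
  have hbase : ∀ i j, i ≠ j → (i, j) ∉ E → ∀ t (δ : ℝ), -e' ≤ deviance h (ω i j t) δ := by
    intro i j hij hE' t δ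
    obtain ⟨h1, h2⟩ := hω.base i j hij hE' t
    exact Hl _ _ (by linarith) h2
  have hlow : ∀ i j, i ≠ j → (i, j) ∉ E → ∀ d, -e ≤ Φ i j d := by
    intro i j hij hE' d
    have := Finset.sum_le_sum fun t (_ : t ∈ Finset.univ) => hbase i j hij hE' t (d t)
    simp only [Finset.sum_const, Finset.card_univ, Fintype.card_fin, nsmul_eq_mul] at this
    linarith
  have hfar : ∀ i j, i ≠ j → (i, j) ∉ E → ∀ d, (∃ t, κ ≤ |d t|) → c ≤ Φ i j d := by
    rintro i j hij hE' d ⟨t, ht⟩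
    obtain ⟨h1, h2⟩ := hω.base i j hij hE' t
    have := le_sum_of_exists_le he'.le (fun t => hbase i j hij hE' t (d t))
      ⟨t, Hd _ _ (by linarith only [h1, b1]) h2 ht⟩
    refine le_trans ?_ this
    linarith only [hTe, hec, hcdef, hc0]
  have hfar₁ : ∀ i j, i ≠ j → (i, j) ∉ E → ∀ d, (∃ t, κ₁ ≤ |d t|) → c₁ ≤ Φ i j d := by
    rintro i j hij hE' d ⟨t, ht⟩
    obtain ⟨h1, h2⟩ := hω.base i j hij hE' t
    have := le_sum_of_exists_le he'.le (fun t => hbase i j hij hE' t (d t))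
      ⟨t, Hd₁ _ _ (by linarith only [h1, b3]) h2 ht⟩
    refine le_trans ?_ this
    linarith only [hTe, heη, hηc₁, hc₁def, hc₁0]
  have hnear : ∀ i j, i ≠ j → (i, j) ∉ E → ∀ d, (∀ t, |d t| ≤ 9 * κ₁) → Φ i j d ≤ c / 16 := by
    intro i j hij hE' d hd
    have := sum_le_mul_of_le fun t => Hu (ω i j t) (d t)
      (by linarith [(hω.base i j hij hE' t).1]) (hω.base i j hij hE' t).2 ((hd t).trans hκ₁u)
    refine this.trans ?_
    rw [mul_div_assoc', div_le_div_iff₀ (by positivity) (by norm_num)]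
    nlinarith
  have hnear0 : ∀ i j, i ≠ j → (i, j) ∉ E → ∀ d, (∀ t, |d t| ≤ ξ₁) → Φ i j d ≤ e := by
    intro i j hij hE' d hd
    have := sum_le_mul_of_le fun t => He (ω i j t) (d t)
      (by linarith [(hω.base i j hij hE' t).1]) (hω.base i j hij hE' t).2 ((hd t).trans x1)
    exact this.trans hTe
  have hElow : ∀ i j, (i, j) ∈ E → ∀ d, -C ≤ Φ i j d := by
    intro i j hij d
    have h1 : ∀ t, -D ≤ deviance h (ω i j t) (d t) := by
      intro t
      rw [hω.event i j hij t]
      split_ifs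
      · linarith [HCu (d t)]
      · linarith [HC1 (d t)]
    have := Finset.sum_le_sum fun t (_ : t ∈ Finset.univ) => h1 t
    simp only [Finset.sum_const, Finset.card_univ, Fintype.card_fin, nsmul_eq_mul] at this
    linarith
  have hEup : ∀ i j, i ≠ j → ∀ d, (∀ t, |d t| ≤ 1) → Φ i j d ≤ C := by
    intro i j hij d hd
    refine le_trans (sum_le_mul_of_le (C := D) fun t => ?_) hTD
    by_cases hE' : (i, j) ∈ E
    · rw [hω.event i j hE' t]
      split_ifs
      · linarith [HCu' (d t) (hd t)]
      · linarith [HC1' (d t) (hd t)]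
    · obtain ⟨h1, h2⟩ := hω.base i j hij hE' t
      have h3 := (abs_le.1 (Hn (ω i j t) (d t)
        (by rw [abs_of_nonneg (by linarith)]; linarith) (hd t))).2
      linarith [HC1' (d t) (hd t)]
  have hmin0 : ∑ q ∈ (Finset.univ : Finset ι).offDiag,
      Φ q.1 q.2 (fittedLog ξ P Q R q.1 q.2) ≤
      ∑ q ∈ Finset.univ.offDiag, Φ q.1 q.2 (ξ q.1 q.2) := by
    have := hmin 0 0 0
    simpa [fittedLog, hΦ] using this
  have hbad := card_filter_abs_le (η := η) hE hc₁0 he.le hC0.le hlow hfar₁ hnear0 hElow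
    (fun i j hij d hd => hEup i j hij d fun t => (hd t).trans x3) hξ hmin0 (by linarith)
  -- Subtracting the fit of period `t₀` removes the pair effect, and `P + Q` is at most `2 * κ₁ + 2
  -- * ξ₁`, hence at most `3 * κ₁`, off the bad pairs.
  obtain ⟨i₀, hi₀P, hi₀Q⟩ := exists_common_shift P Q (ρ := 3 * κ₁) hη hη8 hNη hbad (by
    intro i j hij hB
    rw [Finset.mem_filter, not_and, not_or] at hB
    obtain ⟨-, hB⟩ := hB (by simpa using hij)
    push Not at hB
    rw [pi_norm_le_iff_of_nonneg (by positivity)]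
    intro t
    have h2 := abs_lt.1 (hB t)
    have h3 := abs_lt.1 (hB t₀)
    have h4 := abs_le.1 (hξ i j t)
    have h5 := abs_le.1 (hξ i j t₀)
    simp only [fittedLog, hP, hQ, add_zero] at h2 h3
    rw [Real.norm_eq_abs, Pi.add_apply, abs_le]
    constructor <;> linarith)
  refine ⟨P i₀, hP i₀, ?_⟩
  have hshift : ∀ P' Q' : ι → Fin T → ℝ, ∀ R' : ι → ι → ℝ,
      ∑ q ∈ (Finset.univ : Finset ι).offDiag, Φ q.1 q.2
        (fittedLog ξ (fun i => P i - P i₀) (fun j => Q j + P i₀) R q.1 q.2) ≤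
        ∑ q ∈ Finset.univ.offDiag, Φ q.1 q.2 (fittedLog ξ P' Q' R' q.1 q.2) := by
    intro P' Q' R'
    have heq : fittedLog ξ (fun i => P i - P i₀) (fun j => Q j + P i₀) R = fittedLog ξ P Q R := by
      ext i j t
      simp only [fittedLog, Pi.sub_apply, Pi.add_apply]
      ring
    rw [heq]
    exact hmin P' Q' R'
  refine effects_bound_of_most_small (t₀ := t₀) (e := e) (ζ := 2 * η) hE hκ₁ hc0 he.le hC0.le hκ₁κ
    hκ1 (by linarith) hlow hfar hnear hElow hEup hξ (by simp [hP]) (by simp [hP, hQ]) hshift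
    ?_ ?_ (by linarith) hN8 hec hπc hηC
  · convert hi₀P using 5
    ring
  · convert hi₀Q using 5
    ring

/-! ### Scores within a single pair. -/

/-- The derivative of minus the deviance: the score of an outcome `ω` at the fitted log-mean `δ`. -/
noncomputable def score (h : ℝ → ℝ) (ω δ : ℝ) : ℝ := (ω - Real.exp δ) * h δ

section PairScore

variable {h : ℝ → ℝ} {T : ℕ} {δ ω : Fin T → ℝ}

theorem exists_le_of_sum_score_eq_zero (hpos : ∀ τ, 0 < h τ) [Nonempty (Fin T)]
    (h0 : ∑ t, score h (ω t) (δ t) = 0) {a : ℝ} (ha : ∀ t, ω t ≤ Real.exp a) : ∃ t, δ t ≤ a := by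
  by_contra! hcon
  have : ∑ t, score h (ω t) (δ t) < 0 := by
    refine Finset.sum_neg (fun t _ => ?_) Finset.univ_nonempty
    refine mul_neg_of_neg_of_pos ?_ (hpos _)
    have := Real.exp_lt_exp.2 (hcon t)
    linarith [ha t]
  linarith

theorem exists_ge_of_sum_score_eq_zero (hpos : ∀ τ, 0 < h τ) [Nonempty (Fin T)]
    (h0 : ∑ t, score h (ω t) (δ t) = 0) {a : ℝ} (ha : ∀ t, Real.exp a ≤ ω t) : ∃ t, a ≤ δ t := by
  by_contra! hcon
  have : 0 < ∑ t, score h (ω t) (δ t) := by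
    refine Finset.sum_pos (fun t _ => ?_) Finset.univ_nonempty
    refine mul_pos ?_ (hpos _)
    have := Real.exp_lt_exp.2 (hcon t)
    linarith [ha t]
  linarith

/-- Since `h` is positive, the pair condition forbids all fits from exceeding, or all from falling
short of, the range of the outcomes. Small variation over time carries this from one period to all.
-/
theorem mem_Icc_of_sum_score_eq_zero (hpos : ∀ τ, 0 < h τ) {a b r : ℝ}
    (h0 : ∑ t, score h (ω t) (δ t) = 0) (hr : ∀ t s, |δ t - δ s| ≤ r)
    (ha : ∀ t, Real.exp a ≤ ω t) (hb : ∀ t, ω t ≤ Real.exp b) (t : Fin T) :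
    a - r ≤ δ t ∧ δ t ≤ b + r := by
  have : Nonempty (Fin T) := ⟨t⟩
  obtain ⟨s, hs⟩ := exists_le_of_sum_score_eq_zero hpos h0 hb
  obtain ⟨s', hs'⟩ := exists_ge_of_sum_score_eq_zero hpos h0 ha
  have h1 := abs_le.1 (hr t s)
  have h2 := abs_le.1 (hr t s')
  constructor <;> linarith

/-- If the fitted log-means of a pair with one outcome `u` and all others one are nearly constant
over time, then they are close to the logarithm of the mean outcome. -/
theorem exists_event_close (hc : Continuous h) (hpos : ∀ τ, 0 < h τ) (T : ℕ) {u : ℝ} (hu : 1 ≤ u)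
    {ε : ℝ} (hε : 0 < ε) :
    ∃ r : ℝ, 0 < r ∧ ∀ (t₀ : Fin T) (δ ω : Fin T → ℝ), (∀ t, ω t = if t = t₀ then u else 1) →
      (∀ t s, |δ t - δ s| ≤ r) → ∑ t, score h (ω t) (δ t) = 0 →
      ∀ t, |δ t - Real.log ((u + T - 1) / T)| ≤ ε ∧
        |score h (ω t) (δ t) - (ω t - (u + T - 1) / T) * h (Real.log ((u + T - 1) / T))| ≤ ε := by
  rcases Nat.eq_zero_or_pos T with rfl | hT
  · exact ⟨1, one_pos, fun t₀ => Fin.elim0 t₀⟩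
  have hT' : (0 : ℝ) < T := by exact_mod_cast hT
  have hu0 : 0 < u := by linarith
  set z := (u + T - 1) / T with hz
  have hz0 : 0 < z := by
    apply div_pos _ hT'
    have : (1 : ℝ) ≤ T := by exact_mod_cast hT
    linarith
  have hcont : ∀ w, Continuous (score h w) := by
    intro w
    unfold score
    fun_prop
  have hscore : ∀ w, score h w (Real.log z) = (w - z) * h (Real.log z) := by
    intro w
    rw [score, Real.exp_log hz0]
  obtain ⟨r₁, hr₁, H₁⟩ := Metric.continuousAt_iff.1 ((hcont 1).continuousAt (x := Real.log z)) ε hε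
  obtain ⟨r₂, hr₂, H₂⟩ := Metric.continuousAt_iff.1 ((hcont u).continuousAt (x := Real.log z)) ε hε
  obtain ⟨ρ, hρ, Hρ⟩ := Metric.continuousAt_iff.1 (Real.continuousAt_log hz0.ne')
    (min (min r₁ r₂) ε) (by positivity)
  set I := Set.Icc (-1 : ℝ) (Real.log u + 1) with hI
  have hlu : 0 ≤ Real.log u := Real.log_nonneg hu
  have hIne : I.Nonempty := ⟨0, by rw [hI, Set.mem_Icc]; constructor <;> linarith⟩
  obtain ⟨x₀, -, hx₀⟩ := isCompact_Icc.exists_isMinOn hIne hc.continuousOn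
  set m := h x₀ with hm
  have hm0 : 0 < m := hpos _
  obtain ⟨M, hM⟩ := isCompact_Icc.exists_bound_of_continuousOn
    (s := I) (f := fun x => Real.exp x) Real.continuous_exp.continuousOn
  set ε' := min (ρ / 4) (ρ * m / (4 * (u + |M|))) with hε'
  have hD : 0 < u + |M| := by positivity
  have hε'0 : 0 < ε' := by positivity
  obtain ⟨r₃, hr₃, H₃⟩ := Metric.uniformContinuousOn_iff.1
    (isCompact_Icc.uniformContinuousOn_of_continuous (s := I) hc.continuousOn) ε' hε'0
  obtain ⟨r₄, hr₄, H₄⟩ := Metric.uniformContinuousOn_iff.1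
    (isCompact_Icc.uniformContinuousOn_of_continuous (s := I)
      (f := Real.exp) Real.continuous_exp.continuousOn) ε' hε'0
  refine ⟨min (min (r₃ / 2) (r₄ / 2)) 1, by positivity, ?_⟩
  intro t₀ δ ω hω hδ h0
  have hω1 : ∀ t, 1 ≤ ω t ∧ ω t ≤ u := by
    intro t
    rw [hω t]
    split_ifs
    · exact ⟨hu, le_rfl⟩
    · exact ⟨le_rfl, hu⟩
  have hmem : ∀ t, δ t ∈ I := by
    intro t
    have := mem_Icc_of_sum_score_eq_zero hpos (a := 0) (b := Real.log u) h0 hδ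
      (fun t => by rw [Real.exp_zero]; exact (hω1 t).1)
      (fun t => by rw [Real.exp_log hu0]; exact (hω1 t).2) t
    have h1 : min (min (r₃ / 2) (r₄ / 2)) 1 ≤ 1 := min_le_right _ _
    rw [hI, Set.mem_Icc]
    constructor <;> linarith
  have hδ3 : ∀ t s, |h (δ t) - h (δ s)| ≤ ε' := by
    intro t s
    have h1 : |δ t - δ s| < r₃ := by
      have : min (min (r₃ / 2) (r₄ / 2)) 1 ≤ r₃ / 2 := (min_le_left _ _).trans (min_le_left _ _)
      linarith [hδ t s]
    exact (H₃ _ (hmem t) _ (hmem s) h1).le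
  have hδ4 : ∀ t s, |Real.exp (δ t) - Real.exp (δ s)| ≤ ε' := by
    intro t s
    have h1 : |δ t - δ s| < r₄ := by
      have : min (min (r₃ / 2) (r₄ / 2)) 1 ≤ r₄ / 2 := (min_le_left _ _).trans (min_le_right _ _)
      linarith [hδ t s]
    exact (H₄ _ (hmem t) _ (hmem s) h1).le
  have hsumω : ∑ t, ω t = T * z := by
    have : ∀ t, ω t = (if t = t₀ then u - 1 else 0) + 1 := by
      intro t
      rw [hω t]
      split_ifs <;> ring
    rw [Finset.sum_congr rfl fun t _ => this t, Finset.sum_add_distrib]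
    simp only [Finset.sum_ite_eq', Finset.mem_univ, if_true, Finset.sum_const, Finset.card_univ,
      Fintype.card_fin, nsmul_eq_mul, mul_one]
    rw [hz]
    field_simp
    ring
  have hclose : ∀ t, |Real.exp (δ t) - z| < ρ := by
    intro t
    -- Replacing every weight `h (δ s)` by the single weight `h (δ t)` changes the vanishing
    -- weighted sum only by the oscillation of `h`. Thus the unweighted residuals nearly sum to
    -- zero, and the fitted mean is near the average outcome.
    have h1 : (∑ s, (ω s - Real.exp (δ s))) * h (δ t) =
        ∑ s, (ω s - Real.exp (δ s)) * (h (δ t) - h (δ s)) := by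
      rw [Finset.sum_mul, ← sub_eq_zero, ← Finset.sum_sub_distrib, ← h0]
      refine Finset.sum_congr rfl fun s _ => ?_
      rw [score]
      ring
    have h2 : |(∑ s, (ω s - Real.exp (δ s))) * h (δ t)| ≤ T * ((u + |M|) * ε') := by
      rw [h1]
      refine (Finset.abs_sum_le_sum_abs _ _).trans (sum_le_mul_of_le fun s => ?_)
      rw [abs_mul]
      refine mul_le_mul ?_ (hδ3 t s) (abs_nonneg _) hD.le
      have h3 := hM _ (hmem s)
      rw [Real.norm_eq_abs, abs_of_pos (Real.exp_pos _)] at h3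
      have h4 := le_abs_self M
      have h5 := hω1 s
      have h6 := Real.exp_pos (δ s)
      rw [abs_le]
      constructor <;> linarith [abs_nonneg M]
    have h3 : |∑ s, (ω s - Real.exp (δ s))| * m ≤ T * ((u + |M|) * ε') := by
      rw [abs_mul, abs_of_pos (hpos _)] at h2
      exact le_trans (mul_le_mul_of_nonneg_left (hx₀ (hmem t)) (abs_nonneg _)) h2
    have h4 : |∑ s, (Real.exp (δ t) - Real.exp (δ s))| ≤ T * ε' :=
      (Finset.abs_sum_le_sum_abs _ _).trans (sum_le_mul_of_le fun s => hδ4 t s)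
    have h5 : T * (Real.exp (δ t) - z) = (∑ s, (Real.exp (δ t) - Real.exp (δ s))) -
        ∑ s, (ω s - Real.exp (δ s)) := by
      rw [Finset.sum_sub_distrib, Finset.sum_sub_distrib, hsumω]
      simp only [Finset.sum_const, Finset.card_univ, Fintype.card_fin, nsmul_eq_mul]
      ring
    have h6 : |∑ s, (ω s - Real.exp (δ s))| ≤ T * (ρ / 4) := by
      have h7 : ε' ≤ ρ * m / (4 * (u + |M|)) := min_le_right _ _
      rw [le_div_iff₀ (by positivity)] at h7
      have h8 : |∑ s, (ω s - Real.exp (δ s))| * m ≤ T * (ρ / 4) * m := by nlinarith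
      exact le_of_mul_le_mul_right h8 hm0
    have h7 : T * ε' ≤ T * (ρ / 4) := by
      gcongr
      exact min_le_left _ _
    have h8 : T * |Real.exp (δ t) - z| ≤ T * (ρ / 2) := by
      rw [← abs_of_pos hT', ← abs_mul, abs_of_pos hT', h5]
      refine (abs_sub _ _).trans ?_
      linarith
    have := le_of_mul_le_mul_left h8 hT'
    linarith
  intro t
  have h1 := Hρ (hclose t)
  rw [Real.log_exp, Real.dist_eq, lt_min_iff, lt_min_iff] at h1
  refine ⟨h1.2.le, ?_⟩
  rw [← hscore]
  rw [hω t]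
  split_ifs
  · exact (H₂ h1.1.2).le
  · exact (H₁ h1.1.1).le

/-- Away from the contaminated pairs the score is nearly linear. -/
theorem exists_score_linear (hc : Continuous h) (hpos : ∀ τ, 0 < h τ) {ε : ℝ} (hε : 0 < ε) :
    ∃ r : ℝ, 0 < r ∧ r ≤ 1 ∧ ∀ π ω δ : ℝ, 1 - π ≤ ω → ω ≤ 1 → |δ| ≤ r →
      |score h ω δ - h 0 * (ω - 1 - δ)| ≤ ε * (π + (2 + h 0) * |δ|) ∧ h 0 / 2 ≤ h δ ∧
        h δ ≤ 2 * h 0 := by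
  have h0 := hpos 0
  obtain ⟨r, hr, H⟩ := Metric.continuousAt_iff.1 (hc.continuousAt (x := 0)) (min ε (h 0 / 2))
    (by positivity)
  refine ⟨min (min (r / 2) ε) 1, by positivity, min_le_right _ _, fun π ω δ h1 h2 h3 => ?_⟩
  have hδr : |δ| < r := by
    have : min (min (r / 2) ε) 1 ≤ r / 2 := (min_le_left _ _).trans (min_le_left _ _)
    linarith
  have hδε : |δ| ≤ ε := h3.trans ((min_le_left _ _).trans (min_le_right _ _))
  have hδ1 : |δ| ≤ 1 := h3.trans (min_le_right _ _)
  have h4 := H (show dist δ 0 < r by rwa [Real.dist_eq, sub_zero])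
  rw [Real.dist_eq, lt_min_iff] at h4
  have h5 := abs_lt.1 h4.2
  refine ⟨?_, by linarith, by linarith⟩
  have h6 : |Real.exp δ - 1 - δ| ≤ ε * |δ| := by
    refine (Real.abs_exp_sub_one_sub_id_le hδ1).trans ?_
    rw [← sq_abs, sq]
    exact mul_le_mul_of_nonneg_right hδε (abs_nonneg _)
  have h7 : |ω - Real.exp δ| ≤ π + 2 * |δ| := by
    have h8 := Real.abs_exp_sub_one_le hδ1
    have h9 := abs_le.1 h8
    rw [abs_le]
    constructor <;> linarith [abs_nonneg δ]
  have h8 : score h ω δ - h 0 * (ω - 1 - δ) =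
      (ω - Real.exp δ) * (h δ - h 0) - h 0 * (Real.exp δ - 1 - δ) := by
    rw [score]
    ring
  rw [h8]
  refine (abs_sub _ _).trans ?_
  rw [abs_mul, abs_mul, abs_of_pos h0]
  have h9 : |ω - Real.exp δ| * |h δ - h 0| ≤ (π + 2 * |δ|) * ε :=
    mul_le_mul h7 h4.1.le (abs_nonneg _) ((abs_nonneg _).trans h7)
  have h10 : h 0 * |Real.exp δ - 1 - δ| ≤ h 0 * (ε * |δ|) := by gcongr
  linarith

/-- Coercivity of the score for the energy estimate: `δ * (exp δ - 1)` is at least `δ ^ 2 / 2` when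
`|δ| ≤ 1`, and Young's inequality absorbs the perturbation `ω - 1` of size at most `π`. -/
theorem mul_score_le {π ω δ : ℝ} (h0 : 0 < h 0) (h1 : 1 - π ≤ ω) (h2 : ω ≤ 1) (hδ : |δ| ≤ 1)
    (h3 : h 0 / 2 ≤ h δ) (h4 : h δ ≤ 2 * h 0) :
    δ * score h ω δ ≤ -(h 0 / 8) * δ ^ 2 + 8 * h 0 * π ^ 2 := by
  have hd := abs_le.1 hδ
  have h5 : δ ^ 2 / 2 ≤ δ * (Real.exp δ - 1) := by
    rcases le_total 0 δ with h6 | h6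
    · nlinarith [Real.add_one_le_exp δ]
    · have h7 := (abs_le.1 (Real.abs_exp_sub_one_sub_id_le hδ)).2
      have h8 : Real.exp δ ≤ 1 + δ / 2 := by
        -- For negative `δ`, the convex exponential lies below its chord over `[-1, 0]`.
        have h10 := convexOn_exp.2 (Set.mem_univ (-1 : ℝ)) (Set.mem_univ (0 : ℝ))
          (show 0 ≤ -δ by linarith) (show 0 ≤ 1 + δ by linarith) (by ring)
        simp only [smul_eq_mul, Real.exp_zero, mul_neg, mul_one, neg_neg, mul_zero, add_zero] at h10
        have h11 : Real.exp (-1) ≤ 1 / 2 := by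
          rw [Real.exp_neg, ← one_div]
          refine one_div_le_one_div_of_le (by norm_num) ?_
          linarith [Real.add_one_le_exp 1]
        nlinarith
      nlinarith
  have h6 : δ * score h ω δ = -(δ * (Real.exp δ - 1)) * h δ + (ω - 1) * δ * h δ := by
    rw [score]
    ring
  have h7 : (ω - 1) * δ ≤ π * |δ| := by
    have : |(ω - 1) * δ| ≤ π * |δ| := by
      rw [abs_mul]
      gcongr
      rw [abs_le]
      constructor <;> linarith
    exact (le_abs_self _).trans this
  have hπ : 0 ≤ π := by linarith
  have hh : 0 ≤ h δ := by linarith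
  have h8 : (ω - 1) * δ * h δ ≤ π * |δ| * (2 * h 0) :=
    mul_le_mul h7 h4 hh (by positivity)
  have h9 : π * |δ| ≤ δ ^ 2 / 16 + 4 * π ^ 2 := by
    rw [← sq_abs δ]
    nlinarith [sq_nonneg (|δ| / 4 - 2 * π)]
  have h10 : δ ^ 2 / 2 * (h 0 / 2) ≤ δ * (Real.exp δ - 1) * h δ :=
    mul_le_mul h5 h3 (by positivity) (by nlinarith)
  rw [h6]
  nlinarith

theorem exists_score_bound (hc : Continuous h) (u : ℝ) :
    ∃ M : ℝ, 0 < M ∧ ∀ ω δ : ℝ, 0 ≤ ω → ω ≤ u → -1 ≤ δ → δ ≤ Real.log u + 1 →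
      |score h ω δ| ≤ M := by
  have hcont : Continuous fun q : ℝ × ℝ => score h q.1 q.2 := by
    unfold score
    fun_prop
  obtain ⟨M, hM⟩ := ((isCompact_Icc (a := (0 : ℝ)) (b := u)).prod
    (isCompact_Icc (a := (-1 : ℝ)) (b := Real.log u + 1))).exists_bound_of_continuousOn
      hcont.continuousOn
  refine ⟨|M| + 1, by positivity, fun ω δ h1 h2 h3 h4 => ?_⟩
  have := hM (ω, δ) ⟨⟨h1, h2⟩, ⟨h3, h4⟩⟩
  rw [Real.norm_eq_abs] at this
  linarith [le_abs_self M]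

end PairScore

/-! ### Fixed-effect conditions and the energy estimate. -/

theorem sum_abs_effects_le {ι : Type*} [Fintype ι] {T : ℕ} (P Q : ι → Fin T → ℝ) {τ π : ℝ}
    (hτ : 0 < τ) :
    π * (∑ i, ∑ t, |P i t| + ∑ i, ∑ t, |Q i t|) ≤
      τ * (∑ i, ∑ t, P i t ^ 2 + ∑ i, ∑ t, Q i t ^ 2) +
        Fintype.card ι * T * (π ^ 2 / (2 * τ)) := by
  have h1 : ∀ a : ℝ, π * |a| ≤ τ * a ^ 2 + π ^ 2 / (4 * τ) := by
    intro a
    rw [← sq_abs a, ← sub_nonneg]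
    have : τ * |a| ^ 2 + π ^ 2 / (4 * τ) - π * |a| = (2 * τ * |a| - π) ^ 2 / (4 * τ) := by
      field_simp
      ring
    rw [this]
    positivity
  have h2 : ∀ P : ι → Fin T → ℝ, π * ∑ i, ∑ t, |P i t| ≤
      τ * ∑ i, ∑ t, P i t ^ 2 + Fintype.card ι * T * (π ^ 2 / (4 * τ)) := by
    intro P
    have h3 : Fintype.card ι * T * (π ^ 2 / (4 * τ)) =
        ∑ i : ι, ∑ t : Fin T, π ^ 2 / (4 * τ) := by
      simp
      ring
    rw [h3, Finset.mul_sum, Finset.mul_sum, ← Finset.sum_add_distrib]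
    refine Finset.sum_le_sum fun i _ => ?_
    rw [Finset.mul_sum, Finset.mul_sum, ← Finset.sum_add_distrib]
    exact Finset.sum_le_sum fun t _ => h1 _
  have h3 : Fintype.card ι * T * (π ^ 2 / (2 * τ)) =
      Fintype.card ι * T * (π ^ 2 / (4 * τ)) + Fintype.card ι * T * (π ^ 2 / (4 * τ)) := by
    field_simp
    ring
  rw [h3]
  linarith [h2 P, h2 Q]

section FixedEffects

variable {ι : Type*} [Fintype ι] [DecidableEq ι] {T : ℕ}

theorem offDiag_univ_eq_filter :
    (Finset.univ : Finset ι).offDiag = Finset.univ.filter fun q : ι × ι => q.1 ≠ q.2 := by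
  ext q
  simp

theorem sum_offDiag_eq (f : ι → ι → ℝ) :
    ∑ q ∈ Finset.univ.offDiag, f q.1 q.2 = ∑ i, ∑ j ∈ Finset.univ.erase i, f i j := by
  have : ∀ i : ι, Finset.univ.erase i = Finset.univ.filter fun j => i ≠ j := by
    intro i
    ext j
    simp [eq_comm]
  rw [offDiag_univ_eq_filter, Finset.sum_filter, Fintype.sum_prod_type]
  refine Finset.sum_congr rfl fun i _ => ?_
  rw [this, Finset.sum_filter]

theorem sum_offDiag_eq' (f : ι → ι → ℝ) :
    ∑ q ∈ Finset.univ.offDiag, f q.1 q.2 = ∑ j, ∑ i ∈ Finset.univ.erase j, f i j := by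
  have : ∀ j : ι, Finset.univ.erase j = Finset.univ.filter fun i => i ≠ j := by
    intro j
    ext i
    simp
  rw [offDiag_univ_eq_filter, Finset.sum_filter, Fintype.sum_prod_type_right]
  refine Finset.sum_congr rfl fun i _ => ?_
  rw [this, Finset.sum_filter]

theorem sum_offDiag_eq_sub (f : ι → ι → ℝ) :
    ∑ q ∈ Finset.univ.offDiag, f q.1 q.2 = ∑ i, ∑ j, f i j - ∑ i, f i i := by
  rw [sum_offDiag_eq, ← Finset.sum_sub_distrib]
  exact Finset.sum_congr rfl fun i _ => Finset.sum_erase_eq_sub (Finset.mem_univ i)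

/-- The first-order conditions for the three sets of fixed effects, for scores `s`. -/
structure FixedEffectFOC (s : ι → ι → Fin T → ℝ) : Prop where
  row : ∀ i t, ∑ j ∈ Finset.univ.erase i, s i j t = 0
  col : ∀ j t, ∑ i ∈ Finset.univ.erase j, s i j t = 0
  pair : ∀ i j, i ≠ j → ∑ t, s i j t = 0

theorem FixedEffectFOC.sum_mul_eq_zero {s : ι → ι → Fin T → ℝ} (hs : FixedEffectFOC s)
    (P Q : ι → Fin T → ℝ) (R : ι → ι → ℝ) :
    ∑ q ∈ Finset.univ.offDiag, ∑ t, (P q.1 t + Q q.2 t + R q.1 q.2) * s q.1 q.2 t = 0 := by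
  simp only [add_mul, Finset.sum_add_distrib]
  have h1 : ∑ q ∈ (Finset.univ : Finset ι).offDiag, ∑ t, P q.1 t * s q.1 q.2 t = 0 := by
    rw [sum_offDiag_eq fun i j => ∑ t, P i t * s i j t]
    refine Finset.sum_eq_zero fun i _ => ?_
    rw [Finset.sum_comm]
    refine Finset.sum_eq_zero fun t _ => ?_
    rw [← Finset.mul_sum, hs.row, mul_zero]
  have h2 : ∑ q ∈ (Finset.univ : Finset ι).offDiag, ∑ t, Q q.2 t * s q.1 q.2 t = 0 := by
    rw [sum_offDiag_eq' fun i j => ∑ t, Q j t * s i j t]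
    refine Finset.sum_eq_zero fun i _ => ?_
    rw [Finset.sum_comm]
    refine Finset.sum_eq_zero fun t _ => ?_
    rw [← Finset.mul_sum, hs.col, mul_zero]
  have h3 : ∑ q ∈ (Finset.univ : Finset ι).offDiag, ∑ t, R q.1 q.2 * s q.1 q.2 t = 0 := by
    refine Finset.sum_eq_zero fun q hq => ?_
    rw [← Finset.mul_sum, hs.pair _ _ (by simpa using hq), mul_zero]
  rw [h1, h2, h3, add_zero, add_zero]

/-- With `P` centered, the cross terms cancel over the full square and the sum is exactly `N * V`,
where `V` is the sum of all squared effects. The diagonal costs at most `2 * V` and the sparse set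
`E` at most `2 * π * N * V`, which leaves half. -/
theorem sum_sq_effects_le {E : Finset (ι × ι)} {π : ℝ} (hE : SparsePairs E π)
    (P Q : ι → Fin T → ℝ) (hP : ∀ t, ∑ i, P i t = 0)
    (hN : 2 + 2 * π * Fintype.card ι ≤ Fintype.card ι / 2) :
    Fintype.card ι / 2 * (∑ i, ∑ t, P i t ^ 2 + ∑ i, ∑ t, Q i t ^ 2) ≤
      ∑ q ∈ Finset.univ.offDiag \ E, ∑ t, (P q.1 t + Q q.2 t) ^ 2 := by
  set N : ℝ := (Fintype.card ι : ℝ)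
  set V := ∑ i, ∑ t, P i t ^ 2 + ∑ i, ∑ t, Q i t ^ 2 with hV
  have hV0 : 0 ≤ V := by positivity
  have h1 : ∀ i j, ∑ t, (P i t + Q j t) ^ 2 ≤ 2 * ∑ t, P i t ^ 2 + 2 * ∑ t, Q j t ^ 2 := by
    intro i j
    rw [Finset.mul_sum, Finset.mul_sum, ← Finset.sum_add_distrib]
    exact Finset.sum_le_sum fun t _ => by nlinarith [sq_nonneg (P i t - Q j t)]
  have hfull : ∑ i, ∑ j, ∑ t, (P i t + Q j t) ^ 2 = N * V := by
    have h2 : ∀ i j, ∑ t, (P i t + Q j t) ^ 2 =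
        ∑ t, P i t ^ 2 + ∑ t, 2 * (P i t * Q j t) + ∑ t, Q j t ^ 2 := by
      intro i j
      rw [← Finset.sum_add_distrib, ← Finset.sum_add_distrib]
      exact Finset.sum_congr rfl fun t _ => by ring
    have h3 : ∑ i, ∑ j, ∑ t, 2 * (P i t * Q j t) = 0 := by
      rw [Finset.sum_comm]
      refine Finset.sum_eq_zero fun j _ => ?_
      rw [Finset.sum_comm]
      refine Finset.sum_eq_zero fun t _ => ?_
      rw [← Finset.mul_sum, ← Finset.sum_mul, hP, zero_mul, mul_zero]
    simp only [h2, Finset.sum_add_distrib, h3, add_zero, Finset.sum_const, Finset.card_univ,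
      nsmul_eq_mul]
    rw [← Finset.mul_sum, hV, mul_add]
  have hdiag : ∑ i, ∑ t, (P i t + Q i t) ^ 2 ≤ 2 * V := by
    refine (Finset.sum_le_sum fun i _ => h1 i i).trans (le_of_eq ?_)
    rw [Finset.sum_add_distrib, ← Finset.mul_sum, ← Finset.mul_sum, hV]
    ring
  have hEsum : ∑ q ∈ E, ∑ t, (P q.1 t + Q q.2 t) ^ 2 ≤ 2 * (π * N * V) := by
    refine (Finset.sum_le_sum fun q _ => h1 q.1 q.2).trans ?_
    rw [Finset.sum_add_distrib, ← Finset.mul_sum, ← Finset.mul_sum]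
    have h2 := hE.sum_row_le (a := fun i => ∑ t, P i t ^ 2) fun i => by positivity
    have h3 := hE.sum_col_le (a := fun i => ∑ t, Q i t ^ 2) fun i => by positivity
    rw [hV]
    linarith
  have hsplit := Finset.sum_sdiff (f := fun q : ι × ι => ∑ t, (P q.1 t + Q q.2 t) ^ 2) hE.offDiag
  rw [sum_offDiag_eq_sub fun i j => ∑ t, (P i t + Q j t) ^ 2, hfull] at hsplit
  nlinarith

/-- The fitted log-means are, in mean square over the pairs outside `E`, of the order of the
contamination. -/
theorem sum_sq_fittedLog_le {h : ℝ → ℝ} (h0 : 0 < h 0) {E : Finset (ι × ι)} {t₀ : Fin T}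
    {π ξ₀ M : ℝ} {ω ξ : ι → ι → Fin T → ℝ} {P Q : ι → Fin T → ℝ} {R : ι → ι → ℝ}
    (hM : 0 < M) (hξ0 : 0 ≤ ξ₀) (hξ1 : ξ₀ ≤ 1) (hE : SparsePairs E π)
    (hN : 2 + 2 * π * Fintype.card ι ≤ Fintype.card ι / 2)
    (hω : ∀ i j, i ≠ j → (i, j) ∉ E → ∀ t, 1 - π ≤ ω i j t ∧ ω i j t ≤ 1)
    (hξ : ∀ i j t, |ξ i j t| ≤ ξ₀)
    (hP : ∀ i, P i t₀ = 0) (hQ : ∀ j, Q j t₀ = 0) (hPsum : ∀ t, ∑ i, P i t = 0)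
    (hfoc : FixedEffectFOC fun i j t => score h (ω i j t) (fittedLog ξ P Q R i j t))
    (hs : ∀ i j, i ≠ j → ∀ t, |score h (ω i j t) (fittedLog ξ P Q R i j t)| ≤ M)
    (hδ : ∀ i j, i ≠ j → (i, j) ∉ E → ∀ t, |fittedLog ξ P Q R i j t| ≤ 1 ∧
      h 0 / 2 ≤ h (fittedLog ξ P Q R i j t) ∧ h (fittedLog ξ P Q R i j t) ≤ 2 * h 0) :
    ∑ q ∈ Finset.univ.offDiag \ E, ∑ t, fittedLog ξ P Q R q.1 q.2 t ^ 2 ≤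
      16 / h 0 * (8 * h 0 * T + M * T + h 0 / 16 + 128 * T ^ 2 * M ^ 2 / h 0) * (π ^ 2 + ξ₀) *
        (Fintype.card ι : ℝ) ^ 2 := by
  set N : ℝ := (Fintype.card ι : ℝ) with hNdef
  set δ := fittedLog ξ P Q R with hδdef
  set O : Finset (ι × ι) := Finset.univ.offDiag with hO
  set A := ∑ q ∈ O \ E, ∑ t, δ q.1 q.2 t ^ 2 with hA
  set V := ∑ i, ∑ t, P i t ^ 2 + ∑ i, ∑ t, Q i t ^ 2 with hV
  set W := ∑ i, ∑ t, |P i t| + ∑ i, ∑ t, |Q i t| with hW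
  set s : ι → ι → Fin T → ℝ := fun i j t => score h (ω i j t) (δ i j t) with hsdef
  have hT : (1 : ℝ) ≤ T := by
    have : 0 < T := Fin.pos t₀
    exact_mod_cast this
  have hN0 : 0 ≤ N := Nat.cast_nonneg _
  have hmem : ∀ q ∈ O \ E, q.1 ≠ q.2 ∧ (q.1, q.2) ∉ E := by
    intro q hq
    rw [Finset.mem_sdiff, hO, Finset.mem_offDiag] at hq
    exact ⟨hq.1.2.2, hq.2⟩
  have hcard : ((O \ E).card : ℝ) ≤ N ^ 2 :=
    le_trans (by exact_mod_cast Finset.card_le_card Finset.sdiff_subset) card_offDiag_le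
  have hPQ : ∀ q ∈ O \ E, ∑ t, (P q.1 t + Q q.2 t) ^ 2 ≤
      8 * T * ∑ t, δ q.1 q.2 t ^ 2 + 8 * T * ξ₀ ^ 2 := by
    intro q hq
    have h1 : ∀ t, (P q.1 t + Q q.2 t) ^ 2 ≤ 4 * δ q.1 q.2 t ^ 2 + 4 * δ q.1 q.2 t₀ ^ 2 +
        8 * ξ₀ ^ 2 := by
      intro t
      -- Differencing against period `t₀`, where both effects vanish, eliminates the pair effect.
      have h2 : P q.1 t + Q q.2 t =
          δ q.1 q.2 t - δ q.1 q.2 t₀ - ξ q.1 q.2 t + ξ q.1 q.2 t₀ := by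
        simp only [hδdef, fittedLog, hP, hQ]
        ring
      have h3 : ∀ t, ξ q.1 q.2 t ^ 2 ≤ ξ₀ ^ 2 := fun t => by
        rw [← sq_abs]
        exact pow_le_pow_left₀ (abs_nonneg _) (hξ _ _ _) 2
      have h4 : ∀ a b c d : ℝ, (a - b - c + d) ^ 2 ≤ 4 * a ^ 2 + 4 * b ^ 2 + 4 * c ^ 2 +
          4 * d ^ 2 := by
        intro a b c d
        nlinarith [sq_nonneg (a + b), sq_nonneg (a + c), sq_nonneg (a - d), sq_nonneg (b - c),
          sq_nonneg (b + d), sq_nonneg (c + d)]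
      rw [h2]
      linarith [h4 (δ q.1 q.2 t) (δ q.1 q.2 t₀) (ξ q.1 q.2 t) (ξ q.1 q.2 t₀), h3 t, h3 t₀]
    have h2 := Finset.sum_le_sum fun t (_ : t ∈ Finset.univ) => h1 t
    rw [Finset.sum_add_distrib, Finset.sum_add_distrib, ← Finset.mul_sum] at h2
    simp only [Finset.sum_const, Finset.card_univ, Fintype.card_fin, nsmul_eq_mul] at h2
    have h3 : δ q.1 q.2 t₀ ^ 2 ≤ ∑ t, δ q.1 q.2 t ^ 2 :=
      Finset.single_le_sum (f := fun t => δ q.1 q.2 t ^ 2) (fun t _ => sq_nonneg _)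
        (Finset.mem_univ t₀)
    have h4 : 0 ≤ ∑ t, δ q.1 q.2 t ^ 2 := by positivity
    nlinarith
  have hNV : N * V ≤ 16 * T * A + 16 * T * N ^ 2 * ξ₀ ^ 2 := by
    have h1 := sum_sq_effects_le hE P Q hPsum hN
    have h2 := h1.trans (Finset.sum_le_sum hPQ)
    rw [Finset.sum_add_distrib, ← Finset.mul_sum, Finset.sum_const, nsmul_eq_mul] at h2
    have h3 : ((O \ E).card : ℝ) * (8 * T * ξ₀ ^ 2) ≤ N ^ 2 * (8 * T * ξ₀ ^ 2) := by gcongr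
    linarith
  have hW0 : 0 ≤ W := by positivity
  have hEs : |∑ q ∈ E, ∑ t, (P q.1 t + Q q.2 t) * s q.1 q.2 t| ≤ M * (π * N * W) := by
    have h1 : ∀ q ∈ E, |∑ t, (P q.1 t + Q q.2 t) * s q.1 q.2 t| ≤
        M * ∑ t, |P q.1 t| + M * ∑ t, |Q q.2 t| := by
      intro q hq
      have hne : q.1 ≠ q.2 := by simpa using hE.offDiag hq
      refine (Finset.abs_sum_le_sum_abs _ _).trans ?_
      rw [Finset.mul_sum, Finset.mul_sum, ← Finset.sum_add_distrib]
      refine Finset.sum_le_sum fun t _ => ?_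
      rw [abs_mul]
      have := mul_le_mul (abs_add_le (P q.1 t) (Q q.2 t)) (hs q.1 q.2 hne t) (abs_nonneg _)
        (by positivity)
      linarith
    refine (Finset.abs_sum_le_sum_abs _ _).trans ((Finset.sum_le_sum h1).trans ?_)
    rw [Finset.sum_add_distrib, ← Finset.mul_sum, ← Finset.mul_sum]
    have h2 := hE.sum_row_le (a := fun i => ∑ t, |P i t|) fun i => by positivity
    have h3 := hE.sum_col_le (a := fun i => ∑ t, |Q i t|) fun i => by positivity
    rw [← mul_add]
    refine mul_le_mul_of_nonneg_left ?_ hM.le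
    rw [hW, mul_add]
    exact add_le_add h2 h3
  have hbase : ∀ q ∈ O \ E, ∑ t, (P q.1 t + Q q.2 t) * s q.1 q.2 t ≤
      -(h 0 / 8) * ∑ t, δ q.1 q.2 t ^ 2 + T * (8 * h 0 * π ^ 2 + ξ₀ * M) := by
    intro q hq
    obtain ⟨hne, hqE⟩ := hmem q hq
    -- By the pair condition `R` may be added for free, so the test direction `P + Q` becomes `δ -
    -- ξ` and the coercivity of the score applies.
    have h1 : ∑ t, (P q.1 t + Q q.2 t) * s q.1 q.2 t =
        ∑ t, (δ q.1 q.2 t * s q.1 q.2 t - ξ q.1 q.2 t * s q.1 q.2 t) := by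
      have h2 : ∑ t, R q.1 q.2 * s q.1 q.2 t = 0 := by
        rw [← Finset.mul_sum, hfoc.pair _ _ hne, mul_zero]
      rw [← add_zero (∑ t, (P q.1 t + Q q.2 t) * s q.1 q.2 t), ← h2, ← Finset.sum_add_distrib]
      refine Finset.sum_congr rfl fun t _ => ?_
      simp only [hδdef, fittedLog]
      ring
    rw [h1, Finset.mul_sum]
    have h2 : (T : ℝ) * (8 * h 0 * π ^ 2 + ξ₀ * M) =
        ∑ t : Fin T, (8 * h 0 * π ^ 2 + ξ₀ * M) := by
      rw [Finset.sum_const, Finset.card_univ, Fintype.card_fin, nsmul_eq_mul]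
    rw [h2, ← Finset.sum_add_distrib]
    refine Finset.sum_le_sum fun t _ => ?_
    obtain ⟨h3, h4⟩ := hω _ _ hne hqE t
    obtain ⟨h5, h6, h7⟩ := hδ _ _ hne hqE t
    have h8 := mul_score_le h0 h3 h4 h5 h6 h7
    have h9 : |ξ q.1 q.2 t * s q.1 q.2 t| ≤ ξ₀ * M := by
      rw [abs_mul]
      exact mul_le_mul (hξ _ _ _) (hs _ _ hne t) (abs_nonneg _) hξ0
    have h10 := (abs_le.1 h9).1
    simp only [hsdef] at h10 ⊢
    linarith
  -- The test direction omits `R`: on `E` the pair effect need not be small, while the row and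
  -- column sums of `P` and `Q` over `E` are controlled by sparsity.
  have htot := hfoc.sum_mul_eq_zero P Q 0
  simp only [Pi.zero_apply, add_zero] at htot
  rw [← hO, ← Finset.sum_sdiff hE.offDiag] at htot
  have hsum := Finset.sum_le_sum hbase
  rw [Finset.sum_add_distrib, ← Finset.mul_sum, Finset.sum_const, nsmul_eq_mul, ← hA] at hsum
  have hc2 : ((O \ E).card : ℝ) * (T * (8 * h 0 * π ^ 2 + ξ₀ * M)) ≤
      N ^ 2 * (T * (8 * h 0 * π ^ 2 + ξ₀ * M)) := by gcongr
  have hmain : h 0 / 8 * A ≤ N ^ 2 * (T * (8 * h 0 * π ^ 2 + ξ₀ * M)) + M * (π * N * W) := by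
    have := (abs_le.1 hEs).2
    linarith
  -- The Young parameter is such that the contribution of `E` takes up exactly `h 0 / 16 * A`, half
  -- of the coercive term.
  set τ := h 0 / (256 * T * M) with hτ
  have hT0 : (0 : ℝ) < T := by linarith
  have hτ0 : 0 < τ := by positivity
  have hWV := sum_abs_effects_le P Q (π := π) hτ0
  rw [← hW, ← hV, ← hNdef] at hWV
  have e1 : M * (π * N * W) ≤ M * N * (τ * V + N * T * (π ^ 2 / (2 * τ))) := by
    have : M * (π * N * W) = M * N * (π * W) := by ring
    rw [this]
    gcongr
  have e2 : M * τ * (N * V) ≤ M * τ * (16 * T * A + 16 * T * N ^ 2 * ξ₀ ^ 2) := by gcongr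
  have e3 : M * τ * (16 * T * A + 16 * T * N ^ 2 * ξ₀ ^ 2) = h 0 / 16 * A +
      h 0 / 16 * N ^ 2 * ξ₀ ^ 2 := by
    rw [hτ]
    field_simp
    ring
  have e4 : M * N * (N * T * (π ^ 2 / (2 * τ))) = 128 * T ^ 2 * M ^ 2 / h 0 * π ^ 2 * N ^ 2 := by
    rw [hτ]
    field_simp
    ring
  have e5 : h 0 / 16 * A ≤ (8 * h 0 * T + M * T + h 0 / 16 + 128 * T ^ 2 * M ^ 2 / h 0) *
      (π ^ 2 + ξ₀) * N ^ 2 := by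
    have f1 : h 0 / 16 * A ≤ (8 * h 0 * T * π ^ 2 + M * T * ξ₀ + h 0 / 16 * ξ₀ ^ 2 +
        128 * T ^ 2 * M ^ 2 / h 0 * π ^ 2) * N ^ 2 := by linarith
    refine f1.trans (mul_le_mul_of_nonneg_right ?_ (sq_nonneg N))
    have g1 : 0 ≤ 128 * T ^ 2 * M ^ 2 / h 0 := by positivity
    have g2 : ξ₀ ^ 2 ≤ ξ₀ := by nlinarith
    have g3 : h 0 / 16 * ξ₀ ^ 2 ≤ h 0 / 16 * ξ₀ := by gcongr
    have g4 : 0 ≤ h 0 / 16 * π ^ 2 := by positivity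
    have g5 : 0 ≤ 8 * h 0 * T * ξ₀ := by positivity
    have g6 : 0 ≤ M * T * π ^ 2 := by positivity
    have g7 : 0 ≤ 128 * T ^ 2 * M ^ 2 / h 0 * ξ₀ := by positivity
    linarith
  have e6 : A = 16 / h 0 * (h 0 / 16 * A) := by
    field_simp
  rw [e6, mul_assoc, mul_assoc]
  refine mul_le_mul_of_nonneg_left ?_ (by positivity)
  rw [← mul_assoc]
  exact e5

end FixedEffects

/-! ### Bias of the score in a residualized direction. -/

section ScoreBias

variable {ι : Type*} [Fintype ι] [DecidableEq ι] {T : ℕ}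

/-- A test direction with vanishing row, column and time sums is bounded by `B`. -/
structure ResidualDirection (v : ι → ι → Fin T → ℝ) (B : ℝ) : Prop where
  bound : ∀ i j t, |v i j t| ≤ B
  row : ∀ i t, ∑ j, v i j t = 0
  col : ∀ j t, ∑ i, v i j t = 0
  pair : ∀ i j, ∑ t, v i j t = 0

/-- The direction `v` annihilates the fixed effects over the full square. What remains is the
regression part `ξ` and the missing diagonal, which is only of order `N`. -/
theorem ResidualDirection.abs_sum_mul_fittedLog_le {v : ι → ι → Fin T → ℝ} {B ξ₀ : ℝ}
    (hv : ResidualDirection v B) (hB : 0 ≤ B) {ξ : ι → ι → Fin T → ℝ} {P Q : ι → Fin T → ℝ}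
    {R : ι → ι → ℝ} (hξ : ∀ i j t, |ξ i j t| ≤ ξ₀) (hξ0 : 0 ≤ ξ₀) (hP : ∀ i t, |P i t| ≤ 1)
    (hQ : ∀ i t, |Q i t| ≤ 1) :
    |∑ q ∈ Finset.univ.offDiag, ∑ t, v q.1 q.2 t * fittedLog ξ P Q R q.1 q.2 t| ≤
      T * B * ξ₀ * (Fintype.card ι : ℝ) ^ 2 + 2 * T * B * Fintype.card ι := by
  set N : ℝ := (Fintype.card ι : ℝ) with hN
  have hsplit : ∀ q : ι × ι, ∑ t, v q.1 q.2 t * fittedLog ξ P Q R q.1 q.2 t =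
      ∑ t, v q.1 q.2 t * ξ q.1 q.2 t + ∑ t, v q.1 q.2 t * P q.1 t + ∑ t, v q.1 q.2 t * Q q.2 t := by
    intro q
    have h1 : ∑ t, v q.1 q.2 t * R q.1 q.2 = 0 := by
      rw [← Finset.sum_mul, hv.pair, zero_mul]
    rw [← add_zero (∑ t, v q.1 q.2 t * ξ q.1 q.2 t + _ + _), ← h1, ← Finset.sum_add_distrib,
      ← Finset.sum_add_distrib, ← Finset.sum_add_distrib]
    refine Finset.sum_congr rfl fun t _ => ?_
    rw [fittedLog]
    ring
  have hPs : ∑ q ∈ (Finset.univ : Finset ι).offDiag, ∑ t, v q.1 q.2 t * P q.1 t =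
      -∑ i, ∑ t, v i i t * P i t := by
    rw [sum_offDiag_eq_sub fun i j => ∑ t, v i j t * P i t]
    have : ∑ i, ∑ j, ∑ t, v i j t * P i t = 0 := by
      refine Finset.sum_eq_zero fun i _ => ?_
      rw [Finset.sum_comm]
      refine Finset.sum_eq_zero fun t _ => ?_
      rw [← Finset.sum_mul, hv.row, zero_mul]
    rw [this, zero_sub]
  have hQs : ∑ q ∈ (Finset.univ : Finset ι).offDiag, ∑ t, v q.1 q.2 t * Q q.2 t =
      -∑ i, ∑ t, v i i t * Q i t := by
    rw [sum_offDiag_eq_sub fun i j => ∑ t, v i j t * Q j t]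
    have : ∑ i, ∑ j, ∑ t, v i j t * Q j t = 0 := by
      rw [Finset.sum_comm]
      refine Finset.sum_eq_zero fun i _ => ?_
      rw [Finset.sum_comm]
      refine Finset.sum_eq_zero fun t _ => ?_
      rw [← Finset.sum_mul, hv.col, zero_mul]
    rw [this, zero_sub]
  have hdiag : ∀ P : ι → Fin T → ℝ, (∀ i t, |P i t| ≤ 1) →
      |-∑ i, ∑ t, v i i t * P i t| ≤ T * B * N := by
    intro P hP
    rw [abs_neg]
    refine (Finset.abs_sum_le_sum_abs _ _).trans ?_
    have : ∀ i, |∑ t, v i i t * P i t| ≤ T * B := by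
      intro i
      refine (Finset.abs_sum_le_sum_abs _ _).trans (sum_le_mul_of_le fun t => ?_)
      rw [abs_mul]
      simpa using mul_le_mul (hv.bound i i t) (hP i t) (abs_nonneg _) hB
    refine (Finset.sum_le_sum fun i _ => this i).trans ?_
    rw [Finset.sum_const, nsmul_eq_mul, Finset.card_univ, mul_comm]
  have hξs : |∑ q ∈ (Finset.univ : Finset ι).offDiag, ∑ t, v q.1 q.2 t * ξ q.1 q.2 t| ≤
      T * B * ξ₀ * N ^ 2 := by
    refine (Finset.abs_sum_le_sum_abs _ _).trans ?_
    have : ∀ q : ι × ι, |∑ t, v q.1 q.2 t * ξ q.1 q.2 t| ≤ T * (B * ξ₀) := by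
      intro q
      refine (Finset.abs_sum_le_sum_abs _ _).trans (sum_le_mul_of_le fun t => ?_)
      rw [abs_mul]
      exact mul_le_mul (hv.bound _ _ t) (hξ _ _ t) (abs_nonneg _) hB
    refine (Finset.sum_le_sum fun q _ => this q).trans ?_
    rw [Finset.sum_const, nsmul_eq_mul]
    calc _ ≤ N ^ 2 * (T * (B * ξ₀)) := by
          gcongr
          exact card_offDiag_le
      _ = _ := by ring
  simp only [hsplit, Finset.sum_add_distrib, hPs, hQs]
  refine (abs_add_le _ _).trans ?_
  have h1 := abs_add_le (∑ q ∈ (Finset.univ : Finset ι).offDiag, ∑ t, v q.1 q.2 t * ξ q.1 q.2 t)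
    (-∑ i, ∑ t, v i i t * P i t)
  linarith [hdiag P hP, hdiag Q hQ]

/-- The score in a residual direction sees the contaminated pairs with a weight that is
proportional to the change `h₁ - h 0` of the weight function. -/
theorem score_bias_le {h : ℝ → ℝ} (h0 : 0 < h 0) {E : Finset (ι × ι)} {t₀ : Fin T}
    {B ξ₀ ε π K lam u z h₁ : ℝ} {ω ξ v : ι → ι → Fin T → ℝ} {P Q : ι → Fin T → ℝ}
    {R : ι → ι → ℝ} (hv : ResidualDirection v B) (hB : 0 < B) (hε : 0 < ε) (hπ : 0 < π)
    (hE : SparsePairs E π) (hξ : ∀ i j t, |ξ i j t| ≤ ξ₀) (hξ0 : 0 ≤ ξ₀)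
    (hP : ∀ i t, |P i t| ≤ 1) (hQ : ∀ i t, |Q i t| ≤ 1)
    (hlin : ∀ i j, i ≠ j → (i, j) ∉ E → ∀ t,
      |score h (ω i j t) (fittedLog ξ P Q R i j t) -
        h 0 * (ω i j t - 1 - fittedLog ξ P Q R i j t)| ≤
        ε * (π + (2 + h 0) * |fittedLog ξ P Q R i j t|))
    (hev : ∀ i j, (i, j) ∈ E → ∀ t, |fittedLog ξ P Q R i j t - Real.log z| ≤ ε ∧
      |score h (ω i j t) (fittedLog ξ P Q R i j t) - (ω i j t - z) * h₁| ≤ ε)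
    (hωE : ∀ i j, (i, j) ∈ E → ∀ t, ω i j t = if t = t₀ then u else 1)
    (hωv : |∑ q ∈ Finset.univ.offDiag, ∑ t, v q.1 q.2 t * (ω q.1 q.2 t - 1)| ≤
      lam * (Fintype.card ι : ℝ) ^ 2)
    (hsq : ∑ q ∈ Finset.univ.offDiag \ E, ∑ t, fittedLog ξ P Q R q.1 q.2 t ^ 2 ≤
      K * π ^ 2 * (Fintype.card ι : ℝ) ^ 2)
    (hfoc : ∑ q ∈ Finset.univ.offDiag, ∑ t,
      v q.1 q.2 t * score h (ω q.1 q.2 t) (fittedLog ξ P Q R q.1 q.2 t) = 0) :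
    |(u - 1) * (h₁ - h 0) * ∑ q ∈ E, v q.1 q.2 t₀| ≤
      h 0 * (lam * (Fintype.card ι : ℝ) ^ 2 + (T * B * ξ₀ * (Fintype.card ι : ℝ) ^ 2 +
        2 * T * B * Fintype.card ι)) +
      (T * B * (1 + h 0) + B * (T + (2 + h 0) * (K + T))) * (ε * π) *
        (Fintype.card ι : ℝ) ^ 2 := by
  set N : ℝ := (Fintype.card ι : ℝ) with hN
  set δ := fittedLog ξ P Q R with hδ
  set O : Finset (ι × ι) := Finset.univ.offDiag with hO
  set ρ : ι → ι → Fin T → ℝ := fun i j t =>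
    score h (ω i j t) (δ i j t) - h 0 * (ω i j t - 1 - δ i j t) with hρ
  have hvδ := hv.abs_sum_mul_fittedLog_le (R := R) hB.le hξ hξ0 hP hQ
  rw [← hδ, ← hN, ← hO] at hvδ
  have hEterm : ∀ q ∈ E, |∑ t, v q.1 q.2 t * ρ q.1 q.2 t -
      (u - 1) * (h₁ - h 0) * v q.1 q.2 t₀| ≤ T * (B * (ε * (1 + h 0))) := by
    intro q hq
    have h1 : ∑ t, v q.1 q.2 t * ρ q.1 q.2 t - (u - 1) * (h₁ - h 0) * v q.1 q.2 t₀ =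
        ∑ t, v q.1 q.2 t * ((score h (ω q.1 q.2 t) (δ q.1 q.2 t) - (ω q.1 q.2 t - z) * h₁) +
          h 0 * (δ q.1 q.2 t - Real.log z)) := by
      have h2 : (u - 1) * (h₁ - h 0) * v q.1 q.2 t₀ =
          ∑ t, v q.1 q.2 t * (if t = t₀ then (u - 1) * (h₁ - h 0) else 0) := by
        simp [mul_comm]
      -- Terms constant over time are invisible to `v`. Hence the level `z` absorbed by the pair
      -- effect drops out, and only the shock at `t₀` with its changed weight survives.
      have h3 : ∑ t, v q.1 q.2 t * (h₁ - z * h₁ + h 0 * Real.log z) = 0 := by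
        rw [← Finset.sum_mul, hv.pair, zero_mul]
      have h4 : ∀ t, v q.1 q.2 t * ((score h (ω q.1 q.2 t) (δ q.1 q.2 t) - (ω q.1 q.2 t - z) * h₁) +
          h 0 * (δ q.1 q.2 t - Real.log z)) = v q.1 q.2 t * ρ q.1 q.2 t -
          v q.1 q.2 t * (if t = t₀ then (u - 1) * (h₁ - h 0) else 0) -
          v q.1 q.2 t * (h₁ - z * h₁ + h 0 * Real.log z) := by
        intro t
        simp only [hρ, hωE q.1 q.2 hq t]
        split_ifs <;> ring
      rw [Finset.sum_congr rfl fun t _ => h4 t, Finset.sum_sub_distrib, Finset.sum_sub_distrib, h3,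
        sub_zero, h2]
    rw [h1]
    refine (Finset.abs_sum_le_sum_abs _ _).trans (sum_le_mul_of_le fun t => ?_)
    rw [abs_mul]
    refine mul_le_mul (hv.bound _ _ _) ?_ (abs_nonneg _) hB.le
    obtain ⟨h2, h3⟩ := hev q.1 q.2 hq t
    refine (abs_add_le _ _).trans ?_
    rw [abs_mul, abs_of_pos h0]
    nlinarith
  have hEsum : |∑ q ∈ E, ∑ t, v q.1 q.2 t * ρ q.1 q.2 t -
      (u - 1) * (h₁ - h 0) * ∑ q ∈ E, v q.1 q.2 t₀| ≤ π * N ^ 2 * (T * (B * (ε * (1 + h 0)))) := by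
    rw [Finset.mul_sum, ← Finset.sum_sub_distrib]
    refine (Finset.abs_sum_le_sum_abs _ _).trans ((Finset.sum_le_sum hEterm).trans ?_)
    rw [Finset.sum_const, nsmul_eq_mul]
    exact mul_le_mul_of_nonneg_right hE.card_le (by positivity)
  have hmem : ∀ q ∈ O \ E, q.1 ≠ q.2 ∧ (q.1, q.2) ∉ E := by
    intro q hq
    rw [Finset.mem_sdiff, hO, Finset.mem_offDiag] at hq
    exact ⟨hq.1.2.2, hq.2⟩
  have hcard : ((O \ E).card : ℝ) ≤ N ^ 2 :=
    le_trans (by exact_mod_cast Finset.card_le_card Finset.sdiff_subset) card_offDiag_le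
  have habs : ∑ q ∈ O \ E, ∑ t, |δ q.1 q.2 t| ≤ (K + T) * π * N ^ 2 := by
    -- Balancing at scale `π` turns a mean square of order `π ^ 2` into a mean absolute value of
    -- order `π`, comparable with the signal.
    have h1 : ∀ a : ℝ, |a| ≤ a ^ 2 / π + π := by
      intro a
      rw [← sq_abs a, ← sub_nonneg]
      have : |a| ^ 2 / π + π - |a| = ((|a| - π / 2) ^ 2 + 3 * π ^ 2 / 4) / π := by
        field_simp
        ring
      rw [this]
      positivity
    have h2 : ∀ q ∈ O \ E, ∑ t, |δ q.1 q.2 t| ≤ (∑ t, δ q.1 q.2 t ^ 2) / π + T * π := by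
      intro q _
      have h3 : (T : ℝ) * π = ∑ t : Fin T, π := by simp
      rw [Finset.sum_div, h3, ← Finset.sum_add_distrib]
      exact Finset.sum_le_sum fun t _ => h1 _
    refine (Finset.sum_le_sum h2).trans ?_
    rw [Finset.sum_add_distrib, ← Finset.sum_div, Finset.sum_const, nsmul_eq_mul]
    have h3 : (∑ q ∈ O \ E, ∑ t, δ q.1 q.2 t ^ 2) / π ≤ K * π * N ^ 2 := by
      rw [div_le_iff₀ hπ]
      linarith
    have h4 : ((O \ E).card : ℝ) * (T * π) ≤ N ^ 2 * (T * π) := by gcongr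
    linarith
  have hbase : |∑ q ∈ O \ E, ∑ t, v q.1 q.2 t * ρ q.1 q.2 t| ≤
      B * ε * (T + (2 + h 0) * (K + T)) * π * N ^ 2 := by
    have h1 : ∀ q ∈ O \ E, |∑ t, v q.1 q.2 t * ρ q.1 q.2 t| ≤
        B * ε * (T * π + (2 + h 0) * ∑ t, |δ q.1 q.2 t|) := by
      intro q hq
      obtain ⟨hne, hqE⟩ := hmem q hq
      have h3 : B * ε * (T * π + (2 + h 0) * ∑ t, |δ q.1 q.2 t|) =
          ∑ t, B * (ε * (π + (2 + h 0) * |δ q.1 q.2 t|)) := by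
        rw [← Finset.mul_sum, ← Finset.mul_sum, Finset.sum_add_distrib, ← Finset.mul_sum,
          Finset.sum_const, Finset.card_univ, Fintype.card_fin, nsmul_eq_mul]
        ring
      rw [h3]
      refine (Finset.abs_sum_le_sum_abs _ _).trans (Finset.sum_le_sum fun t _ => ?_)
      rw [abs_mul]
      exact mul_le_mul (hv.bound _ _ _) (hlin _ _ hne hqE t) (abs_nonneg _) hB.le
    refine (Finset.abs_sum_le_sum_abs _ _).trans ((Finset.sum_le_sum h1).trans ?_)
    rw [← Finset.mul_sum, Finset.sum_add_distrib, Finset.sum_const, nsmul_eq_mul, ← Finset.mul_sum]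
    have h4 : ((O \ E).card : ℝ) * (T * π) ≤ N ^ 2 * (T * π) := by gcongr
    have h5 : (2 + h 0) * ∑ q ∈ O \ E, ∑ t, |δ q.1 q.2 t| ≤
        (2 + h 0) * ((K + T) * π * N ^ 2) := by gcongr
    calc _ ≤ B * ε * (N ^ 2 * (T * π) + (2 + h 0) * ((K + T) * π * N ^ 2)) := by
          gcongr
      _ = _ := by ring
  have htot : h 0 * (∑ q ∈ O, ∑ t, v q.1 q.2 t * (ω q.1 q.2 t - 1)) -
      h 0 * (∑ q ∈ O, ∑ t, v q.1 q.2 t * δ q.1 q.2 t) +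
      (∑ q ∈ O \ E, ∑ t, v q.1 q.2 t * ρ q.1 q.2 t + ∑ q ∈ E, ∑ t, v q.1 q.2 t * ρ q.1 q.2 t) =
      0 := by
    rw [Finset.sum_sdiff hE.offDiag]
    refine Eq.trans ?_ hfoc
    simp only [Finset.mul_sum]
    rw [← Finset.sum_sub_distrib, ← Finset.sum_add_distrib]
    refine Finset.sum_congr rfl fun q _ => ?_
    rw [← Finset.sum_sub_distrib, ← Finset.sum_add_distrib]
    refine Finset.sum_congr rfl fun t _ => ?_
    simp only [hρ]
    ring
  have e1 : |h 0 * (∑ q ∈ O, ∑ t, v q.1 q.2 t * (ω q.1 q.2 t - 1))| ≤ h 0 * (lam * N ^ 2) := by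
    rw [abs_mul, abs_of_pos h0]
    gcongr
  have e2 : |h 0 * (∑ q ∈ O, ∑ t, v q.1 q.2 t * δ q.1 q.2 t)| ≤
      h 0 * (T * B * ξ₀ * N ^ 2 + 2 * T * B * N) := by
    rw [abs_mul, abs_of_pos h0]
    gcongr
  have f1 := abs_le.1 e1
  have f2 := abs_le.1 e2
  have f3 := abs_le.1 hbase
  have f4 := abs_le.1 hEsum
  have g : (T * B * (1 + h 0) + B * (T + (2 + h 0) * (K + T))) * (ε * π) * N ^ 2 =
      π * N ^ 2 * (T * (B * (ε * (1 + h 0)))) + B * ε * (T + (2 + h 0) * (K + T)) * π * N ^ 2 := by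
    ring
  rw [g, abs_le]
  constructor <;> linarith

end ScoreBias

/-! ### Contaminated disturbances and the choice of constants. -/

/-- The disturbances: at the pairs of `S` and in period `t₀` they are `u` at the pairs of `E` and
slightly below one otherwise, with mean one if `E` has density `p` in `S`. -/
noncomputable def contaminated {ι : Type*} {T : ℕ} (S E : Set (ι × ι)) (t₀ : Fin T) (u p : ℝ)
    (i j : ι) (t : Fin T) : ℝ :=
  open Classical in
  if (i, j) ∈ S ∧ t = t₀ then (if (i, j) ∈ E then u else 1 - p * (u - 1) / (1 - p)) else 1

/-- With small effects, the fitted log-means vary little over the periods. -/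
theorem abs_fittedLog_sub_le {ι : Type*} {T : ℕ} {ξ : ι → ι → Fin T → ℝ} {P Q : ι → Fin T → ℝ}
    {R : ι → ι → ℝ}
    {a ξ₀ : ℝ} (hξ : ∀ i j t, |ξ i j t| ≤ ξ₀) (hPa : ∀ i t, |P i t| ≤ a)
    (hQa : ∀ i t, |Q i t| ≤ a) (i j : ι) (t s : Fin T) :
    |fittedLog ξ P Q R i j t - fittedLog ξ P Q R i j s| ≤ 4 * a + 2 * ξ₀ := by
  have h1 := abs_le.1 (hξ i j t)
  have h2 := abs_le.1 (hξ i j s)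
  have h3 := abs_le.1 (hPa i t)
  have h4 := abs_le.1 (hPa i s)
  have h5 := abs_le.1 (hQa j t)
  have h6 := abs_le.1 (hQa j s)
  rw [abs_le]
  simp only [fittedLog]
  constructor <;> linarith

/-- Effects that are small up to a common shift can be normalized to have mean zero over the
exporters. -/
theorem exists_centered_effects {ι : Type*} [Fintype ι] {T : ℕ} {P Q : ι → Fin T → ℝ}
    {a : Fin T → ℝ} {t₀ : Fin T} {κ : ℝ}
    (hN : 0 < Fintype.card ι)
    (hP0 : ∀ i, P i t₀ = 0) (hQ0 : ∀ j, Q j t₀ = 0) (ha : a t₀ = 0)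
    (hP : ∀ i, ‖P i - a‖ ≤ κ) (hQ : ∀ j, ‖Q j + a‖ ≤ κ) :
    ∃ P' Q' : ι → Fin T → ℝ, (∀ i j t, P' i t + Q' j t = P i t + Q j t) ∧ (∀ i, P' i t₀ = 0) ∧
      (∀ j, Q' j t₀ = 0) ∧ (∀ t, ∑ i, P' i t = 0) ∧ (∀ i t, |P' i t| ≤ 2 * κ) ∧
      ∀ j t, |Q' j t| ≤ 2 * κ := by
  set N : ℝ := (Fintype.card ι : ℝ) with hNdef
  have hN0 : 0 < N := by
    rw [hNdef]
    exact_mod_cast hN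
  set m : Fin T → ℝ := fun t => (∑ i, (P i t - a t)) / N with hm
  have hPa : ∀ i t, |P i t - a t| ≤ κ := fun i t => (norm_le_pi_norm (P i - a) t).trans (hP i)
  have hQa : ∀ i t, |Q i t + a t| ≤ κ := fun i t => (norm_le_pi_norm (Q i + a) t).trans (hQ i)
  have hmb : ∀ t, |m t| ≤ κ := by
    intro t
    rw [hm]
    dsimp only
    rw [abs_div, abs_of_pos hN0, div_le_iff₀ hN0]
    refine (Finset.abs_sum_le_sum_abs _ _).trans ?_
    refine (Finset.sum_le_sum fun i _ => hPa i t).trans ?_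
    rw [Finset.sum_const, nsmul_eq_mul, Finset.card_univ, mul_comm]
  refine ⟨fun i t => P i t - a t - m t, fun j t => Q j t + a t + m t, fun i j t => by ring, ?_, ?_,
    ?_, ?_, ?_⟩
  · intro i
    simp [hm, hP0, ha]
  · intro j
    simp [hm, hP0, hQ0, ha]
  · intro t
    rw [Finset.sum_sub_distrib, Finset.sum_const, nsmul_eq_mul, Finset.card_univ, ← hNdef, hm]
    field_simp
    ring
  · intro i t
    have := abs_sub (P i t - a t) (m t)
    linarith [hPa i t, hmb t]
  · intro i t
    have := abs_add_le (Q i t + a t) (m t)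
    linarith [hQa i t, hmb t]

section Contradiction

variable {ι : Type} [Fintype ι] [DecidableEq ι] {T : ℕ}

/-- The lowered value away from the shocks is exactly what makes the disturbances mean one, so the
sum is a multiple of the centered sum over `E`. Unweighted residuals therefore carry no bias, only
sampling noise. -/
theorem sum_residual_contaminated {S E : Finset (ι × ι)} {t₀ : Fin T} {u p : ℝ} (hp : p < 1)
    (hES : E ⊆ S) (hS : S ⊆ Finset.univ.offDiag) (v : ι → ι → Fin T → ℝ) :
    ∑ q ∈ Finset.univ.offDiag, ∑ t, v q.1 q.2 t * (contaminated (↑S) (↑E) t₀ u p q.1 q.2 t - 1) =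
      (u - 1 + p * (u - 1) / (1 - p)) *
        (∑ q ∈ E, v q.1 q.2 t₀ - p * ∑ q ∈ S, v q.1 q.2 t₀) := by
  classical
  have h1 : ∀ q : ι × ι, ∑ t, v q.1 q.2 t * (contaminated (↑S) (↑E) t₀ u p q.1 q.2 t - 1) =
      (if q ∈ E then (u - 1 + p * (u - 1) / (1 - p)) * v q.1 q.2 t₀ else 0) -
        if q ∈ S then p * (u - 1) / (1 - p) * v q.1 q.2 t₀ else 0 := by
    intro q
    have h2 : ∀ t, v q.1 q.2 t * (contaminated (↑S) (↑E) t₀ u p q.1 q.2 t - 1) =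
        if t = t₀ then v q.1 q.2 t₀ * (contaminated (↑S) (↑E) t₀ u p q.1 q.2 t₀ - 1) else 0 := by
      intro t
      split_ifs with ht
      · rw [ht]
      · simp [contaminated, ht]
    rw [Finset.sum_congr rfl fun t _ => h2 t, Finset.sum_ite_eq' , if_pos (Finset.mem_univ _)]
    by_cases hqS : q ∈ S
    · by_cases hqE : q ∈ E
      · simp [contaminated, hqS, hqE]
        ring
      · simp [contaminated, hqS, hqE]
        ring
    · have hqE : q ∉ E := fun h => hqS (hES h)
      simp [contaminated, hqS, hqE]
  simp only [h1, Finset.sum_sub_distrib, ← Finset.sum_filter]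
  rw [Finset.filter_mem_eq_inter, Finset.filter_mem_eq_inter, Finset.inter_eq_right.2 hS,
    Finset.inter_eq_right.2 (hES.trans hS), ← Finset.mul_sum, ← Finset.mul_sum]
  have h3 : 1 - p ≠ 0 := by linarith
  field_simp
  ring

set_option maxHeartbeats 2000000 in
/-- Sparse contamination that is correlated with a residual direction `v` is incompatible with the
first-order conditions in the direction `v` unless the weight is the same at the mean outcome of a
contaminated pair and at the true mean. -/
theorem exists_contamination_contradiction {h : ℝ → ℝ} (hc : Continuous h) (hpos : ∀ τ, 0 < h τ)
    (T : ℕ) {u : ℝ} (hu : 1 < u) (hz : h (Real.log ((u + T - 1) / T)) ≠ h 0) {B c₀ : ℝ}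
    (hB : 0 < B) (hc₀ : 0 < c₀) :
    ∃ p ξ₀ lam N₀ : ℝ, 0 < p ∧ p ≤ 1 / 2 ∧ p * (u - 1) / (1 - p) ≤ 1 / 2 ∧ 0 < ξ₀ ∧ 0 < lam ∧
      ∀ {ι : Type} [Fintype ι] [DecidableEq ι] {S E : Finset (ι × ι)} {t₀ : Fin T}
        {ξ v : ι → ι → Fin T → ℝ} {P Q : ι → Fin T → ℝ} {R : ι → ι → ℝ},
        N₀ ≤ Fintype.card ι → E ⊆ S → S ⊆ Finset.univ.offDiag → SparsePairs E (2 * p) →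
        (∀ i j t, |ξ i j t| ≤ ξ₀) →
        MinimizesDeviance h (contaminated (↑S) (↑E) t₀ u p) ξ P Q R →
        FixedEffectFOC (fun i j t =>
          score h (contaminated (↑S) (↑E) t₀ u p i j t) (fittedLog ξ P Q R i j t)) →
        ResidualDirection v B →
        ∑ q ∈ Finset.univ.offDiag, ∑ t, v q.1 q.2 t *
          score h (contaminated (↑S) (↑E) t₀ u p q.1 q.2 t) (fittedLog ξ P Q R q.1 q.2 t) = 0 →
        c₀ * (Fintype.card ι : ℝ) ^ 2 ≤ ∑ q ∈ S, v q.1 q.2 t₀ →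
        |∑ q ∈ E, v q.1 q.2 t₀ - p * ∑ q ∈ S, v q.1 q.2 t₀| ≤
          lam * (Fintype.card ι : ℝ) ^ 2 → False := by
  have h0 := hpos 0
  have hu0 : 0 < u := by linarith
  have hlu : 0 ≤ Real.log u := Real.log_nonneg hu.le
  set z := (u + T - 1) / T with hzdef
  set Δ := (u - 1) * |h (Real.log z) - h 0| with hΔ
  have hΔ0 : 0 < Δ := mul_pos (by linarith) (abs_pos.2 (sub_ne_zero.2 hz))
  obtain ⟨M, hM, HM⟩ := exists_score_bound hc u
  set C₅ := 16 / h 0 * (8 * h 0 * T + M * T + h 0 / 16 + 128 * T ^ 2 * M ^ 2 / h 0) with hC₅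
  have hC₅0 : 0 < C₅ := by positivity
  set K := 2 * C₅ with hK
  set C₆ := T * B * (1 + h 0) + B * (T + (2 + h 0) * (K + T)) with hC₆
  have hC₆0 : 0 < C₆ := by positivity
  -- The linearization error `ε` must be fixed before `p`: the error is of order `ε * p` and the
  -- signal of order `Δ * c₀ * p`, so `p` cancels in the comparison.
  set ε := Δ * c₀ / (8 * (2 * u + 2) * C₆) with hε
  have hε0 : 0 < ε := by positivity
  have hεC : C₆ * (ε * (2 * u + 2)) = Δ * c₀ / 8 := by
    rw [hε]
    field_simp
  obtain ⟨r₁, hr₁, hr₁1, H₁⟩ := exists_score_linear hc hpos hε0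
  obtain ⟨r₂, hr₂, H₂⟩ := exists_event_close hc hpos T hu.le hε0
  set κ := min (r₁ / 68) (r₂ / 34) with hκ
  have hκ0 : 0 < κ := by positivity
  have hκr₁ : κ ≤ r₁ / 68 := min_le_left _ _
  have hκr₂ : κ ≤ r₂ / 34 := min_le_right _ _
  obtain ⟨π₀, ξ₁, N₁, hπ₀, hξ₁, HB⟩ := exists_effects_bound hc hpos T hu0 hκ0 (by linarith)
  set p := min (min (π₀ / (2 * u + 2)) ((1 - Real.exp (-33 * κ)) / (2 * u + 2)))
    (1 / (8 * (2 * u + 2))) with hp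
  have hexp : 0 < 1 - Real.exp (-33 * κ) := by
    have : Real.exp (-33 * κ) < 1 := Real.exp_lt_one_iff.2 (by linarith)
    linarith
  have hp0 : 0 < p := by positivity
  -- One parameter proportional to `p` dominates both the density `2 * p` of the shocks and the dip
  -- `p'` below one.
  set π := (2 * u + 2) * p with hπ
  have hπ0 : 0 < π := by positivity
  have hππ₀ : π ≤ π₀ := by
    have : p ≤ π₀ / (2 * u + 2) := (min_le_left _ _).trans (min_le_left _ _)
    rw [le_div_iff₀ (by positivity)] at this
    linarith
  have hπexp : π ≤ 1 - Real.exp (-33 * κ) := by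
    have : p ≤ (1 - Real.exp (-33 * κ)) / (2 * u + 2) := (min_le_left _ _).trans (min_le_right _ _)
    rw [le_div_iff₀ (by positivity)] at this
    linarith
  have hπ8 : π ≤ 1 / 8 := by
    have : p ≤ 1 / (8 * (2 * u + 2)) := min_le_right _ _
    rw [le_div_iff₀ (by positivity)] at this
    linarith
  have h4p : 4 * p ≤ π := mul_le_mul_of_nonneg_right (by linarith only [hu]) hp0.le
  have hp32 : p ≤ 1 / 32 := by linarith only [h4p, hπ8]
  set p' := p * (u - 1) / (1 - p) with hp'
  have hp'0 : 0 ≤ p' := by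
    apply div_nonneg (mul_nonneg hp0.le (by linarith)) (by linarith)
  have hp'π : p' ≤ π := by
    rw [hp', div_le_iff₀ (by linarith)]
    have h1 : π * (1 / 2) ≤ π * (1 - p) := mul_le_mul_of_nonneg_left (by linarith) hπ0.le
    linarith only [h1, hπ, hp0]
  -- The signal will be `8 * a * N ^ 2` and each of five error terms at most `a * N ^ 2`.
  set a := Δ * c₀ * p / 8 with ha
  have ha0 : 0 < a := by positivity
  set ξ₀ := min (min ξ₁ (κ / 2)) (min (min 1 (π ^ 2)) (a / (h 0 * T * B + 1))) with hξ₀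
  have hξ₀0 : 0 < ξ₀ := by positivity
  have x1 : ξ₀ ≤ ξ₁ := (min_le_left _ _).trans (min_le_left _ _)
  have x2 : ξ₀ ≤ κ / 2 := (min_le_left _ _).trans (min_le_right _ _)
  have x3 : ξ₀ ≤ 1 := (min_le_right _ _).trans ((min_le_left _ _).trans (min_le_left _ _))
  have x4 : ξ₀ ≤ π ^ 2 := (min_le_right _ _).trans ((min_le_left _ _).trans (min_le_right _ _))
  have x5 : h 0 * T * B * ξ₀ ≤ a := by
    have : ξ₀ ≤ a / (h 0 * T * B + 1) := (min_le_right _ _).trans (min_le_right _ _)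
    rw [le_div_iff₀ (by positivity)] at this
    linarith
  set lam := min (a / (h 0 * u)) (a / Δ) with hlam
  have hlam0 : 0 < lam := by positivity
  have l1 : h 0 * (u * lam) ≤ a := by
    have : lam ≤ a / (h 0 * u) := min_le_left _ _
    rw [le_div_iff₀ (by positivity)] at this
    linarith
  have l2 : Δ * lam ≤ a := by
    have : lam ≤ a / Δ := min_le_right _ _
    rw [le_div_iff₀ (by positivity)] at this
    linarith
  refine ⟨p, ξ₀, lam, max (max N₁ 8) (2 * h 0 * T * B / a), hp0, by linarith, by linarith, hξ₀0,
    hlam0, ?_⟩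
  intro ι _ _ S E t₀ ξ v P Q R hN hES hS hE hξ hmin hfoc hv hvfoc hSv hEv
  set N : ℝ := (Fintype.card ι : ℝ) with hNdef
  have n1 : N₁ ≤ N := (le_max_left _ _).trans ((le_max_left _ _).trans hN)
  have n2 : 8 ≤ N := (le_max_right _ _).trans ((le_max_left _ _).trans hN)
  have n3 : 2 * h 0 * T * B ≤ a * N := by
    have := (le_max_right _ _).trans hN
    rw [div_le_iff₀ ha0] at this
    linarith
  have hN0 : 0 < N := by linarith
  set ω : ι → ι → Fin T → ℝ := contaminated (↑S) (↑E) t₀ u p with hω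
  have hωevent : ∀ i j, (i, j) ∈ E → ∀ t, ω i j t = if t = t₀ then u else 1 := by
    intro i j hij t
    have hijS := hES hij
    simp [hω, contaminated, hij, hijS]
  have hωbase : ∀ i j, i ≠ j → (i, j) ∉ E → ∀ t, 1 - π ≤ ω i j t ∧ ω i j t ≤ 1 := by
    intro i j _ hij t
    simp only [hω, contaminated, Finset.mem_coe, hij, if_false, ← hp']
    split_ifs <;> constructor <;> linarith
  have hEπ : SparsePairs E π := by
    have h2p : 2 * p * N ≤ π * N := by
      have : 2 * p ≤ π := by linarith only [h4p, hp0]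
      gcongr
    exact ⟨hE.offDiag, fun i => (hE.row i).trans h2p, fun i => (hE.col i).trans h2p⟩
  have hcont : ContaminatedOutcome E t₀ u π ω := ⟨hωbase, hωevent⟩
  -- The period-`t₀` values of the country-time effects are moved into the pair effects, without
  -- changing the fit.
  set P₁ : ι → Fin T → ℝ := fun i t => P i t - P i t₀ with hP₁
  set Q₁ : ι → Fin T → ℝ := fun i t => Q i t - Q i t₀ with hQ₁
  set R₁ : ι → ι → ℝ := fun i j => R i j + P i t₀ + Q j t₀ with hR₁
  have hfit₁ : fittedLog ξ P₁ Q₁ R₁ = fittedLog ξ P Q R := by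
    ext i j t
    simp only [fittedLog, hP₁, hQ₁, hR₁]
    ring
  have hP₁0 : ∀ i, P₁ i t₀ = 0 := fun i => sub_self _
  have hQ₁0 : ∀ i, Q₁ i t₀ = 0 := fun i => sub_self _
  obtain ⟨b, hb0, hbP, hbQ⟩ := HB (R := R₁) hπ0.le hππ₀ n1 hEπ hcont
    (fun i j t => (hξ i j t).trans x1) hP₁0 hQ₁0 (by
      unfold MinimizesDeviance
      rw [hfit₁]
      exact hmin)
  obtain ⟨P₂, Q₂, hPQ₂, hP₂0, hQ₂0, hP₂sum, hP₂b, hQ₂b⟩ := exists_centered_effects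
    (by rw [hNdef] at hN0; exact_mod_cast hN0) hP₁0 hQ₁0 hb0 hbP hbQ
  have hfit₂ : fittedLog ξ P Q R = fittedLog ξ P₂ Q₂ R₁ := by
    rw [← hfit₁]
    ext i j t
    simp only [fittedLog]
    linarith [hPQ₂ i j t]
  rw [hfit₂] at hfoc hvfoc
  set δ := fittedLog ξ P₂ Q₂ R₁ with hδ
  -- The centered effects are at most `8 * κ`, so the variation over time is at most `32 * κ + 2 *
  -- ξ₀`. This is the source of the factors 33, 34 and 68.
  have hdiff : ∀ i j t s, |δ i j t - δ i j s| ≤ 33 * κ := by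
    intro i j t s
    have := abs_fittedLog_sub_le (R := R₁) hξ hP₂b hQ₂b i j t s
    linarith
  have hne : ∀ i j, (i, j) ∈ E → i ≠ j := by
    intro i j hij
    simpa using hE.offDiag hij
  have hbase : ∀ i j, i ≠ j → (i, j) ∉ E → ∀ t, -r₁ ≤ δ i j t ∧ δ i j t ≤ r₁ := by
    intro i j hij hijE t
    have := mem_Icc_of_sum_score_eq_zero hpos (a := -33 * κ) (b := 0) (hfoc.pair i j hij)
      (hdiff i j) (fun t => by linarith [(hωbase i j hij hijE t).1])
      (fun t => by rw [Real.exp_zero]; exact (hωbase i j hij hijE t).2) t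
    constructor <;> linarith
  have hevent : ∀ i j, (i, j) ∈ E → ∀ t, -r₁ ≤ δ i j t ∧ δ i j t ≤ Real.log u + r₁ := by
    intro i j hijE t
    have hω1 : ∀ t, 1 ≤ ω i j t ∧ ω i j t ≤ u := by
      intro t
      rw [hωevent i j hijE t]
      split_ifs
      · exact ⟨hu.le, le_rfl⟩
      · exact ⟨le_rfl, hu.le⟩
    have := mem_Icc_of_sum_score_eq_zero hpos (a := 0) (b := Real.log u)
      (hfoc.pair i j (hne i j hijE)) (hdiff i j)
      (fun t => by rw [Real.exp_zero]; exact (hω1 t).1)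
      (fun t => by rw [Real.exp_log hu0]; exact (hω1 t).2) t
    constructor <;> linarith
  have hsM : ∀ i j, i ≠ j → ∀ t, |score h (ω i j t) (δ i j t)| ≤ M := by
    intro i j hij t
    by_cases hijE : (i, j) ∈ E
    · have h1 := hevent i j hijE t
      apply HM
      · rw [hωevent i j hijE t]
        split_ifs <;> linarith
      · rw [hωevent i j hijE t]
        split_ifs <;> linarith
      · linarith
      · linarith
    · have h1 := hbase i j hij hijE t
      have h2 := hωbase i j hij hijE t
      apply HM <;> linarith
  have hlinear : ∀ i j, i ≠ j → (i, j) ∉ E → ∀ t,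
      |score h (ω i j t) (δ i j t) - h 0 * (ω i j t - 1 - δ i j t)| ≤
        ε * (π + (2 + h 0) * |δ i j t|) ∧ h 0 / 2 ≤ h (δ i j t) ∧ h (δ i j t) ≤ 2 * h 0 := by
    intro i j hij hijE t
    exact H₁ π _ _ (hωbase i j hij hijE t).1 (hωbase i j hij hijE t).2
      (abs_le.2 (hbase i j hij hijE t))
  have hsq := sum_sq_fittedLog_le (t₀ := t₀) h0 hM hξ₀0.le x3 hEπ
    (by
      have h1 : π * N ≤ 1 / 8 * N := mul_le_mul_of_nonneg_right hπ8 hN0.le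
      linarith only [h1, n2, hNdef]) hωbase hξ hP₂0 hQ₂0 hP₂sum hfoc hsM
    (fun i j hij hijE t => ⟨(abs_le.2 (hbase i j hij hijE t)).trans hr₁1,
      (hlinear i j hij hijE t).2⟩)
  rw [← hC₅, ← hNdef] at hsq
  have hsq' : ∑ q ∈ Finset.univ.offDiag \ E, ∑ t, δ q.1 q.2 t ^ 2 ≤ K * π ^ 2 * N ^ 2 := by
    refine hsq.trans (mul_le_mul_of_nonneg_right ?_ (sq_nonneg N))
    have h1 := mul_le_mul_of_nonneg_left x4 hC₅0.le
    rw [hK]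
    linarith only [h1]
  have hωv : |∑ q ∈ Finset.univ.offDiag, ∑ t, v q.1 q.2 t * (ω q.1 q.2 t - 1)| ≤
      u * lam * N ^ 2 := by
    rw [hω, sum_residual_contaminated (by linarith) hES hS, abs_mul, ← hp',
      abs_of_nonneg (by linarith), mul_assoc]
    exact mul_le_mul (by linarith) hEv (abs_nonneg _) hu0.le
  have hbias := score_bias_le (t₀ := t₀) (u := u) (z := z) (h₁ := h (Real.log z)) h0 hv hB hε0 hπ0
    hEπ hξ hξ₀0.le
    (fun i t => (hP₂b i t).trans (by linarith)) (fun i t => (hQ₂b i t).trans (by linarith))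
    (fun i j hij hijE t => (hlinear i j hij hijE t).1)
    (fun i j hijE t => H₂ t₀ (δ i j) (ω i j) (hωevent i j hijE)
      (fun t s => (hdiff i j t s).trans (by linarith)) (hfoc.pair i j (hne i j hijE)) t)
    hωevent hωv hsq' hvfoc
  rw [← hC₆, ← hNdef, abs_mul, abs_mul, abs_of_pos (show 0 < u - 1 by linarith), ← hΔ] at hbias
  have hlow : (p * c₀ - lam) * N ^ 2 ≤ |∑ q ∈ E, v q.1 q.2 t₀| := by
    have h1 := (abs_le.1 hEv).1
    have h2 := mul_le_mul_of_nonneg_left hSv hp0.le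
    linarith [le_abs_self (∑ q ∈ E, v q.1 q.2 t₀)]
  have hlow' := mul_le_mul_of_nonneg_left hlow hΔ0.le
  have hNN : 0 < N ^ 2 := by positivity
  have y1 : h 0 * (u * lam) * N ^ 2 ≤ a * N ^ 2 := by gcongr
  have y2 : h 0 * T * B * ξ₀ * N ^ 2 ≤ a * N ^ 2 := by gcongr
  have y3 : 2 * h 0 * T * B * N ≤ a * N * N := by gcongr
  have y4 : C₆ * (ε * π) * N ^ 2 = a * N ^ 2 := by
    have : C₆ * (ε * π) = C₆ * (ε * (2 * u + 2)) * p := by rw [hπ]; ring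
    rw [this, hεC, ha]
    ring
  have y5 : Δ * lam * N ^ 2 ≤ a * N ^ 2 := by gcongr
  have y6 : Δ * (p * c₀) * N ^ 2 = 8 * (a * N ^ 2) := by
    rw [ha]
    ring
  have y7 : 0 < a * N ^ 2 := by positivity
  linarith

end Contradiction

/-! ### Residualized regressors and a set of pairs correlated with them. -/

section Residual

theorem abs_sum_div_card_le {κ : Type*} [Fintype κ] [Nonempty κ] {f : κ → ℝ} {a : ℝ}
    (hf : ∀ k, |f k| ≤ a) : |(∑ k, f k) / Fintype.card κ| ≤ a := by
  have hn : (0 : ℝ) < Fintype.card κ := by exact_mod_cast Fintype.card_pos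
  rw [abs_div, abs_of_pos hn, div_le_iff₀ hn]
  refine (Finset.abs_sum_le_sum_abs _ _).trans ((Finset.sum_le_sum fun k _ => hf k).trans ?_)
  rw [Finset.sum_const, nsmul_eq_mul, Finset.card_univ, mul_comm]

/-- Demeaning over time, exporters and importers. -/
theorem exists_residualDirection {ι : Type*} [Fintype ι] [Nonempty ι] {T : ℕ} (hT : 0 < T)
    (X : ι → ι → Fin T → ℝ) {b : ℝ} (hX : ∀ i j t, |X i j t| ≤ b) :
    ∃ (v : ι → ι → Fin T → ℝ) (P Q : ι → Fin T → ℝ) (R : ι → ι → ℝ),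
      (∀ i j t, v i j t = X i j t - P i t - Q j t - R i j) ∧ ResidualDirection v (8 * b) := by
  have : Nonempty (Fin T) := ⟨⟨0, hT⟩⟩
  have hT' : (0 : ℝ) < T := by exact_mod_cast hT
  have hN' : (0 : ℝ) < Fintype.card ι := by exact_mod_cast Fintype.card_pos
  -- Demeaning over the full square, diagonal included, is done one index at a time. Each step keeps
  -- the zero sums already achieved and at most doubles the bound, whence the factor 8.
  set R : ι → ι → ℝ := fun i j => (∑ t, X i j t) / T with hR
  set X₁ : ι → ι → Fin T → ℝ := fun i j t => X i j t - R i j with hX₁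
  set Q : ι → Fin T → ℝ := fun j t => (∑ i, X₁ i j t) / Fintype.card ι with hQ
  set X₂ : ι → ι → Fin T → ℝ := fun i j t => X₁ i j t - Q j t with hX₂
  set P : ι → Fin T → ℝ := fun i t => (∑ j, X₂ i j t) / Fintype.card ι with hP
  have hb₁ : ∀ i j t, |X₁ i j t| ≤ 2 * b := by
    intro i j t
    have h1 : |R i j| ≤ b := by
      simpa using abs_sum_div_card_le (hX i j)
    have h2 := abs_sub (X i j t) (R i j)
    linarith [hX i j t]
  have hb₂ : ∀ i j t, |X₂ i j t| ≤ 4 * b := by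
    intro i j t
    have h1 : |Q j t| ≤ 2 * b := abs_sum_div_card_le fun i => hb₁ i j t
    have h2 := abs_sub (X₁ i j t) (Q j t)
    linarith [hb₁ i j t]
  have hs₁ : ∀ i j, ∑ t, X₁ i j t = 0 := by
    intro i j
    simp only [hX₁, hR, Finset.sum_sub_distrib, Finset.sum_const, Finset.card_univ,
      Fintype.card_fin, nsmul_eq_mul]
    field_simp
    ring
  have hs₂ : ∀ i j, ∑ t, X₂ i j t = 0 := by
    intro i j
    simp only [hX₂, hQ, Finset.sum_sub_distrib, hs₁, ← Finset.sum_div]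
    rw [Finset.sum_comm]
    simp [hs₁]
  have hc₂ : ∀ j t, ∑ i, X₂ i j t = 0 := by
    intro j t
    simp only [hX₂, hQ, Finset.sum_sub_distrib, Finset.sum_const, Finset.card_univ, nsmul_eq_mul]
    field_simp
    ring
  refine ⟨fun i j t => X₂ i j t - P i t, P, Q, R, fun i j t => by simp only [hX₂, hX₁]; ring,
    ⟨?_, ?_, ?_, ?_⟩⟩
  · intro i j t
    have h1 : |P i t| ≤ 4 * b := abs_sum_div_card_le fun j => hb₂ i j t
    have h2 := abs_sub (X₂ i j t) (P i t)
    linarith [hb₂ i j t]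
  · intro i t
    simp only [hP, Finset.sum_sub_distrib, Finset.sum_const, Finset.card_univ, nsmul_eq_mul]
    field_simp
    ring
  · intro j t
    simp only [hP, Finset.sum_sub_distrib, hc₂, ← Finset.sum_div]
    rw [Finset.sum_comm]
    simp [hc₂]
  · intro i j
    simp only [hP, Finset.sum_sub_distrib, hs₂, ← Finset.sum_div]
    rw [Finset.sum_comm]
    simp [hs₂]

/-- Boundedness turns the square sum into an absolute sum, and some period has at least a share `1 /
T` of it. In that period the entries sum to zero up to the diagonal, so the positive part accounts
for nearly half; the remaining loss is covered by `hN`. -/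
theorem ResidualDirection.exists_sum_posPart_ge {ι : Type*} [Fintype ι] [DecidableEq ι]
    [Nonempty ι] {T : ℕ} (hT : 0 < T) {v : ι → ι → Fin T → ℝ} {B c : ℝ}
    (hv : ResidualDirection v B) (hB : 0 < B)
    (hN : 2 * B ^ 2 * T ≤ c * Fintype.card ι)
    (hsq : c * (Fintype.card ι : ℝ) ^ 2 ≤ ∑ q ∈ Finset.univ.offDiag, ∑ t, v q.1 q.2 t ^ 2) :
    ∃ t, c / (4 * B * T) * (Fintype.card ι : ℝ) ^ 2 ≤
      ∑ q ∈ Finset.univ.offDiag, max (v q.1 q.2 t) 0 := by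
  have hT' : (0 : ℝ) < T := by exact_mod_cast hT
  have : Nonempty (Fin T) := ⟨⟨0, hT⟩⟩
  have hN' : (0 : ℝ) < Fintype.card ι := by exact_mod_cast Fintype.card_pos
  set N : ℝ := (Fintype.card ι : ℝ) with hNdef
  have h1 : c * N ^ 2 / B ≤ ∑ t, ∑ q ∈ Finset.univ.offDiag, |v q.1 q.2 t| := by
    rw [div_le_iff₀' hB, Finset.sum_comm, Finset.mul_sum]
    refine hsq.trans (Finset.sum_le_sum fun q _ => ?_)
    rw [Finset.mul_sum]
    refine Finset.sum_le_sum fun t _ => ?_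
    rw [← sq_abs, sq]
    exact mul_le_mul_of_nonneg_right (hv.bound _ _ _) (abs_nonneg _)
  obtain ⟨t, -, ht⟩ := Finset.exists_le_of_sum_le (s := (Finset.univ : Finset (Fin T)))
    (f := fun _ => c * N ^ 2 / B / T)
    (g := fun t => ∑ q ∈ (Finset.univ : Finset ι).offDiag, |v q.1 q.2 t|)
    Finset.univ_nonempty (by
      rw [Finset.sum_const, Finset.card_univ, Fintype.card_fin, nsmul_eq_mul]
      refine le_trans (le_of_eq ?_) h1
      field_simp)
  refine ⟨t, ?_⟩
  have h2 : ∑ q ∈ (Finset.univ : Finset ι).offDiag, max (v q.1 q.2 t) 0 =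
      (∑ q ∈ (Finset.univ : Finset ι).offDiag, |v q.1 q.2 t| +
        ∑ q ∈ (Finset.univ : Finset ι).offDiag, v q.1 q.2 t) / 2 := by
    rw [← Finset.sum_add_distrib, Finset.sum_div]
    refine Finset.sum_congr rfl fun q _ => ?_
    rcases le_total 0 (v q.1 q.2 t) with h | h
    · rw [max_eq_left h, abs_of_nonneg h]
      ring
    · rw [max_eq_right h, abs_of_nonpos h]
      ring
  have h3 : -(B * N) ≤ ∑ q ∈ (Finset.univ : Finset ι).offDiag, v q.1 q.2 t := by
    rw [sum_offDiag_eq_sub fun i j => v i j t]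
    have h4 : ∑ i, ∑ j, v i j t = 0 := Finset.sum_eq_zero fun i _ => hv.row i t
    have h5 : ∑ i, v i i t ≤ B * N := by
      refine (Finset.sum_le_sum fun i _ => (le_abs_self _).trans (hv.bound i i t)).trans ?_
      rw [Finset.sum_const, Finset.card_univ, nsmul_eq_mul, mul_comm]
    linarith
  have h6 : c / (4 * B * T) * N ^ 2 = c * N ^ 2 / B / T / 2 - c / (4 * B * T) * N ^ 2 := by
    field_simp
    ring
  have h7 : B * N / 2 ≤ c / (4 * B * T) * N ^ 2 := by
    rw [div_mul_eq_mul_div, div_le_div_iff₀ (by norm_num) (by positivity)]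
    nlinarith
  rw [h2, h6]
  linarith

/-- Gliding hump: one fixed set `S` picks up, for infinitely many `N`, most of the positive part of
the array `w N`. -/
theorem exists_set_frequently_sum_ge {α : Type*} [DecidableEq α] {O : ℕ → Finset α}
    (hO : Monotone O) (hcard : ∀ N, ((O N).card : ℝ) ≤ (N : ℝ) ^ 2) {w : ℕ → α → ℝ} {B c : ℝ}
    (hB : 0 < B) (hc : 0 < c) (hw : ∀ N q, |w N q| ≤ B)
    (hfreq : ∃ᶠ N : ℕ in atTop, c * (N : ℝ) ^ 2 ≤ ∑ q ∈ O N, max (w N q) 0) :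
    ∃ S : Set α, ∃ᶠ N : ℕ in atTop,
      c / 2 * (N : ℝ) ^ 2 ≤ ∑ q ∈ O N, S.indicator (w N) q := by
  classical
  rw [frequently_atTop] at hfreq
  choose (f : ℕ → ℕ) hf using hfreq
  -- The scales grow by a factor above `L`, so that the square of the preceding scale, where `S` may
  -- be wrong at a cost of `2 * B` per pair, uses up at most half of `c * N ^ 2`.
  obtain ⟨L, hL⟩ := exists_nat_ge (4 * B / c)
  obtain ⟨n, hn0, hn⟩ : ∃ n : ℕ → ℕ, n 0 = f 1 ∧ ∀ k, n (k + 1) = f ((L + 1) * n k + 1) :=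
    ⟨fun k => Nat.rec (motive := fun _ => ℕ) (f 1) (fun _ m => f ((L + 1) * m + 1)) k, rfl,
      fun _ => rfl⟩
  have hstep : ∀ k, (L + 1) * n k + 1 ≤ n (k + 1) := by
    intro k
    rw [hn]
    exact (hf _).1
  have hmono : StrictMono n := by
    refine strictMono_nat_of_lt_succ fun k => ?_
    have := hstep k
    nlinarith
  have hgood : ∀ k, c * (n k : ℝ) ^ 2 ≤ ∑ q ∈ O (n k), max (w (n k) q) 0 := by
    intro k
    cases k with
    | zero =>
      rw [hn0]
      exact (hf 1).2
    | succ k =>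
      rw [hn]
      exact (hf _).2
  -- Each pair is decided at the first scale whose square contains it, by the sign of the array of
  -- that scale.
  refine ⟨{q | ∃ k, q ∈ O (n k) ∧ (∀ m < k, q ∉ O (n m)) ∧ 0 < w (n k) q}, ?_⟩
  rw [frequently_atTop]
  intro M
  refine ⟨n (M + 1), (Nat.le_succ M).trans (hmono.le_apply (x := M + 1)), ?_⟩
  set S : Set α := {q | ∃ k, q ∈ O (n k) ∧ (∀ m < k, q ∉ O (n m)) ∧ 0 < w (n k) q} with hS
  set N := n (M + 1) with hN
  have hpt : ∀ q ∈ O N, max (w N q) 0 - (if q ∈ O (n M) then 2 * B else 0) ≤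
      S.indicator (w N) q := by
    intro q hq
    have hwq := abs_le.1 (hw N q)
    by_cases hqM : q ∈ O (n M)
    · rw [if_pos hqM]
      have h1 : max (w N q) 0 ≤ B := max_le hwq.2 hB.le
      have h2 : -B ≤ S.indicator (w N) q := by
        rw [Set.indicator_apply]
        split_ifs <;> linarith
      linarith
    · rw [if_neg hqM, sub_zero]
      have hold : ∀ m, m < M + 1 → q ∉ O (n m) := fun m hm h =>
        hqM (hO (hmono.monotone (Nat.lt_succ_iff.1 hm)) h)
      by_cases hpos : 0 < w N q
      · have : q ∈ S := ⟨M + 1, hq, hold, hpos⟩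
        rw [Set.indicator_of_mem this, max_eq_left hpos.le]
      · have : q ∉ S := by
          rintro ⟨k, h1, h2, h3⟩
          rcases lt_trichotomy k (M + 1) with h4 | h4 | h4
          · exact hold k h4 h1
          · rw [h4] at h3
            exact hpos h3
          · exact h2 (M + 1) h4 hq
        rw [Set.indicator_of_notMem this, max_eq_right (not_lt.1 hpos)]
  have hsum := Finset.sum_le_sum hpt
  rw [Finset.sum_sub_distrib, ← Finset.sum_filter, Finset.sum_const, nsmul_eq_mul] at hsum
  have h1 : (((O N).filter fun q => q ∈ O (n M)).card : ℝ) ≤ (n M : ℝ) ^ 2 := by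
    refine le_trans ?_ (hcard (n M))
    exact_mod_cast Finset.card_le_card fun q hq => (Finset.mem_filter.1 hq).2
  have h2 : ((L : ℝ) + 1) * n M + 1 ≤ N := by exact_mod_cast hstep M
  have h3 : 4 * B * (n M : ℝ) ^ 2 ≤ c * (N : ℝ) ^ 2 := by
    rw [div_le_iff₀ hc] at hL
    have h4 : (n M : ℝ) ^ 2 * (L : ℝ) ≤ (N : ℝ) ^ 2 := by
      have h5 : (0 : ℝ) ≤ n M := Nat.cast_nonneg _
      have h6 : (0 : ℝ) ≤ L := Nat.cast_nonneg _
      have h7 : (((L : ℝ) + 1) * n M) ^ 2 ≤ (N : ℝ) ^ 2 :=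
        pow_le_pow_left₀ (by positivity) (by linarith) 2
      refine le_trans ?_ h7
      rw [mul_pow, mul_comm]
      gcongr
      nlinarith
    calc 4 * B * (n M : ℝ) ^ 2 ≤ L * c * (n M : ℝ) ^ 2 := by gcongr
      _ = c * ((n M : ℝ) ^ 2 * L) := by ring
      _ ≤ _ := by gcongr
  have h4 := hgood (M + 1)
  rw [← hN] at h4
  nlinarith

theorem sum_offDiag_range_eq {N : ℕ} (f : ℕ → ℕ → ℝ) :
    ∑ q ∈ (Finset.range N).offDiag, f q.1 q.2 =
      ∑ q ∈ (Finset.univ : Finset (Fin N)).offDiag, f q.1 q.2 := by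
  symm
  refine Finset.sum_bij (fun q _ => ((q.1 : ℕ), (q.2 : ℕ))) ?_ ?_ ?_ ?_
  · intro q hq
    simp only [Finset.mem_offDiag, Finset.mem_univ, true_and, Finset.mem_range] at hq ⊢
    exact ⟨q.1.2, q.2.2, fun h => hq (Fin.ext h)⟩
  · intro q _ q' _ h
    simp only [Prod.mk.injEq] at h
    exact Prod.ext (Fin.ext h.1) (Fin.ext h.2)
  · intro q hq
    simp only [Finset.mem_offDiag, Finset.mem_range] at hq
    refine ⟨(⟨q.1, hq.1⟩, ⟨q.2, hq.2.1⟩), ?_, rfl⟩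
    simp only [Finset.mem_offDiag, Finset.mem_univ, true_and, ne_eq, Fin.mk.injEq]
    exact hq.2.2
  · intro q _
    rfl

open Classical in
/-- For regular regressors there are a set `S` of pairs and a period `t₀` which, for infinitely many
`N`, are correlated with a regressor after the fixed effects have been partialled out. -/
theorem RegularRegressors.exists_correlated_pairs {K T : ℕ} (hK : 0 < K) {x : Regressors K T ℕ}
    (hx : RegularRegressors x) :
    ∃ (B c₀ : ℝ) (t₀ : Fin T) (S : Set (ℕ × ℕ)), 0 < B ∧ 0 < c₀ ∧ (∀ i j t, ‖x i j t‖ ≤ B) ∧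
      ∃ᶠ N : ℕ in atTop, ∃ (b : EuclideanSpace ℝ (Fin K)) (v : Fin N → Fin N → Fin T → ℝ)
        (P Q : Fin N → Fin T → ℝ) (R : Fin N → Fin N → ℝ),
        (∀ i j t, v i j t = inner ℝ (sampleRegressors x N i j t) b - P i t - Q j t - R i j) ∧
        ResidualDirection v B ∧
        c₀ * (N : ℝ) ^ 2 ≤ ∑ q ∈ (Finset.univ : Finset (Fin N)).offDiag,
          (if ((q.1 : ℕ), (q.2 : ℕ)) ∈ S then v q.1 q.2 t₀ else 0) := by
  classical
  obtain ⟨B₀, hB₀⟩ := hx.bounded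
  obtain ⟨c, hc, hnc⟩ := hx.noncollinear
  set b : EuclideanSpace ℝ (Fin K) := EuclideanSpace.single ⟨0, hK⟩ 1 with hb
  have hbn : ‖b‖ = 1 := by simp [hb]
  set B₁ := |B₀| + 1 with hB₁
  have hB₁0 : 0 < B₁ := by positivity
  have hxB : ∀ i j t, ‖x i j t‖ ≤ B₁ := fun i j t => by
    linarith [hB₀ i j t, le_abs_self B₀]
  set B := 8 * B₁ with hB
  have hB0 : 0 < B := by positivity
  -- Without periods the sum in the noncollinearity bound would be empty.
  have hT : 0 < T := by
    obtain ⟨N, hN, hN1⟩ := (hnc.and (eventually_ge_atTop 1)).exists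
    by_contra hT
    have hT0 : T = 0 := by omega
    subst hT0
    have := hN b 0 0 0
    rw [hbn] at this
    simp only [Finset.univ_eq_empty, Finset.sum_empty, Finset.sum_const_zero] at this
    have h1 : (1 : ℝ) ≤ N := by exact_mod_cast hN1
    have : 0 < c * (N : ℝ) ^ 2 * 1 ^ 2 := by positivity
    linarith
  have hT' : (0 : ℝ) < T := by exact_mod_cast hT
  have hres : ∀ N : ℕ, ∃ (v : Fin N → Fin N → Fin T → ℝ) (P Q : Fin N → Fin T → ℝ)
      (R : Fin N → Fin N → ℝ),
      (∀ i j t, v i j t = inner ℝ (sampleRegressors x N i j t) b - P i t - Q j t - R i j) ∧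
      ResidualDirection v B := by
    intro N
    rcases Nat.eq_zero_or_pos N with rfl | hN
    · exact ⟨fun i => Fin.elim0 i, fun i => Fin.elim0 i, fun i => Fin.elim0 i, fun i => Fin.elim0 i,
        fun i => Fin.elim0 i, ⟨fun i => Fin.elim0 i, fun i => Fin.elim0 i, fun i => Fin.elim0 i,
          fun i => Fin.elim0 i⟩⟩
    · have : Nonempty (Fin N) := ⟨⟨0, hN⟩⟩
      refine exists_residualDirection hT (fun i j t => inner ℝ (sampleRegressors x N i j t) b)
        (fun i j t => ?_)
      have := abs_real_inner_le_norm (sampleRegressors x N i j t) b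
      rw [hbn, mul_one] at this
      exact this.trans (hxB _ _ _)
  choose v P Q R hv hvres using hres
  have hev : ∀ᶠ N : ℕ in atTop, ∃ t, c / (4 * B * T) * (N : ℝ) ^ 2 ≤
      ∑ q ∈ (Finset.univ : Finset (Fin N)).offDiag, max (v N q.1 q.2 t) 0 := by
    have hlarge : ∀ᶠ N : ℕ in atTop, 2 * B ^ 2 * T / c ≤ (N : ℝ) :=
      tendsto_natCast_atTop_atTop.eventually_ge_atTop _
    filter_upwards [hnc, hlarge, eventually_ge_atTop 1] with N h1 h2 h3
    have : Nonempty (Fin N) := ⟨⟨0, h3⟩⟩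
    have h4 := (hvres N).exists_sum_posPart_ge (c := c) hT hB0
      (by
        rw [Fintype.card_fin]
        rw [div_le_iff₀ hc] at h2
        linarith)
      (by
        have h5 := h1 b (P N) (Q N) (R N)
        rw [hbn, one_pow, mul_one] at h5
        rw [Fintype.card_fin, sum_offDiag_eq fun i j => ∑ t, v N i j t ^ 2]
        simpa only [← hv] using h5)
    rwa [Fintype.card_fin] at h4
  -- The good period may vary with `N`; as there are finitely many, one of them recurs infinitely
  -- often.
  obtain ⟨t₀, ht₀⟩ : ∃ t, ∃ᶠ N : ℕ in atTop, c / (4 * B * T) * (N : ℝ) ^ 2 ≤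
      ∑ q ∈ (Finset.univ : Finset (Fin N)).offDiag, max (v N q.1 q.2 t) 0 := by
    by_contra hcon
    have h1 : ∀ t, ∀ᶠ N : ℕ in atTop, ¬ c / (4 * B * T) * (N : ℝ) ^ 2 ≤
        ∑ q ∈ (Finset.univ : Finset (Fin N)).offDiag, max (v N q.1 q.2 t) 0 :=
      fun t => not_frequently.1 (not_exists.1 hcon t)
    obtain ⟨N, ⟨t, h2⟩, h3⟩ := (hev.and (eventually_all.2 h1)).exists
    exact h3 t h2
  set w : ℕ → ℕ × ℕ → ℝ := fun N q =>
    if h : q.1 < N ∧ q.2 < N then v N ⟨q.1, h.1⟩ ⟨q.2, h.2⟩ t₀ else 0 with hw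
  have hwv : ∀ N (i j : Fin N), w N (i, j) = v N i j t₀ := by
    intro N i j
    simp [hw]
  obtain ⟨S, hS⟩ := exists_set_frequently_sum_ge (O := fun N => (Finset.range N).offDiag) (w := w)
    (B := B) (c := c / (4 * B * T))
    (fun m n hmn => Finset.offDiag_mono (Finset.range_mono hmn))
    (fun N => by
      rw [Finset.offDiag_card, Finset.card_range]
      have : N * N - N ≤ N ^ 2 := by rw [sq]; exact Nat.sub_le _ _
      exact_mod_cast this)
    hB0 (by positivity)
    (fun N q => by
      simp only [hw]
      split_ifs
      · exact (hvres N).bound _ _ _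
      · simpa using hB0.le)
    (ht₀.mono fun N hN => by
      rw [sum_offDiag_range_eq fun i j => max (w N (i, j)) 0]
      simpa only [hwv] using hN)
  refine ⟨B, c / (4 * B * T) / 2, t₀, S, hB0, by positivity, fun i j t => (hxB i j t).trans ?_,
    hS.mono fun N hN => ⟨b, v N, P N, Q N, R N, hv N, hvres N, ?_⟩⟩
  · rw [hB]
    linarith
  · rw [sum_offDiag_range_eq fun i j => S.indicator (w N) (i, j)] at hN
    simpa only [Set.indicator_apply, hwv] using hN

end Residual

/-! ### Independent coins and their concentration. -/

section Coins

/-- Independent coins, each of which shows `true` with probability `p`. -/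
noncomputable def coinMeasure (κ : Type*) (p : unitInterval) : Measure (κ → Bool) :=
  Measure.infinitePi fun _ => bernoulliMeasure true false p

variable {κ : Type*} {p : unitInterval}

instance : IsProbabilityMeasure (coinMeasure κ p) := by
  unfold coinMeasure
  infer_instance

/-- The indicator of `true`. -/
noncomputable def coinValue (b : Bool) : ℝ := if b then 1 else 0

theorem integral_coin (f : Bool → ℝ) (k : κ) :
    ∫ w, f (w k) ∂(coinMeasure κ p) = p * f true + (1 - p) * f false := by
  have h1 := (measurePreserving_eval_infinitePi
    (fun _ : κ => bernoulliMeasure true false p) k).map_eq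
  have h2 := integral_map (μ := coinMeasure κ p) (φ := Function.eval k) (f := f)
    (measurable_pi_apply k).aemeasurable
    (measurable_from_top (f := f)).aestronglyMeasurable
  rw [coinMeasure] at h2 ⊢
  rw [h1, integral_bernoulliMeasure] at h2
  simpa using h2.symm

theorem iIndepFun_coin {β : Type*} {f : β → κ} (hf : Function.Injective f) (X : β → Bool → ℝ) :
    iIndepFun (fun (b : β) (w : κ → Bool) => X b (w (f b))) (coinMeasure κ p) := by
  have h1 : iIndepFun (fun (k : κ) (w : κ → Bool) => w k) (coinMeasure κ p) :=
    iIndepFun_infinitePi (X := fun (_ : κ) (b : Bool) => b) fun _ => measurable_id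
  exact (h1.precomp hf).comp X fun _ => measurable_from_top

/-- Hoeffding's inequality for weighted sums of coins. -/
theorem measure_coin_sum_ge_le {β : Type*} {f : β → κ} (hf : Function.Injective f) (s : Finset β)
    {a : β → ℝ} {A ε : ℝ} (ha : ∀ b, |a b| ≤ A) (hε : 0 ≤ ε) :
    (coinMeasure κ p).real {w | ε ≤ ∑ b ∈ s, a b * (coinValue (w (f b)) - p)} ≤
      Real.exp (-ε ^ 2 / (2 * (s.card * A ^ 2))) := by
  rcases isEmpty_or_nonempty β with hβ | hβ
  · have : s = ∅ := Finset.eq_empty_of_isEmpty s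
    subst this
    simp
  have hA : 0 ≤ A := (abs_nonneg _).trans (ha (Classical.arbitrary β))
  have hindep := iIndepFun_coin (p := p) hf fun b c => a b * (coinValue c - p)
  have hsub : ∀ b ∈ s, HasSubgaussianMGF (fun w : κ → Bool => a b * (coinValue (w (f b)) - p))
      ((‖A - (-A)‖₊ / 2) ^ 2) (coinMeasure κ p) := by
    intro b _
    refine hasSubgaussianMGF_of_mem_Icc_of_integral_eq_zero ?_ (ae_of_all _ fun w => ?_) ?_
    · have : Measurable fun c : Bool => a b * (coinValue c - p) := measurable_from_top
      exact (this.comp (measurable_pi_apply (f b))).aemeasurable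
    · have h1 : |a b * (coinValue (w (f b)) - p)| ≤ A := by
        rw [abs_mul]
        have h2 : |coinValue (w (f b)) - (p : ℝ)| ≤ 1 := by
          have h3 := p.2.1
          have h4 := p.2.2
          rw [coinValue, abs_le]
          split_ifs <;> constructor <;> linarith
        calc _ ≤ A * 1 := mul_le_mul (ha b) h2 (abs_nonneg _) hA
          _ = A := mul_one A
      exact abs_le.1 h1
    · rw [integral_coin fun c => a b * (coinValue c - p)]
      simp only [coinValue]
      norm_num
      ring
  have h := HasSubgaussianMGF.measure_sum_ge_le_of_iIndepFun hindep hsub hε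
  refine h.trans (le_of_eq ?_)
  congr 2
  simp only [Finset.sum_const, nsmul_eq_mul]
  push_cast
  have : ‖A - -A‖ / 2 = A := by
    rw [Real.norm_eq_abs, abs_of_nonneg (by linarith)]
    ring
  rw [this]

end Coins

/-! ### Regularity of the random set of shocks. -/

section Events

variable {T : ℕ}

open Classical in
/-- The pairs of the first `N` indices that lie in `S`. -/
noncomputable def samplePairs (S : Set (ℕ × ℕ)) (N : ℕ) : Finset (Fin N × Fin N) :=
  Finset.univ.offDiag.filter fun q => ((q.1 : ℕ), (q.2 : ℕ)) ∈ S

theorem mem_samplePairs {S : Set (ℕ × ℕ)} {N : ℕ} {q : Fin N × Fin N} :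
    q ∈ samplePairs S N ↔ q.1 ≠ q.2 ∧ ((q.1 : ℕ), (q.2 : ℕ)) ∈ S := by
  classical
  rw [samplePairs, Finset.mem_filter]
  simp

/-- The pairs of `S` whose coin in period `t₀` shows `true`. -/
def eventSet (S : Set (ℕ × ℕ)) (t₀ : Fin T) (w : ℕ × ℕ × Fin T → Bool) : Set (ℕ × ℕ) :=
  {q | q ∈ S ∧ w (q.1, q.2, t₀) = true}

theorem mem_eventSet {S : Set (ℕ × ℕ)} {t₀ : Fin T} {w : ℕ × ℕ × Fin T → Bool} {q : ℕ × ℕ} :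
    q ∈ eventSet S t₀ w ↔ q ∈ S ∧ w (q.1, q.2, t₀) = true := Iff.rfl

/-- The threshold for `N` must not depend on `v`, since the residual direction changes with `N`.
Hoeffding's bound uses `v` only through `B`. A union over `2 * N` rows and columns costs a factor
`N` against `exp (-p ^ 2 * N / 2)`, and two further tails control the sum weighted by `v`. -/
theorem eventually_events_regular (S : Set (ℕ × ℕ)) (t₀ : Fin T) {p : unitInterval}
    (hp : 0 < (p : ℝ)) {B lam δ : ℝ} (hB : 0 < B) (hlam : 0 < lam) (hδ : 0 < δ) :
    ∀ᶠ N : ℕ in atTop, ∀ v : Fin N → Fin N → Fin T → ℝ, (∀ i j t, |v i j t| ≤ B) →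
      (coinMeasure (ℕ × ℕ × Fin T) p).real
        {w | ¬ (SparsePairs (samplePairs (eventSet S t₀ w) N) (2 * p) ∧
          |∑ q ∈ samplePairs (eventSet S t₀ w) N, v q.1 q.2 t₀ -
            p * ∑ q ∈ samplePairs S N, v q.1 q.2 t₀| ≤ lam * (N : ℝ) ^ 2)} ≤ δ := by
  classical
  set a : ℝ := (p : ℝ) ^ 2 / 2 with ha
  set b : ℝ := lam ^ 2 / (2 * B ^ 2) with hb
  have ha0 : 0 < a := by positivity
  have hb0 : 0 < b := by positivity
  have hlim1 : Tendsto (fun N : ℕ => 2 * ((N : ℝ) * Real.exp (-a * N)) +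
      2 * Real.exp (-b * N)) atTop (𝓝 0) := by
    have h1 : Tendsto (fun x : ℝ => x ^ (1 : ℝ) * Real.exp (-a * x)) atTop (𝓝 0) :=
      tendsto_rpow_mul_exp_neg_mul_atTop_nhds_zero 1 a ha0
    have h2 : Tendsto (fun x : ℝ => x ^ (0 : ℝ) * Real.exp (-b * x)) atTop (𝓝 0) :=
      tendsto_rpow_mul_exp_neg_mul_atTop_nhds_zero 0 b hb0
    simp only [Real.rpow_one, Real.rpow_zero, one_mul] at h1 h2
    have h3 := ((h1.const_mul 2).add (h2.const_mul 2)).comp tendsto_natCast_atTop_atTop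
    simpa [Function.comp_def] using h3
  filter_upwards [hlim1.eventually_le_const hδ, eventually_ge_atTop 1] with N hN hN1 v hv
  refine le_trans ?_ hN
  have hNr : (1 : ℝ) ≤ N := by exact_mod_cast hN1
  have hN0 : (0 : ℝ) < N := by linarith
  set μ := coinMeasure (ℕ × ℕ × Fin T) p with hμ
  set rowBad : Fin N → Set (ℕ × ℕ × Fin T → Bool) := fun i =>
    {w | (p : ℝ) * N ≤ ∑ j : Fin N, 1 * (coinValue (w ((i : ℕ), (j : ℕ), t₀)) - p)} with hrow
  set colBad : Fin N → Set (ℕ × ℕ × Fin T → Bool) := fun j =>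
    {w | (p : ℝ) * N ≤ ∑ i : Fin N, 1 * (coinValue (w ((i : ℕ), (j : ℕ), t₀)) - p)} with hcol
  set z : Fin N × Fin N → ℝ := fun q => if q ∈ samplePairs S N then v q.1 q.2 t₀ else 0 with hz
  set upBad : Set (ℕ × ℕ × Fin T → Bool) :=
    {w | lam * (N : ℝ) ^ 2 ≤ ∑ q : Fin N × Fin N,
      z q * (coinValue (w ((q.1 : ℕ), (q.2 : ℕ), t₀)) - p)} with hup
  set downBad : Set (ℕ × ℕ × Fin T → Bool) :=
    {w | lam * (N : ℝ) ^ 2 ≤ ∑ q : Fin N × Fin N,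
      (-z q) * (coinValue (w ((q.1 : ℕ), (q.2 : ℕ), t₀)) - p)} with hdown
  have hrowle : ∀ i, μ.real (rowBad i) ≤ Real.exp (-a * N) := by
    intro i
    have h1 := measure_coin_sum_ge_le (p := p) (κ := ℕ × ℕ × Fin T)
      (f := fun j : Fin N => ((i : ℕ), (j : ℕ), t₀))
      (fun j j' h => by simpa [Fin.ext_iff] using h) Finset.univ (a := fun _ => 1) (A := 1)
      (ε := p * N) (fun _ => by simp) (by positivity)
    refine h1.trans (le_of_eq ?_)
    rw [Finset.card_univ, Fintype.card_fin, ha]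
    congr 1
    field_simp
  have hcolle : ∀ j, μ.real (colBad j) ≤ Real.exp (-a * N) := by
    intro j
    have h1 := measure_coin_sum_ge_le (p := p) (κ := ℕ × ℕ × Fin T)
      (f := fun i : Fin N => ((i : ℕ), (j : ℕ), t₀))
      (fun i i' h => by simpa [Fin.ext_iff] using h) Finset.univ (a := fun _ => 1) (A := 1)
      (ε := p * N) (fun _ => by simp) (by positivity)
    refine h1.trans (le_of_eq ?_)
    rw [Finset.card_univ, Fintype.card_fin, ha]
    congr 1
    field_simp
  have hzB : ∀ q, |z q| ≤ B := by
    intro q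
    simp only [hz]
    split_ifs
    · exact hv _ _ _
    · simpa using hB.le
  have hinj : Function.Injective fun q : Fin N × Fin N => ((q.1 : ℕ), (q.2 : ℕ), t₀) := by
    intro q q' h
    simp only [Prod.mk.injEq, and_true] at h
    exact Prod.ext (Fin.ext h.1) (Fin.ext h.2)
  have hexp : Real.exp (-(lam * (N : ℝ) ^ 2) ^ 2 /
      (2 * ((Finset.univ : Finset (Fin N × Fin N)).card * B ^ 2))) ≤ Real.exp (-b * N) := by
    rw [Real.exp_le_exp, Finset.card_univ, Fintype.card_prod, Fintype.card_fin, hb]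
    have h1 : -(lam * (N : ℝ) ^ 2) ^ 2 / (2 * (((N * N : ℕ) : ℝ) * B ^ 2)) =
        -(lam ^ 2 / (2 * B ^ 2)) * N ^ 2 := by
      push_cast
      field_simp
    rw [h1]
    have h2 : (N : ℝ) ≤ (N : ℝ) ^ 2 := by nlinarith
    have h3 := mul_le_mul_of_nonneg_left h2 (hb ▸ hb0.le)
    linarith
  have huple : μ.real upBad ≤ Real.exp (-b * N) :=
    (measure_coin_sum_ge_le (p := p) hinj Finset.univ hzB (by positivity)).trans hexp
  have hdownle : μ.real downBad ≤ Real.exp (-b * N) :=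
    (measure_coin_sum_ge_le (p := p) hinj Finset.univ (a := fun q => -z q)
      (fun q => by rw [abs_neg]; exact hzB q) (by positivity)).trans hexp
  have hsub : {w | ¬ (SparsePairs (samplePairs (eventSet S t₀ w) N) (2 * p) ∧
          |∑ q ∈ samplePairs (eventSet S t₀ w) N, v q.1 q.2 t₀ -
            p * ∑ q ∈ samplePairs S N, v q.1 q.2 t₀| ≤ lam * (N : ℝ) ^ 2)} ⊆
      ((⋃ i, rowBad i) ∪ ⋃ j, colBad j) ∪ (upBad ∪ downBad) := by
    intro w hw
    by_contra hcon
    simp only [Set.mem_union, Set.mem_iUnion, not_or, not_exists] at hcon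
    obtain ⟨⟨h1, h2⟩, h3, h4⟩ := hcon
    apply hw
    simp only [hrow, hcol, hup, hdown, Set.mem_ofPred_eq, not_le] at h1 h2 h3 h4
    refine ⟨⟨Finset.filter_subset _ _, fun i => ?_, fun j => ?_⟩, ?_⟩
    · have h5 := h1 i
      simp only [one_mul, Finset.sum_sub_distrib, Finset.sum_const, Finset.card_univ,
        Fintype.card_fin, nsmul_eq_mul] at h5
      -- All coins of the row are counted, including those outside `S` and on the diagonal; this
      -- only enlarges the count and keeps the index set free of `S`.
      have h6 : (((samplePairs (eventSet S t₀ w) N).filter fun q => q.1 = i).card : ℝ) ≤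
          ∑ j : Fin N, coinValue (w ((i : ℕ), (j : ℕ), t₀)) := by
        have h7 : ((samplePairs (eventSet S t₀ w) N).filter fun q => q.1 = i).card ≤
            (Finset.univ.filter fun j : Fin N => w ((i : ℕ), (j : ℕ), t₀) = true).card := by
          refine Finset.card_le_card_of_injOn Prod.snd ?_ ?_
          · intro q hq
            rw [Finset.mem_coe, Finset.mem_filter, mem_samplePairs, mem_eventSet] at hq
            rw [Finset.mem_coe, Finset.mem_filter, ← hq.2]
            exact ⟨Finset.mem_univ _, hq.1.2.2⟩
          · intro q hq q' hq' h
            have e1 := (Finset.mem_filter.1 hq).2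
            have e2 := (Finset.mem_filter.1 hq').2
            exact Prod.ext (e1.trans e2.symm) h
        have h8 : ∑ j : Fin N, coinValue (w ((i : ℕ), (j : ℕ), t₀)) =
            ((Finset.univ.filter fun j : Fin N => w ((i : ℕ), (j : ℕ), t₀) = true).card : ℝ) := by
          simp [coinValue]
        rw [h8]
        exact_mod_cast h7
      rw [Fintype.card_fin]
      linarith
    · have h5 := h2 j
      simp only [one_mul, Finset.sum_sub_distrib, Finset.sum_const, Finset.card_univ,
        Fintype.card_fin, nsmul_eq_mul] at h5
      have h6 : (((samplePairs (eventSet S t₀ w) N).filter fun q => q.2 = j).card : ℝ) ≤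
          ∑ i : Fin N, coinValue (w ((i : ℕ), (j : ℕ), t₀)) := by
        have h7 : ((samplePairs (eventSet S t₀ w) N).filter fun q => q.2 = j).card ≤
            (Finset.univ.filter fun i : Fin N => w ((i : ℕ), (j : ℕ), t₀) = true).card := by
          refine Finset.card_le_card_of_injOn Prod.fst ?_ ?_
          · intro q hq
            rw [Finset.mem_coe, Finset.mem_filter, mem_samplePairs, mem_eventSet] at hq
            rw [Finset.mem_coe, Finset.mem_filter, ← hq.2]
            exact ⟨Finset.mem_univ _, hq.1.2.2⟩
          · intro q hq q' hq' h
            have e1 := (Finset.mem_filter.1 hq).2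
            have e2 := (Finset.mem_filter.1 hq').2
            exact Prod.ext h (e1.trans e2.symm)
        have h8 : ∑ i : Fin N, coinValue (w ((i : ℕ), (j : ℕ), t₀)) =
            ((Finset.univ.filter fun i : Fin N => w ((i : ℕ), (j : ℕ), t₀) = true).card : ℝ) := by
          simp [coinValue]
        rw [h8]
        exact_mod_cast h7
      rw [Fintype.card_fin]
      linarith
    · have h5 : ∑ q : Fin N × Fin N, z q * (coinValue (w ((q.1 : ℕ), (q.2 : ℕ), t₀)) - p) =
          ∑ q ∈ samplePairs (eventSet S t₀ w) N, v q.1 q.2 t₀ -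
            p * ∑ q ∈ samplePairs S N, v q.1 q.2 t₀ := by
        have h6 : ∀ q : Fin N × Fin N,
            z q * (coinValue (w ((q.1 : ℕ), (q.2 : ℕ), t₀)) - p) =
            (if q ∈ samplePairs (eventSet S t₀ w) N then v q.1 q.2 t₀ else 0) -
              p * if q ∈ samplePairs S N then v q.1 q.2 t₀ else 0 := by
          intro q
          by_cases hqS : q ∈ samplePairs S N
          · have hqS' := hqS
            rw [mem_samplePairs] at hqS'
            by_cases hqw : w ((q.1 : ℕ), (q.2 : ℕ), t₀) = true
            · have hqE : q ∈ samplePairs (eventSet S t₀ w) N := by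
                rw [mem_samplePairs, mem_eventSet]
                exact ⟨hqS'.1, hqS'.2, hqw⟩
              simp only [hz, if_pos hqS, if_pos hqE, coinValue, if_pos hqw]
              ring
            · have hqE : q ∉ samplePairs (eventSet S t₀ w) N := by
                rw [mem_samplePairs, mem_eventSet]
                exact fun h => hqw h.2.2
              simp only [hz, if_pos hqS, if_neg hqE, coinValue, if_neg hqw]
              ring
          · have hqE : q ∉ samplePairs (eventSet S t₀ w) N := by
              intro h
              apply hqS
              rw [mem_samplePairs] at h ⊢
              rw [mem_eventSet] at h
              exact ⟨h.1, h.2.1⟩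
            simp only [hz, if_neg hqS, if_neg hqE]
            ring
        simp only [h6, Finset.sum_sub_distrib, ← Finset.mul_sum, Finset.sum_ite_mem,
          Finset.univ_inter]
      simp only [neg_mul, Finset.sum_neg_distrib] at h4
      rw [h5] at h3 h4
      rw [abs_le]
      constructor <;> linarith
  refine (measureReal_mono hsub).trans ?_
  refine (measureReal_union_le _ _).trans ?_
  have e1 : μ.real ((⋃ i, rowBad i) ∪ ⋃ j, colBad j) ≤ 2 * (N * Real.exp (-a * N)) := by
    refine (measureReal_union_le _ _).trans ?_
    have e2 : μ.real (⋃ i, rowBad i) ≤ N * Real.exp (-a * N) := by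
      refine (measureReal_iUnion_fintype_le _).trans ?_
      refine (Finset.sum_le_sum fun i _ => hrowle i).trans (le_of_eq ?_)
      simp
    have e3 : μ.real (⋃ j, colBad j) ≤ N * Real.exp (-a * N) := by
      refine (measureReal_iUnion_fintype_le _).trans ?_
      refine (Finset.sum_le_sum fun i _ => hcolle i).trans (le_of_eq ?_)
      simp
    linarith
  have e4 := measureReal_union_le (μ := μ) upBad downBad
  linarith

end Events

/-! ### The contaminated data-generating process. -/

section ContaminatedModel

variable {K T : ℕ}

/-- Each disturbance is a function of its own coin alone, which gives independence and the moments.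
-/
theorem contaminated_eventSet (S : Set (ℕ × ℕ)) (t₀ : Fin T) (u p : ℝ) (i j : ℕ) (t : Fin T)
    (w : ℕ × ℕ × Fin T → Bool) :
    contaminated S (eventSet S t₀ w) t₀ u p i j t =
      (open Classical in fun c : Bool => if (i, j) ∈ S ∧ t = t₀ then
        (if c = true then u else 1 - p * (u - 1) / (1 - p)) else 1) (w (i, j, t)) := by
  by_cases h : (i, j) ∈ S ∧ t = t₀
  · obtain ⟨h1, h2⟩ := h
    subst h2
    simp [contaminated, h1, mem_eventSet]
  · simp only [contaminated, if_neg h]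

/-- The process with constant conditional mean `l` and contaminated disturbances at the pairs
of `S`. -/
theorem exists_contaminated_process (x : Regressors K T ℕ) {Λ : Set ℝ} {l : ℝ} (hl : l ∈ Λ)
    (hl0 : 0 < l) (S : Set (ℕ × ℕ)) (t₀ : Fin T) {u : ℝ} (hu : 1 ≤ u) (p : unitInterval)
    (hp : (p : ℝ) < 1) (hpu : p * (u - 1) / (1 - p) < (1 : ℝ)) :
    ∃ D : GravityDGP x Λ (coinMeasure (ℕ × ℕ × Fin T) p), D.θ.β = 0 ∧
      (∀ i j t, gravityMean x D.θ i j t = l) ∧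
      ∀ i j t w, D.ω i j t w = contaminated S (eventSet S t₀ w) t₀ u p i j t := by
  classical
  have hp0 : 0 ≤ (p : ℝ) := p.2.1
  have hp' : 0 ≤ p * (u - 1) / (1 - p : ℝ) :=
    div_nonneg (mul_nonneg hp0 (by linarith)) (by linarith)
  set F : ℕ × ℕ × Fin T → Bool → ℝ := fun k c => if (k.1, k.2.1) ∈ S ∧ k.2.2 = t₀ then
    (if c = true then u else 1 - p * (u - 1) / (1 - p)) else 1 with hF
  have hFpos : ∀ k c, 0 < F k c := by
    intro k c
    simp only [hF]
    split_ifs <;> linarith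
  have hFle : ∀ k c, F k c ≤ u := by
    intro k c
    simp only [hF]
    split_ifs <;> linarith
  have hωF : ∀ i j t w, contaminated S (eventSet S t₀ w) t₀ u p i j t = F (i, j, t) (w (i, j, t)) :=
    fun i j t w => contaminated_eventSet S t₀ u p i j t w
  have hmean : ∀ i j t, gravityMean x (⟨0, fun _ _ => Real.log l, fun _ _ => 0, fun _ _ => 0⟩ :
      GravityParams K T ℕ) i j t = l := by
    intro i j t
    simp [gravityMean, Real.exp_log hl0]
  refine ⟨{
    θ := ⟨0, fun _ _ => Real.log l, fun _ _ => 0, fun _ _ => 0⟩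
    ω := fun i j t w => contaminated S (eventSet S t₀ w) t₀ u p i j t
    bounded_effects := ⟨|Real.log l|, fun _ _ => le_rfl, fun _ _ => by simp, fun _ _ => by simp⟩
    mean_mem := fun i j t _ => by rwa [hmean]
    measurable := fun i j t _ => ?_
    pos := fun i j t _ => ae_of_all _ fun w => ?_
    mean_one := fun i j t _ => ?_
    moments := ⟨1, u ^ ((8 : ℝ) + 1), one_pos, fun i j t _ => ?_⟩
    indep := ?_ }, rfl, hmean, fun _ _ _ _ => rfl⟩
  · simp only [hωF]
    exact (measurable_from_top (f := F (i, j, t))).comp (measurable_pi_apply (i, j, t))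
  · rw [hωF]
    exact hFpos _ _
  · simp only [hωF]
    rw [integral_coin (F (i, j, t))]
    simp only [hF]
    have : (1 : ℝ) - p ≠ 0 := by linarith
    split_ifs <;> simp_all
    field_simp
    ring
  · have h1 : ∀ w, ENNReal.ofReal (contaminated S (eventSet S t₀ w) t₀ u p i j t ^ ((8 : ℝ) + 1)) ≤
        ENNReal.ofReal (u ^ ((8 : ℝ) + 1)) := by
      intro w
      rw [hωF]
      exact ENNReal.ofReal_le_ofReal
        (Real.rpow_le_rpow (hFpos _ _).le (hFle _ _) (by norm_num))
    refine (lintegral_mono h1).trans ?_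
    simp
  · simp only [hωF]
    exact iIndepFun_coin (f := fun q : {q : ℕ × ℕ × Fin T // q.1 ≠ q.2.1} => q.1)
      Subtype.val_injective fun q => F q.1

end ContaminatedModel

/-! ### From the gravity model to deviances around a common mean `l`. -/

section Translation

variable {g : ℝ → ℝ} {l : ℝ}

theorem continuous_weight (hg : ContinuousOn g (Set.Ioi 0)) (hl : 0 < l) :
    Continuous fun τ => g (l * Real.exp τ) :=
  hg.comp_continuous (by fun_prop) fun τ => Set.mem_Ioi.2 (by positivity)

theorem hasDerivAt_integral_weight {f : ℝ → ℝ} (hf : ContinuousOn f (Set.Ioi 0)) (hl : 0 < l)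
    (δ : ℝ) : HasDerivAt (fun δ => ∫ s in (1 : ℝ)..(l * Real.exp δ), f s)
      (f (l * Real.exp δ) * (l * Real.exp δ)) δ := by
  have hpos : 0 < l * Real.exp δ := by positivity
  have h1 : HasDerivAt (fun r => ∫ s in (1 : ℝ)..r, f s) (f (l * Real.exp δ)) (l * Real.exp δ) := by
    refine intervalIntegral.integral_hasDerivAt_right ?_ ?_ ?_
    · refine (hf.mono fun s hs => ?_).intervalIntegrable
      rw [Set.mem_uIcc] at hs
      rw [Set.mem_Ioi]
      rcases hs with hs | hs <;> linarith
    · exact hf.stronglyMeasurableAtFilter isOpen_Ioi _ (Set.mem_Ioi.2 hpos)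
    · exact hf.continuousAt (Ioi_mem_nhds hpos)
  exact h1.comp δ ((Real.hasDerivAt_exp δ).const_mul l)

/-- The pseudo-likelihood of an observation is, up to a constant, minus its deviance. -/
theorem logLik_eq_sub_deviance (hg : ContinuousOn g (Set.Ioi 0)) (hl : 0 < l) (ω δ : ℝ) :
    l * ω * (∫ s in (1 : ℝ)..(l * Real.exp δ), g s / s) - (∫ s in (1 : ℝ)..(l * Real.exp δ), g s) =
      l * ω * (∫ s in (1 : ℝ)..l, g s / s) - (∫ s in (1 : ℝ)..l, g s) -
        l * deviance (fun τ => g (l * Real.exp τ)) ω δ := by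
  set k : ℝ → ℝ := fun δ => l * ω * (∫ s in (1 : ℝ)..(l * Real.exp δ), g s / s) -
    (∫ s in (1 : ℝ)..(l * Real.exp δ), g s) + l * deviance (fun τ => g (l * Real.exp τ)) ω δ with hk
  have hdiv : ContinuousOn (fun s => g s / s) (Set.Ioi 0) :=
    hg.div continuousOn_id fun s hs => (ne_of_gt hs)
  have hderiv : ∀ δ, HasDerivAt k 0 δ := by
    intro δ
    have h1 := ((hasDerivAt_integral_weight hdiv hl δ).const_mul (l * ω)).sub
      (hasDerivAt_integral_weight hg hl δ)
    have h2 := (hasDerivAt_deviance (continuous_weight hg hl) ω δ).const_mul l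
    refine (h1.add h2).congr_deriv ?_
    have hpos : l * Real.exp δ ≠ 0 := by positivity
    rw [div_mul_cancel₀ _ hpos]
    ring
  -- Both sides have the same derivative in `δ` and agree at zero.
  have hconst := is_const_of_deriv_eq_zero (fun δ => (hderiv δ).differentiableAt)
    (fun δ => (hderiv δ).deriv) δ 0
  simp only [hk, Real.exp_zero, mul_one, deviance_zero, mul_zero, add_zero] at hconst
  linarith

end Translation

section Recentred

variable {K T N : ℕ} {g : ℝ → ℝ} {l : ℝ} {x : Regressors K T (Fin N)}
  {y ω : Fin N → Fin N → Fin T → ℝ} {θ : GravityParams K T (Fin N)}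

/-- The log-deviation of the fitted mean from `l`. -/
noncomputable def logDeviation (x : Regressors K T (Fin N)) (θ : GravityParams K T (Fin N))
    (l : ℝ) :
    Fin N → Fin N → Fin T → ℝ :=
  fittedLog (fun i j t => inner ℝ (x i j t) θ.β) θ.α θ.γ fun i j => θ.η i j - Real.log l

theorem gravityMean_eq_mul_exp (hl : 0 < l) (i j : Fin N) (t : Fin T) :
    gravityMean x θ i j t = l * Real.exp (logDeviation x θ l i j t) := by
  rw [gravityMean, ← Real.exp_log hl, ← Real.exp_add, Real.exp_log hl]
  congr 1
  simp only [logDeviation, fittedLog]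
  ring

theorem weighted_residual_eq (hl : 0 < l) {i j : Fin N} {t : Fin T}
    (hy : y i j t = l * ω i j t) :
    (y i j t - gravityMean x θ i j t) * g (gravityMean x θ i j t) =
      l * score (fun τ => g (l * Real.exp τ)) (ω i j t) (logDeviation x θ l i j t) := by
  rw [gravityMean_eq_mul_exp hl, hy, score]
  ring

theorem SolvesFOC.fixedEffectFOC (hθ : SolvesFOC g x y θ) (hl : 0 < l)
    (hy : ∀ i j t, i ≠ j → y i j t = l * ω i j t) :
    FixedEffectFOC fun i j t =>
      score (fun τ => g (l * Real.exp τ)) (ω i j t) (logDeviation x θ l i j t) := by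
  refine ⟨fun i t => ?_, fun j t => ?_, fun i j hij => ?_⟩
  · have h := hθ.foc_α i t
    rw [Finset.sum_congr rfl fun j hj =>
      weighted_residual_eq hl (hy i j t (Finset.ne_of_mem_erase hj).symm), ← Finset.mul_sum] at h
    exact (mul_eq_zero.1 h).resolve_left hl.ne'
  · have h := hθ.foc_γ j t
    rw [Finset.sum_congr rfl fun i hi =>
      weighted_residual_eq hl (hy i j t (Finset.ne_of_mem_erase hi)), ← Finset.mul_sum] at h
    exact (mul_eq_zero.1 h).resolve_left hl.ne'
  · have h := hθ.foc_η i j hij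
    rw [Finset.sum_congr rfl fun t _ => weighted_residual_eq hl (hy i j t hij),
      ← Finset.mul_sum] at h
    exact (mul_eq_zero.1 h).resolve_left hl.ne'

theorem SolvesFOC.sum_inner_mul_score (hθ : SolvesFOC g x y θ) (hl : 0 < l)
    (hy : ∀ i j t, i ≠ j → y i j t = l * ω i j t) (b : EuclideanSpace ℝ (Fin K)) :
    ∑ q ∈ Finset.univ.offDiag, ∑ t, inner ℝ (x q.1 q.2 t) b *
      score (fun τ => g (l * Real.exp τ)) (ω q.1 q.2 t) (logDeviation x θ l q.1 q.2 t) = 0 := by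
  have h := congrArg (fun z => inner ℝ z b) hθ.foc_β
  simp only [sum_inner, inner_zero_left, real_inner_smul_left] at h
  rw [sum_offDiag_eq fun i j => ∑ t, inner ℝ (x i j t) b *
    score (fun τ => g (l * Real.exp τ)) (ω i j t) (logDeviation x θ l i j t)]
  refine (mul_eq_zero.1 (?_ : l * _ = 0)).resolve_left hl.ne'
  rw [← h, Finset.mul_sum]
  refine Finset.sum_congr rfl fun i _ => ?_
  rw [Finset.mul_sum]
  refine Finset.sum_congr rfl fun j hj => ?_
  rw [Finset.mul_sum]
  refine Finset.sum_congr rfl fun t _ => ?_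
  rw [weighted_residual_eq hl (hy i j t (Finset.ne_of_mem_erase hj).symm)]
  ring

theorem SolvesFOC.sum_residual_mul_score (hθ : SolvesFOC g x y θ) (hl : 0 < l)
    (hy : ∀ i j t, i ≠ j → y i j t = l * ω i j t) {b : EuclideanSpace ℝ (Fin K)}
    {v : Fin N → Fin N → Fin T → ℝ} {P Q : Fin N → Fin T → ℝ} {R : Fin N → Fin N → ℝ}
    (hv : ∀ i j t, v i j t = inner ℝ (x i j t) b - P i t - Q j t - R i j) :
    ∑ q ∈ Finset.univ.offDiag, ∑ t, v q.1 q.2 t *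
      score (fun τ => g (l * Real.exp τ)) (ω q.1 q.2 t) (logDeviation x θ l q.1 q.2 t) = 0 := by
  have h1 := hθ.sum_inner_mul_score hl hy b
  have h2 := (hθ.fixedEffectFOC hl hy).sum_mul_eq_zero P Q R
  refine Eq.trans ?_ ((congrArg₂ (· - ·) h1 h2).trans (sub_zero 0))
  rw [← Finset.sum_sub_distrib]
  refine Finset.sum_congr rfl fun q _ => ?_
  rw [← Finset.sum_sub_distrib]
  refine Finset.sum_congr rfl fun t _ => ?_
  rw [hv]
  ring

theorem pseudoLogLik_eq_sub_deviance (hg : ContinuousOn g (Set.Ioi 0)) (hl : 0 < l)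
    (hy : ∀ i j t, i ≠ j → y i j t = l * ω i j t) :
    pseudoLogLik g x y θ =
      ∑ q ∈ Finset.univ.offDiag, ∑ t : Fin T,
        (l * ω q.1 q.2 t * (∫ s in (1 : ℝ)..l, g s / s) - ∫ s in (1 : ℝ)..l, g s) -
      l * ∑ q ∈ Finset.univ.offDiag, ∑ t,
        deviance (fun τ => g (l * Real.exp τ)) (ω q.1 q.2 t) (logDeviation x θ l q.1 q.2 t) := by
  rw [pseudoLogLik, ← sum_offDiag_eq fun i j => ∑ t, (y i j t *
      (∫ s in (1 : ℝ)..(gravityMean x θ i j t), g s / s) -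
      ∫ s in (1 : ℝ)..(gravityMean x θ i j t), g s), Finset.mul_sum, ← Finset.sum_sub_distrib]
  refine Finset.sum_congr rfl fun q hq => ?_
  rw [Finset.mul_sum, ← Finset.sum_sub_distrib]
  refine Finset.sum_congr rfl fun t _ => ?_
  rw [hy _ _ _ (Finset.mem_offDiag.1 hq).2.2, gravityMean_eq_mul_exp hl,
    logLik_eq_sub_deviance hg hl]

/-- Only competitors with the same slope are needed; with the regression part held fixed, maximality
becomes a minimization over fixed effects alone. -/
theorem IsFEPML.minimizesDeviance (hθ : IsFEPML g x y θ) (hg : ContinuousOn g (Set.Ioi 0))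
    (hl : 0 < l) (hy : ∀ i j t, i ≠ j → y i j t = l * ω i j t) :
    MinimizesDeviance (fun τ => g (l * Real.exp τ)) ω (fun i j t => inner ℝ (x i j t) θ.β)
      θ.α θ.γ fun i j => θ.η i j - Real.log l := by
  intro P' Q' R'
  have h := hθ.isMax ⟨θ.β, P', Q', fun i j => R' i j + Real.log l⟩
  rw [pseudoLogLik_eq_sub_deviance hg hl hy, pseudoLogLik_eq_sub_deviance hg hl hy] at h
  have h' := le_of_mul_le_mul_left (sub_le_sub_iff_left _ |>.1 h) hl
  simpa only [logDeviation, add_sub_cancel_right] using h'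

end Recentred

/-! ### Restricting the process to the first `N` countries. -/

section Contamination

variable {T N : ℕ}

theorem contaminated_samplePairs (S E : Set (ℕ × ℕ)) (t₀ : Fin T) (u p : ℝ) {i j : Fin N}
    (hij : i ≠ j) (t : Fin T) :
    contaminated (↑(samplePairs S N)) (↑(samplePairs E N)) t₀ u p i j t =
      contaminated S E t₀ u p (i : ℕ) (j : ℕ) t := by
  have h : ∀ A : Set (ℕ × ℕ), (i, j) ∈ (↑(samplePairs A N) : Set (Fin N × Fin N)) ↔
      ((i : ℕ), (j : ℕ)) ∈ A := by
    intro A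
    rw [Finset.mem_coe, mem_samplePairs]
    exact and_iff_right hij
  rw [contaminated, contaminated, propext (h S), propext (h E)]

theorem sum_samplePairs (S : Set (ℕ × ℕ)) [DecidablePred (· ∈ S)] (f : Fin N × Fin N → ℝ) :
    ∑ q ∈ samplePairs S N, f q = ∑ q ∈ (Finset.univ : Finset (Fin N)).offDiag,
      if ((q.1 : ℕ), (q.2 : ℕ)) ∈ S then f q else 0 := by
  rw [← Finset.sum_filter]
  refine Finset.sum_congr ?_ fun _ _ => rfl
  ext q
  simp [mem_samplePairs]

end Contamination

/-- Three events of probability above `2/3` have a common point. -/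
theorem exists_not_of_measureReal_le {Ω : Type*} [MeasurableSpace Ω] {μ : Measure Ω}
    [IsProbabilityMeasure μ] {p q r : Ω → Prop} (hp : μ.real {w | p w} ≤ 1 / 8)
    (hq : μ.real {w | q w} ≤ 1 / 8) (hr : μ.real {w | r w} ≤ 1 / 8) :
    ∃ w, ¬ p w ∧ ¬ q w ∧ ¬ r w := by
  by_contra! hcon
  have huniv : (Set.univ : Set Ω) ⊆ ({w | p w} ∪ {w | q w}) ∪ {w | r w} := by
    intro w _
    simp only [Set.mem_union, Set.mem_ofPred_eq]
    by_cases h1 : p w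
    · exact Or.inl (Or.inl h1)
    · by_cases h2 : q w
      · exact Or.inl (Or.inr h2)
      · exact Or.inr (hcon w h1 h2)
  have h1 := measureReal_mono (μ := μ) huniv
  have h2 := measureReal_union_le (μ := μ) ({w | p w} ∪ {w | q w}) {w | r w}
  have h3 := measureReal_union_le (μ := μ) {w | p w} {w | q w}
  rw [probReal_univ] at h1
  linarith

/-! ### Constancy of the weight and conclusion. -/

section Main

variable {K T : ℕ} {x : Regressors K T ℕ} {g : ℝ → ℝ} {Λ : Set ℝ} {est : GravityEstimator K T}

/-- Only the smaller value `l₁` has to be a possible conditional mean; `l₂` arises as the fitted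
mean of the shocked pairs. The order matters because the shocks exceed one and so raise the pair
average. -/
theorem weight_eq_of_lt (hK : 0 < K) (hx : RegularRegressors x)
    (hg_cont : ContinuousOn g (Set.Ioi 0)) (hg_pos : ∀ l : ℝ, 0 < l → 0 < g l)
    (hest : ∀ (Ω : Type) [MeasurableSpace Ω] (P : Measure Ω) [IsProbabilityMeasure P]
      (D : GravityDGP x Λ P), IsFEPMLEstimatorUnder g D est)
    (hcons : ∀ (Ω : Type) [MeasurableSpace Ω] (P : Measure Ω) [IsProbabilityMeasure P]
      (D : GravityDGP x Λ P), IsConsistentUnder D est)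
    {l₁ l₂ : ℝ} (hl₁ : l₁ ∈ Λ) (hl : 0 < l₁) (hlt : l₁ < l₂) : g l₂ = g l₁ := by
  classical
  by_contra hne
  obtain ⟨B, c₀, t₀, S, hB, hc₀, hxB, hfreq⟩ := hx.exists_correlated_pairs hK
  have hT : (0 : ℝ) < T := Nat.cast_pos.2 (Fin.pos t₀)
  -- This solves `(u + T - 1) / T = l₂ / l₁`.
  set u : ℝ := T * (l₂ / l₁ - 1) + 1 with hu_def
  have hz1 : 1 < l₂ / l₁ := (one_lt_div hl).2 hlt
  have hu : 1 < u := by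
    have := mul_pos hT (sub_pos.2 hz1)
    linarith
  have huz : (u + T - 1) / T = l₂ / l₁ := by
    rw [hu_def]
    field_simp
    ring
  have hz : (fun τ => g (l₁ * Real.exp τ)) (Real.log ((u + T - 1) / T)) ≠
      (fun τ => g (l₁ * Real.exp τ)) 0 := by
    simp only [Real.exp_zero, mul_one]
    rwa [huz, Real.exp_log (by linarith), mul_div_cancel₀ _ hl.ne']
  obtain ⟨p, ξ₀, lam, N₀, hp0, hp12, hpu, hξ₀, hlam, hcontra⟩ :=
    exists_contamination_contradiction (continuous_weight hg_cont hl)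
      (fun τ => hg_pos _ (by positivity)) T hu hz hB hc₀
  obtain ⟨p, rfl⟩ : ∃ p' : unitInterval, (p' : ℝ) = p := ⟨⟨p, hp0.le, by linarith⟩, rfl⟩
  obtain ⟨D, hDβ, hDmean, hDω⟩ := exists_contaminated_process x hl₁ hl S t₀ hu.le p
    (by linarith) (by linarith)
  let μ := coinMeasure (ℕ × ℕ × Fin T) p
  have hfe : ∀ᶠ N : ℕ in atTop, μ.real {w | ¬ IsFEPML g (sampleRegressors x N) (D.sample N w)
      (est N (D.sample N w))} ≤ 1 / 8 := by
    have h := (ENNReal.tendsto_toReal_zero_iff fun N => measure_ne_top _ _).2 (hest _ μ D)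
    exact (h.eventually_lt_const (by norm_num : (0 : ℝ) < 1 / 8)).mono fun N hN => hN.le
  have hco : ∀ᶠ N : ℕ in atTop, μ.real {w | ξ₀ / B ≤ ‖(est N (D.sample N w)).β - D.θ.β‖} ≤
      1 / 8 := by
    have h := tendstoInMeasure_iff_measureReal_norm.1 (hcons _ μ D) (ξ₀ / B) (by positivity)
    exact (h.eventually_lt_const (by norm_num : (0 : ℝ) < 1 / 8)).mono fun N hN => hN.le
  have hreg := eventually_events_regular S t₀ (p := p) hp0 hB hlam
    (by norm_num : (0 : ℝ) < 1 / 8)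
  -- Correlation with `S` holds only for infinitely many `N`, everything else for all large `N`; one
  -- common `N` suffices.
  obtain ⟨N, ⟨b, v, P, Q, R, hv, hres, hcorr⟩, ⟨⟨hfeN, hcoN⟩, hregN⟩, hN⟩ :=
    (hfreq.and_eventually (((hfe.and hco).and hreg).and
      (eventually_ge_atTop ⌈N₀⌉₊))).exists
  obtain ⟨w, hw1, hw2, hw3⟩ := exists_not_of_measureReal_le hfeN hcoN (hregN v hres.bound)
  rw [not_not] at hw1 hw3
  obtain ⟨hsparse, hdiff⟩ := hw3
  rw [hDβ, sub_zero, not_le] at hw2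
  set θ := est N (D.sample N w) with hθ
  set E := eventSet S t₀ w with hE
  have hy : ∀ i j t, i ≠ j → D.sample N w i j t =
      l₁ * contaminated (↑(samplePairs S N)) (↑(samplePairs E N)) t₀ u p i j t := by
    intro i j t hij
    rw [GravityDGP.sample, if_neg hij, hDmean, hDω, contaminated_samplePairs S E t₀ u p hij]
  refine hcontra (S := samplePairs S N) (E := samplePairs E N) (v := v) ?_ ?_ ?_ hsparse ?_
    (hw1.minimizesDeviance hg_cont hl hy) (hw1.solvesFOC.fixedEffectFOC hl hy) hres
    (hw1.solvesFOC.sum_residual_mul_score hl hy hv) ?_ ?_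
  · rw [Fintype.card_fin]
    exact (Nat.le_ceil _).trans (Nat.cast_le.2 hN)
  · intro q hq
    rw [mem_samplePairs] at hq ⊢
    exact ⟨hq.1, (mem_eventSet.1 hq.2).1⟩
  · intro q hq
    rw [mem_samplePairs] at hq
    simpa using hq.1
  · intro i j t
    calc |inner ℝ (sampleRegressors x N i j t) θ.β|
        ≤ ‖sampleRegressors x N i j t‖ * ‖θ.β‖ := abs_real_inner_le_norm _ _
      _ ≤ B * (ξ₀ / B) := mul_le_mul (hxB _ _ _) hw2.le (norm_nonneg _) hB.le
      _ = ξ₀ := mul_div_cancel₀ _ hB.ne'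
  · rw [Fintype.card_fin, sum_samplePairs]
    convert hcorr
  · rw [Fintype.card_fin]
    exact hdiff

/-- Where the weight is a nonzero constant, the first-order conditions are those of weight `1`. -/
theorem solvesFOC_iff_of_const {N : ℕ} {x : Regressors K T (Fin N)}
    {y : Fin N → Fin N → Fin T → ℝ} {θ : GravityParams K T (Fin N)} {c : ℝ} (hc : c ≠ 0)
    (h : ∀ i j t, i ≠ j → g (gravityMean x θ i j t) = c) :
    SolvesFOC g x y θ ↔ SolvesFOC (fun _ => 1) x y θ := by
  have hβ : ∑ i, ∑ j ∈ Finset.univ.erase i, ∑ t,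
      ((y i j t - gravityMean x θ i j t) * g (gravityMean x θ i j t)) • x i j t =
      c • ∑ i, ∑ j ∈ Finset.univ.erase i, ∑ t,
        ((y i j t - gravityMean x θ i j t) * 1) • x i j t := by
    simp only [Finset.smul_sum, smul_smul]
    refine Finset.sum_congr rfl fun i _ => Finset.sum_congr rfl fun j hj =>
      Finset.sum_congr rfl fun t _ => ?_
    rw [h i j t (Finset.ne_of_mem_erase hj).symm, mul_one, mul_comm]
  have hα : ∀ i t, ∑ j ∈ Finset.univ.erase i,
      (y i j t - gravityMean x θ i j t) * g (gravityMean x θ i j t) =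
      c * ∑ j ∈ Finset.univ.erase i, (y i j t - gravityMean x θ i j t) * 1 := by
    intro i t
    rw [Finset.mul_sum]
    refine Finset.sum_congr rfl fun j hj => ?_
    rw [h i j t (Finset.ne_of_mem_erase hj).symm, mul_one, mul_comm]
  have hγ : ∀ j t, ∑ i ∈ Finset.univ.erase j,
      (y i j t - gravityMean x θ i j t) * g (gravityMean x θ i j t) =
      c * ∑ i ∈ Finset.univ.erase j, (y i j t - gravityMean x θ i j t) * 1 := by
    intro j t
    rw [Finset.mul_sum]
    refine Finset.sum_congr rfl fun i hi => ?_
    rw [h i j t (Finset.ne_of_mem_erase hi), mul_one, mul_comm]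
  have hη : ∀ i j, i ≠ j → ∑ t,
      (y i j t - gravityMean x θ i j t) * g (gravityMean x θ i j t) =
      c * ∑ t, (y i j t - gravityMean x θ i j t) * 1 := by
    intro i j hij
    rw [Finset.mul_sum]
    refine Finset.sum_congr rfl fun t _ => ?_
    rw [h i j t hij, mul_one, mul_comm]
  constructor
  · intro hs
    refine ⟨?_, fun i t => ?_, fun j t => ?_, fun i j hij => ?_⟩
    · exact (smul_eq_zero.1 (hβ.symm.trans hs.foc_β)).resolve_left hc
    · exact (mul_eq_zero.1 ((hα i t).symm.trans (hs.foc_α i t))).resolve_left hc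
    · exact (mul_eq_zero.1 ((hγ j t).symm.trans (hs.foc_γ j t))).resolve_left hc
    · exact (mul_eq_zero.1 ((hη i j hij).symm.trans (hs.foc_η i j hij))).resolve_left hc
  · intro hs
    refine ⟨?_, fun i t => ?_, fun j t => ?_, fun i j hij => ?_⟩
    · rw [hβ, hs.foc_β, smul_zero]
    · rw [hα, hs.foc_α, mul_zero]
    · rw [hγ, hs.foc_γ, mul_zero]
    · rw [hη i j hij, hs.foc_η i j hij, mul_zero]

end Main

theorem proposition2 {K T : ℕ} (hK : 0 < K) (x : Regressors K T ℕ) (hx : RegularRegressors x)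
    (g : ℝ → ℝ) (hg_cont : ContinuousOn g (Set.Ioi 0)) (hg_pos : ∀ l : ℝ, 0 < l → 0 < g l)
    (Λ : Set ℝ) (hΛ : Λ ⊆ Set.Ioi 0)
    (est : GravityEstimator K T)
    (hest : ∀ (Ω : Type) [MeasurableSpace Ω] (P : Measure Ω) [IsProbabilityMeasure P]
      (D : GravityDGP x Λ P), IsFEPMLEstimatorUnder g D est)
    (hcons : ∀ (Ω : Type) [MeasurableSpace Ω] (P : Measure Ω) [IsProbabilityMeasure P]
      (D : GravityDGP x Λ P), IsConsistentUnder D est) :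
    (∃ c : ℝ, ∀ l ∈ Λ, g l = c) ∧
      ∀ (N : ℕ) (y : Fin N → Fin N → Fin T → ℝ) (θ : GravityParams K T (Fin N)),
        (∀ i j t, i ≠ j → gravityMean (sampleRegressors x N) θ i j t ∈ Λ) →
          (SolvesFOC g (sampleRegressors x N) y θ ↔
            SolvesFOC (fun _ => 1) (sampleRegressors x N) y θ) := by
  -- The constant must be nonzero for the first-order conditions to be equivalent, so the empty `Λ`
  -- is given the value one.
  have hc : ∃ c : ℝ, c ≠ 0 ∧ ∀ l ∈ Λ, g l = c := by
    rcases Λ.eq_empty_or_nonempty with rfl | ⟨l₀, hl₀⟩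
    · exact ⟨1, one_ne_zero, fun l hl => absurd hl (Set.notMem_empty l)⟩
    · refine ⟨g l₀, (hg_pos _ (hΛ hl₀)).ne', fun l hl => ?_⟩
      rcases lt_trichotomy l₀ l with h | h | h
      · exact weight_eq_of_lt hK hx hg_cont hg_pos hest hcons hl₀ (hΛ hl₀) h
      · rw [h]
      · exact (weight_eq_of_lt hK hx hg_cont hg_pos hest hcons hl (hΛ hl) h).symm
  obtain ⟨c, hc0, hc⟩ := hc
  exact ⟨⟨c, hc⟩, fun N y θ hθ => solvesFOC_iff_of_const hc0 fun i j t hij => hc _ (hθ i j t hij)⟩
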